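/- All graphs are finite, simple and undirected. The rank and the spectral radius $\rho(G)$ of a graph $G$ are the rank and the spectral radius of its adjacency matrix. For a graph $G$ with vertices $v_1,\dots,v_k$ and positive integers $n_1,\dots,n_k$, let $G\circ(n_1,\dots,n_k)$ be the graph obtained from $G$ by replacing each $v_i$ with an independent set $V_i$ of $n_i$ vertices and joining every vertex of $V_i$ to every vertex of $V_j$ if and only if $v_iv_j\in E(G)$. Let $G_1$ be the graph on $v_1,\dots,v_5$ with edges $v_1v_2,\ v_1v_3,\ v_1v_4,\ v_2v_4,\ v_3v_5$, and let $G_{10}$ be the graph on $v_1,\dots,v_6$ with edges $v_1v_2,\ v_1v_3,\ v_1v_4,\ v_2v_3,\ v_2v_5,\ v_3v_5,\ v_4v_6$. Theorem. Let $n\ge 5$. Among all connected graphs of order $n$ and rank $5$, the minimum spectral radius is attained by exactly one graph up to isomorphism, namely: - the cycle $C_5$, if $n=5$; - $G_1\circ(1,1,1,1,n-4)$, if $6\le n\le 10$; - $G_{10}\circ(1,1,1,1,1,n-5)$, if $n=11$; - $G_{10}\circ(1,1,1,1,k,n-k-4)$ for some $k\in\left\{\left\lfloor\frac{6n-37-\sqrt{24n+1}}{18}\right\rfloor,\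 \left\lceil\frac{6n-37-\sqrt{24n+1}}{18}\right\rceil\right\}$, if $n\ge 12$. -/

import Mathlib

universe u

namespace RankFive

/-- The rank of a graph: the rank of its (real) adjacency matrix. -/
noncomputable def graphRank {V : Type*} [Fintype V] (G : SimpleGraph V) : ℕ :=
  open Classical in (G.adjMatrix ℝ).rank

/-- The spectral radius of a graph: the spectral radius of its adjacency matrix. The matrix is
real symmetric, so all its complex eigenvalues are real and the spectrum over `ℝ` is the whole
spectrum. -/
noncomputable def graphSpectralRadius {V : Type*} [Fintype V] (G : SimpleGraph V) : ENNReal :=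
  open Classical in spectralRadius ℝ (G.adjMatrix ℝ)

/-- Multiplication of vertices `G ∘ m`: the vertex `i` is replaced with an independent set of
`m i` vertices, and copies of `i` and `j` are joined exactly when `i` and `j` are adjacent. -/
def blowup {ι : Type*} (G : SimpleGraph ι) (m : ι → ℕ) : SimpleGraph (Σ i, Fin (m i)) where
  Adj a b := G.Adj a.1 b.1
  symm := ⟨fun _ _ h => G.symm.symm _ _ h⟩
  loopless := ⟨fun a h => G.loopless.irrefl a.1 h⟩

/-- A triangle with a pendant path of length two, on the vertices `v₁, …, v₅` (numbered from `0`):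
edges `v₁v₂, v₁v₃, v₁v₄, v₂v₄, v₃v₅`. -/
def G1 : SimpleGraph (Fin 5) :=
  SimpleGraph.fromEdgeSet {s(0, 1), s(0, 2), s(0, 3), s(1, 3), s(2, 4)}

/-- The graph on the vertices `v₁, …, v₆` (numbered from `0`) with edges
`v₁v₂, v₁v₃, v₁v₄, v₂v₃, v₂v₅, v₃v₅, v₄v₆`. -/
def G10 : SimpleGraph (Fin 6) :=
  SimpleGraph.fromEdgeSet
    {s(0, 1), s(0, 2), s(0, 3), s(1, 2), s(1, 4), s(2, 4), s(3, 5)}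

/-- `G` attains the minimum spectral radius among all connected graphs of order `n` and rank `r`
(and is itself such a graph). -/
def IsMinimizer (n r : ℕ) {V : Type*} [Fintype V] (G : SimpleGraph V) : Prop :=
  Fintype.card V = n ∧ G.Connected ∧ graphRank G = r ∧
    ∀ H : SimpleGraph (Fin n), H.Connected → graphRank H = r →
      graphSpectralRadius G ≤ graphSpectralRadius H

/-- `F` is, up to isomorphism, the graph that attains the minimum spectral radius among all
connected graphs of order `n` and rank `r`. -/
def IsTheMinimizer.{v, w} (n r : ℕ) {W : Type w} [Fintype W] (F : SimpleGraph W) : Prop :=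
  IsMinimizer n r F ∧
    ∀ (V : Type v) [Fintype V] (G : SimpleGraph V), IsMinimizer n r G → Nonempty (G ≃g F)

end RankFive

namespace RankFive

/-! A connected graph has a positive eigenvector, and its eigenvalue `t` is the spectral radius. All
lower bounds on `t` come from summing the eigenvalue equation over classes of vertices.

Write P = t² - t - 2m and Q = t² - s. The central claim (`exists_secular`) is that every connected
graph of rank five and order n ≥ 6 has, for some m ≥ 1 and s ≥ 2 with m + s + 2 = n, P > 0 and PQ ≥
2, and that PQ = 2 forces the graph to be G₁₀ ∘ (1,1,1,1,m-1,s-1). The spectral radius of this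
blow-up is the root of PQ = 2 with P > 0 (`isPerron_linkGraph`). Since both factors grow with `t`,
the problem reduces to choosing m.

For the claim, suppose first that the diameter is at most two. Every vertex then starts at least n -
1 walks of length two, so t² ≥ n - 1, which makes PQ > 2 for m = 1 when n ≥ 7; parity of the number
of walks repairs n = 6. Otherwise there are edges px, qy with p, q at distance at least three. The 4
× 4 block on p, x, q, y is invertible, so its Schur complement S has rank one, and S_uv² = S_uu S_vv
dictates the adjacencies (`FarEdges`). Either the graph is a blow-up with up to seven classes and t²
≥ n - 1 again (with t² ≥ n where order six can occur), or it is linked: a complete tripartite graph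
attached to a complete bipartite one (`IsLinked`). Linked graphs satisfy the claim by
`secular_of_tripartite`.

For the choice of m, comparison with m ± 1 gives |P - 2Q| ≤ 2 away from the ends of the range. The
real optimum P = 2Q = 2 has 3t² - t = 2n, whence the square root √(24n + 1), and the optimal integer
m lies within distance one of the real one. Two optimal values of m would force Q = (√5 - 1)/2,
which is arithmetically impossible (`unique_of_lt`).

For n = 5 the same count of walks gives t ≥ 2, with equality only for C₅. -/

/-- The entries of the adjacency matrix, as real numbers. -/
noncomputable def ind {V : Type*} (G : SimpleGraph V) (u v : V) : ℝ :=
  open Classical in if G.Adj u v then 1 else 0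

section Ind

variable {V : Type*} {G : SimpleGraph V} {u v : V}

lemma ind_of_adj (h : G.Adj u v) : ind G u v = 1 := by simp [ind, h]

lemma ind_of_not_adj (h : ¬ G.Adj u v) : ind G u v = 0 := by simp [ind, h]

lemma ind_eq_one_iff : ind G u v = 1 ↔ G.Adj u v := by
  by_cases h : G.Adj u v <;> simp [ind, h]

lemma ind_eq_zero_iff : ind G u v = 0 ↔ ¬ G.Adj u v := by
  by_cases h : G.Adj u v <;> simp [ind, h]

lemma ind_zero_or_one (G : SimpleGraph V) (u v : V) : ind G u v = 0 ∨ ind G u v = 1 := by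
  by_cases h : G.Adj u v <;> simp [ind, h]

lemma ind_nonneg (G : SimpleGraph V) (u v : V) : 0 ≤ ind G u v := by
  rcases ind_zero_or_one G u v with h | h <;> simp [h]

lemma ind_comm (G : SimpleGraph V) (u v : V) : ind G u v = ind G v u := by
  by_cases h : G.Adj u v
  · rw [ind_of_adj h, ind_of_adj h.symm]
  · rw [ind_of_not_adj h, ind_of_not_adj fun h' => h h'.symm]

lemma ind_self (G : SimpleGraph V) (u : V) : ind G u u = 0 := by simp [ind]

lemma ind_iso {W : Type*} {H : SimpleGraph W} (e : G ≃g H) (u v : V) :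
    ind H (e u) (e v) = ind G u v := by
  by_cases h : G.Adj u v
  · rw [ind_of_adj h, ind_of_adj (e.map_adj_iff.mpr h)]
  · rw [ind_of_not_adj h, ind_of_not_adj fun h' => h (e.map_adj_iff.mp h')]

lemma adjMatrix_eq_ind [DecidableRel G.Adj] : G.adjMatrix ℝ = Matrix.of (ind G) := by
  ext u v
  by_cases h : G.Adj u v <;> simp [ind, SimpleGraph.adjMatrix_apply, h]

end Ind

lemma graphRank_eq {V : Type*} [Fintype V] (G : SimpleGraph V) :
    graphRank G = (Matrix.of (ind G)).rank := by
  classical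
  rw [graphRank, adjMatrix_eq_ind]

/-! ### Positive eigenvectors and the spectral radius -/

/-- `x` is a positive eigenvector of the adjacency matrix of `G` with eigenvalue `t`. -/
structure IsPerron {V : Type*} [Fintype V] (G : SimpleGraph V) (t : ℝ) (x : V → ℝ) : Prop where
  pos : ∀ v, 0 < x v
  eq : ∀ v, ∑ u, ind G v u * x u = t * x v

namespace IsPerron

variable {V : Type*} [Fintype V] {G : SimpleGraph V} {t : ℝ} {x : V → ℝ}

lemma nonneg [Nonempty V] (h : IsPerron G t x) : 0 ≤ t := by
  obtain ⟨v⟩ := ‹Nonempty V›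
  have h1 : 0 ≤ t * x v := by
    rw [← h.eq v]
    exact Finset.sum_nonneg fun u _ => mul_nonneg (ind_nonneg _ _ _) (h.pos u).le
  exact nonneg_of_mul_nonneg_left h1 (h.pos v)

/-- Pair the entrywise inequality |k||y| ≤ A|y| with the positive vector x: by symmetry of A the
right side becomes t⟨x, |y|⟩, and ⟨x, |y|⟩ > 0. -/
lemma abs_eigenvalue_le [Nonempty V] (h : IsPerron G t x) {k : ℝ} {y : V → ℝ} (hy : y ≠ 0)
    (hk : ∀ v, ∑ u, ind G v u * y u = k * y v) : |k| ≤ t := by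
  have h1 : ∀ v, |k| * |y v| ≤ ∑ u, ind G v u * |y u| := by
    intro v
    rw [← abs_mul, ← hk v]
    refine (Finset.abs_sum_le_sum_abs _ _).trans (Finset.sum_le_sum fun u _ => ?_)
    rw [abs_mul, abs_of_nonneg (ind_nonneg _ _ _)]
  have h2 : |k| * ∑ v, x v * |y v| ≤ t * ∑ v, x v * |y v| := by
    calc |k| * ∑ v, x v * |y v| = ∑ v, x v * (|k| * |y v|) := by
          rw [Finset.mul_sum]; exact Finset.sum_congr rfl fun v _ => by ring
      _ ≤ ∑ v, x v * ∑ u, ind G v u * |y u| :=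
          Finset.sum_le_sum fun v _ => mul_le_mul_of_nonneg_left (h1 v) (h.pos v).le
      _ = ∑ u, |y u| * ∑ v, ind G u v * x v := by
          simp_rw [Finset.mul_sum]
          rw [Finset.sum_comm]
          refine Finset.sum_congr rfl fun u _ => Finset.sum_congr rfl fun v _ => ?_
          rw [ind_comm G v u]; ring
      _ = t * ∑ v, x v * |y v| := by
          simp_rw [h.eq]
          rw [Finset.mul_sum]; exact Finset.sum_congr rfl fun v _ => by ring
  obtain ⟨w, hw⟩ := Function.ne_iff.mp hy
  have h3 : 0 < ∑ v, x v * |y v| :=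
    Finset.sum_pos' (fun v _ => mul_nonneg (h.pos v).le (abs_nonneg _))
      ⟨w, Finset.mem_univ _, mul_pos (h.pos w) (abs_pos.mpr hw)⟩
  exact le_of_mul_le_mul_right h2 h3

lemma graphSpectralRadius_eq [Nonempty V] (h : IsPerron G t x) :
    graphSpectralRadius G = ENNReal.ofReal t := by
  classical
  have key : ∀ k : ℝ, k ∈ spectrum ℝ (Matrix.of (ind G)) ↔
      ∃ y : V → ℝ, y ≠ 0 ∧ ∀ v, ∑ u, ind G v u * y u = k * y v := by
    intro k
    rw [← Matrix.spectrum_toLin', ← Module.End.hasEigenvalue_iff_mem_spectrum]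
    constructor
    · intro hk
      obtain ⟨y, hy⟩ := hk.exists_hasEigenvector
      refine ⟨y, hy.2, fun v => ?_⟩
      have := congrFun hy.apply_eq_smul v
      simpa [Matrix.toLin'_apply, Matrix.mulVec, dotProduct] using this
    · rintro ⟨y, hy, hyk⟩
      refine Module.End.hasEigenvalue_of_hasEigenvector (x := y) ⟨?_, hy⟩
      rw [Module.End.mem_eigenspace_iff]
      funext v
      simpa [Matrix.toLin'_apply, Matrix.mulVec, dotProduct] using hyk v
  rw [graphSpectralRadius, adjMatrix_eq_ind, spectralRadius]
  apply le_antisymm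
  · refine iSup₂_le fun k hk => ?_
    obtain ⟨y, hy, hyk⟩ := (key k).mp hk
    have := h.abs_eigenvalue_le hy hyk
    rw [ENNReal.ofReal, ENNReal.coe_le_coe, ← NNReal.coe_le_coe, coe_nnnorm, Real.norm_eq_abs]
    exact this.trans (Real.le_coe_toNNReal t)
  · have hx : x ≠ 0 := by
      obtain ⟨v⟩ := ‹Nonempty V›
      exact fun h0 => (h.pos v).ne' (congrFun h0 v)
    refine le_trans (le_of_eq ?_) (le_iSup₂ (f := fun k _ => (‖k‖₊ : ENNReal)) t
      ((key t).mpr ⟨x, hx, h.eq⟩))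
    rw [ENNReal.ofReal, ENNReal.coe_inj]
    ext
    rw [Real.coe_toNNReal _ h.nonneg, coe_nnnorm, Real.norm_eq_abs, abs_of_nonneg h.nonneg]

lemma iso {W : Type*} [Fintype W] {H : SimpleGraph W} (h : IsPerron G t x) (e : H ≃g G) :
    IsPerron H t (fun w => x (e w)) where
  pos w := h.pos _
  eq w := by
    rw [← h.eq (e w), ← e.toEquiv.sum_comp]
    exact Finset.sum_congr rfl fun u _ => by
      rw [← ind_iso e w u]; rfl

end IsPerron

/-- A connected graph has a positive eigenvector. -/
theorem exists_isPerron {V : Type*} [Fintype V] {G : SimpleGraph V} (hG : G.Connected) :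
    ∃ t x, IsPerron G t x := by
  classical
  have := hG.nonempty
  set A : Matrix V V ℝ := Matrix.of (ind G) with hA
  have hAh : A.IsHermitian := by
    ext u v
    simp [hA, ind_comm G u v]
  set T := Matrix.toEuclideanCLM (n := V) (𝕜 := ℝ) A with hT
  have hTs : IsSelfAdjoint T := by
    rw [hT, IsSelfAdjoint, ← map_star]
    congr 1
  have hq : ∀ z : EuclideanSpace ℝ V, T.reApplyInnerSelf z = ∑ v, ∑ u, ind G v u * (z v * z u) := by
    intro z
    rw [ContinuousLinearMap.reApplyInnerSelf_apply, real_inner_comm, hT,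
      Matrix.inner_toEuclideanCLM]
    simp only [RCLike.re_to_real, dotProduct, Matrix.mulVec, Finset.mul_sum, hA, Matrix.of_apply]
    refine Finset.sum_congr rfl fun v _ => Finset.sum_congr rfl fun u _ => ?_
    ring
  obtain ⟨x0, hx0, hmax⟩ := (isCompact_sphere (0 : EuclideanSpace ℝ V) 1).exists_isMaxOn
    (by simp)
    T.reApplyInnerSelf_continuous.continuousOn
  set y : EuclideanSpace ℝ V := WithLp.toLp 2 (fun v => |x0 v|) with hy
  have hyn : ‖y‖ = ‖x0‖ := by
    rw [EuclideanSpace.norm_eq, EuclideanSpace.norm_eq]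
    simp [hy]
  have hx1 : ‖x0‖ = 1 := by simpa using hx0
  have hy0 : y ≠ 0 := by
    rw [← norm_ne_zero_iff, hyn, hx1]; norm_num
  -- Taking absolute values does not lower the quadratic form of a nonnegative matrix, so the
  -- maximizer may be chosen nonnegative.
  have hymax : IsMaxOn T.reApplyInnerSelf (Metric.sphere (0 : EuclideanSpace ℝ V) ‖y‖) y := by
    rw [hyn, hx1]
    intro z hz
    have hz1 : T.reApplyInnerSelf z ≤ T.reApplyInnerSelf x0 := hmax hz
    refine hz1.trans ?_
    rw [hq, hq]
    refine Finset.sum_le_sum fun v _ => Finset.sum_le_sum fun u _ => ?_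
    refine mul_le_mul_of_nonneg_left ?_ (ind_nonneg _ _ _)
    rw [hy]
    simpa [abs_mul] using le_abs_self (x0 v * x0 u)
  have hev := hTs.hasEigenvector_of_isMaxOn hy0 hymax
  set t := ⨆ x : { x : EuclideanSpace ℝ V // x ≠ 0 }, T.rayleighQuotient x with ht
  have heq : ∀ v, ∑ u, ind G v u * |x0 u| = t * |x0 v| := by
    intro v
    have h1 := hev.apply_eq_smul
    have h2 := congrArg (fun z : EuclideanSpace ℝ V => z v) h1
    simp only [ContinuousLinearMap.coe_coe, hT] at h2
    rw [Matrix.ofLp_toEuclideanCLM] at h2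
    simpa [Matrix.mulVec, dotProduct, hA, hy] using h2
  -- A zero of the nonnegative eigenvector spreads to all neighbours, hence over the connected
  -- graph.
  have hprop : ∀ u v, G.Adj u v → x0 v = 0 → x0 u = 0 := by
    intro u v huv hv
    have h1 := heq v
    rw [hv, abs_zero, mul_zero, Finset.sum_eq_zero_iff_of_nonneg
      (fun w _ => mul_nonneg (ind_nonneg _ _ _) (abs_nonneg _))] at h1
    have h2 := h1 u (Finset.mem_univ _)
    rwa [ind_of_adj huv.symm, one_mul, abs_eq_zero] at h2
  refine ⟨t, fun v => |x0 v|, ⟨fun v => abs_pos.mpr fun hv => hy0 ?_, heq⟩⟩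
  have hall : ∀ w, x0 w = 0 := by
    intro w
    obtain ⟨p⟩ := hG.preconnected w v
    induction p with
    | nil => exact hv
    | cons h _ ih => exact hprop _ _ h (ih hv)
  ext w
  simp [hy, hall w]

/-- The rank is invariant under isomorphism. -/
lemma graphRank_iso {V W : Type*} [Fintype V] [Fintype W] {G : SimpleGraph V} {H : SimpleGraph W}
    (e : G ≃g H) : graphRank G = graphRank H := by
  rw [graphRank_eq, graphRank_eq]
  have : Matrix.of (ind G) = (Matrix.of (ind H)).submatrix e.toEquiv e.toEquiv := by
    ext u v
    exact (ind_iso e u v).symm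
  rw [this, Matrix.rank_submatrix]

namespace IsPerron

variable {V : Type*} [Fintype V] {G : SimpleGraph V} {t : ℝ} {x : V → ℝ}

lemma sum_le_mul (h : IsPerron G t x) {u : V} {T : Finset V} (hT : ∀ v ∈ T, G.Adj u v) :
    ∑ v ∈ T, x v ≤ t * x u := by
  rw [← h.eq u]
  calc ∑ v ∈ T, x v = ∑ v ∈ T, ind G u v * x v :=
        Finset.sum_congr rfl fun v hv => by rw [ind_of_adj (hT v hv), one_mul]
    _ ≤ ∑ v, ind G u v * x v := Finset.sum_le_sum_of_subset_of_nonneg (Finset.subset_univ _)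
        fun v _ _ => mul_nonneg (ind_nonneg _ _ _) (h.pos v).le

/-- `E u` collects neighbours of `u` outside the common set `T`; keeping their contribution lets the
case of equality detect superfluous edges. -/
lemma card_mul_sum_add_le [DecidableEq V] (h : IsPerron G t x) {I T : Finset V}
    (hT : ∀ u ∈ I, ∀ v ∈ T, G.Adj u v) (E : V → Finset V)
    (hE : ∀ u ∈ I, ∀ v ∈ E u, G.Adj u v) (hd : ∀ u ∈ I, Disjoint T (E u)) :
    (I.card : ℝ) * ∑ v ∈ T, x v + ∑ u ∈ I, ∑ v ∈ E u, x v ≤ t * ∑ u ∈ I, x u := by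
  rw [← nsmul_eq_mul, ← Finset.sum_const, Finset.mul_sum, ← Finset.sum_add_distrib]
  refine Finset.sum_le_sum fun u hu => ?_
  rw [← Finset.sum_union (hd u hu)]
  refine h.sum_le_mul fun v hv => ?_
  rcases Finset.mem_union.mp hv with hv | hv
  exacts [hT u hu v hv, hE u hu v hv]

lemma card_mul_sum_le (h : IsPerron G t x) {I T : Finset V}
    (hT : ∀ u ∈ I, ∀ v ∈ T, G.Adj u v) :
    (I.card : ℝ) * ∑ v ∈ T, x v ≤ t * ∑ u ∈ I, x u := by
  rw [← nsmul_eq_mul, ← Finset.sum_const, Finset.mul_sum]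
  exact Finset.sum_le_sum fun u hu => h.sum_le_mul (hT u hu)

lemma sum_pos (h : IsPerron G t x) {I : Finset V} (hI : I.Nonempty) : 0 < ∑ v ∈ I, x v :=
  Finset.sum_pos (fun v _ => h.pos v) hI

lemma sum_nonneg (h : IsPerron G t x) (I : Finset V) : 0 ≤ ∑ v ∈ I, x v :=
  Finset.sum_nonneg fun v _ => (h.pos v).le

end IsPerron

/-! ### The secular inequality for linked graphs -/

section Tripartite

variable {t a b c d l : ℝ}

/-- For b = c = 1 the hypothesis reads (t - 2)(t + 1)² > 0, and larger parts only strengthen it. -/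
lemma two_lt_of_tripartite (hb : 1 ≤ b) (hc : 1 ≤ c) (ht : 0 < t)
    (h : (b + c) * t + 2 * (b * c) < t * (t ^ 2 - b * c)) : 2 < t := by
  by_contra! h2
  have hp : 1 ≤ b * c := by nlinarith
  nlinarith [mul_nonneg (sub_nonneg.mpr h2) (sq_nonneg (t + 1)),
    mul_nonneg ht.le (sub_nonneg.mpr hp)]

/-- Replacing the parts of sizes `b`, `c` by single vertices and moving the surplus into the third
part does not increase the value of the secular function. -/
lemma tripartite_le (hb : 1 ≤ b) (hc : 1 ≤ c) (ht : 0 < t)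
    (h : (b + c) * t + 2 * (b * c) < t * (t ^ 2 - b * c)) :
    2 * (t * (t ^ 2 - b * c)) ≤
      ((b + c) * t + 2 * (b * c)) * (t ^ 2 - t - 2 * (b + c - 2)) ∧
    (2 * (t * (t ^ 2 - b * c)) =
      ((b + c) * t + 2 * (b * c)) * (t ^ 2 - t - 2 * (b + c - 2)) → b = 1 ∧ c = 1) := by
  have h2 := two_lt_of_tripartite hb hc ht h
  set e := (b - 1) * (c - 1) with he
  have he0 : 0 ≤ e := mul_nonneg (by linarith) (by linarith)
  set w := t ^ 2 - t - 2 * (b + c - 1) with hw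
  -- This is the hypothesis `h`, rewritten in terms of `e` and `w`.
  have hc1 : e * (t + 2) < (t + 1) * w := by
    rw [he, hw]; nlinarith
  have hwe : e ≤ w := by
    by_contra! hlt
    nlinarith
  have hbr : 0 ≤ w + e * t - 2 * e := by nlinarith
  have hid : ((b + c) * t + 2 * (b * c)) * (t ^ 2 - t - 2 * (b + c - 2)) -
      2 * (t * (t ^ 2 - b * c)) = (b + c - 2) * ((t + 1) * w - e * (t + 2)) +
        (b + c - 2) * (w + e * t - 2 * e) + 2 * e * t ^ 2 := by
    rw [he, hw]; ring
  have hs : 0 ≤ b + c - 2 := by linarith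
  have h3 : 0 ≤ (b + c - 2) * ((t + 1) * w - e * (t + 2)) := mul_nonneg hs (by linarith)
  have h4 : 0 ≤ (b + c - 2) * (w + e * t - 2 * e) := mul_nonneg hs hbr
  have h5 : 0 ≤ 2 * e * t ^ 2 := by positivity
  refine ⟨by linarith, fun heq => ?_⟩
  have h6 : (b + c - 2) * ((t + 1) * w - e * (t + 2)) = 0 := by linarith
  rcases mul_eq_zero.mp h6 with h7 | h7
  · constructor <;> linarith
  · linarith

set_option maxHeartbeats 400000 in
/-- The key estimate for a complete tripartite graph with parts of sizes `a`, `b`, `c` linked to a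
complete bipartite graph with parts of sizes `d`, `l`, in terms of the sums of a positive vector
over the parts. -/
lemma secular_of_tripartite {α β γ δ eA eB eC : ℝ} (ha : 1 ≤ a) (hb : 1 ≤ b) (hc : 1 ≤ c)
    (hd : 1 ≤ d) (hl : 1 ≤ l) (ht : 0 < t) (hα : 0 < α) (hβ : 0 < β) (hγ : 0 < γ) (hδ : 0 < δ)
    (heA : δ ≤ eA) (heB : 0 ≤ eB) (heC : 0 ≤ eC)
    (h1 : a * (β + γ) + eA ≤ t * α) (h2 : b * (α + γ) + eB ≤ t * β)
    (h3 : c * (α + β) + eC ≤ t * γ) (h4 : d * (β + γ) ≤ (t ^ 2 - d * (l + 1)) * δ) :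
    0 < t ^ 2 - t - 2 * (a + b + c - 2) ∧
    2 ≤ (t ^ 2 - t - 2 * (a + b + c - 2)) * (t ^ 2 - (d + l)) ∧
    ((t ^ 2 - t - 2 * (a + b + c - 2)) * (t ^ 2 - (d + l)) = 2 →
      d = 1 ∧ b = 1 ∧ c = 1 ∧ eA = δ ∧ eB = 0 ∧ eC = 0) := by
  set s := α + β + γ with hs
  have hs0 : 0 < s := by positivity
  set N := (t + b) * (t + c) with hN
  have hN0 : 0 < N := by positivity
  set K := (b + c) * t + 2 * (b * c) with hK
  have hK0 : 0 < K := by positivity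
  -- `M` is the characteristic polynomial t³ - (ab + bc + ca)t - 2abc of the quotient matrix of the
  -- complete tripartite graph.
  set M := t * (t ^ 2 - b * c) - a * K with hM
  set g := (t + a) * ((t + c) * eB + (t + b) * eC) with hg
  have hg0 : 0 ≤ g := by positivity
  have h1' : a * s + eA ≤ (t + a) * α := by rw [hs]; linarith
  have h2' : b * s + eB ≤ (t + b) * β := by rw [hs]; linarith
  have h3' : c * s + eC ≤ (t + c) * γ := by rw [hs]; linarith
  have h5 : K * s + ((t + c) * eB + (t + b) * eC) ≤ N * (β + γ) := by
    have e1 := mul_le_mul_of_nonneg_left h2' (by positivity : 0 ≤ t + c)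
    have e2 := mul_le_mul_of_nonneg_left h3' (by positivity : 0 ≤ t + b)
    have e3 : N * (β + γ) = (t + c) * ((t + b) * β) + (t + b) * ((t + c) * γ) := by rw [hN]; ring
    have e4 : K * s = (t + c) * (b * s) + (t + b) * (c * s) := by rw [hK]; ring
    linarith
  have h6 : N * eA + g ≤ M * s := by
    have e1 := mul_le_mul_of_nonneg_left h1' hN0.le
    have e2 := mul_le_mul_of_nonneg_left h5 (by positivity : 0 ≤ t + a)
    have e3 : N * ((t + a) * α) + (t + a) * (N * (β + γ)) = (t + a) * N * s := by rw [hs]; ring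
    have e4 : (t + a) * N - N * a - (t + a) * K = M := by rw [hM, hN, hK]; ring
    have e5 : (t + a) * N * s - N * (a * s) - (t + a) * (K * s) = M * s := by rw [← e4]; ring
    have e6 : (t + a) * (K * s + ((t + c) * eB + (t + b) * eC)) = (t + a) * (K * s) + g := by
      rw [hg]; ring
    linarith
  have hM0 : 0 < M := by
    have : 0 < M * s := by
      have : 0 < N * eA := mul_pos hN0 (by linarith)
      linarith
    exact pos_of_mul_pos_left this hs0.le
  have hcond : K < t * (t ^ 2 - b * c) := by
    have : 1 * K ≤ a * K := mul_le_mul_of_nonneg_right ha hK0.le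
    linarith
  obtain ⟨hE, hEeq⟩ := tripartite_le hb hc ht hcond
  set P := t ^ 2 - t - 2 * (a + b + c - 2) with hP
  have hKP : 2 * M ≤ K * P := by
    have : K * P = K * (t ^ 2 - t - 2 * (b + c - 2)) - 2 * (a * K) := by rw [hP]; ring
    linarith
  have hP0 : 0 < P := by
    have : 0 < K * P := by linarith
    exact pos_of_mul_pos_right this hK0.le
  set Qd := t ^ 2 - d * (l + 1) with hQd
  have hQd0 : 0 < Qd := by
    have : 0 < Qd * δ := by
      have : 0 < d * (β + γ) := by positivity
      linarith
    exact pos_of_mul_pos_left this hδ.le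
  set Q := t ^ 2 - (d + l) with hQ
  have hQQ : d * Q = Qd + (d - 1) * (t ^ 2 - d) := by rw [hQ, hQd]; ring
  have htd : 0 < t ^ 2 - d := by
    have : d * 1 ≤ d * (l + 1) := mul_le_mul_of_nonneg_left (by linarith) (by linarith)
    linarith
  have hdQ : Qd ≤ d * Q := by
    have : 0 ≤ (d - 1) * (t ^ 2 - d) := mul_nonneg (by linarith) htd.le
    linarith
  have hQM : d * K * s ≤ Qd * M * s := by
    have e1 : d * (K * s) ≤ d * (N * (β + γ)) := by
      refine mul_le_mul_of_nonneg_left ?_ (by linarith)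
      have : 0 ≤ (t + c) * eB + (t + b) * eC := by positivity
      linarith
    have e2 : N * (d * (β + γ)) ≤ N * (Qd * δ) := mul_le_mul_of_nonneg_left h4 hN0.le
    have e3 : Qd * (N * δ) ≤ Qd * (M * s) := by
      refine mul_le_mul_of_nonneg_left ?_ hQd0.le
      have := mul_le_mul_of_nonneg_left heA hN0.le
      linarith
    linarith
  have hQM' : d * K ≤ Qd * M := le_of_mul_le_mul_right hQM hs0
  have hQ0 : 0 < Q := by
    have : 0 < d * Q := by linarith
    exact pos_of_mul_pos_right this (by linarith)
  -- The chain is 2dK ≤ 2M·Qd ≤ 2M·dQ ≤ KP·dQ; dividing by dK leaves PQ ≥ 2, and PQ = 2 makes every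
  -- link tight.
  have c1 : 2 * M * Qd ≤ 2 * M * (d * Q) := mul_le_mul_of_nonneg_left hdQ (by linarith)
  have c2 : 2 * M * (d * Q) ≤ K * P * (d * Q) :=
    mul_le_mul_of_nonneg_right hKP (by positivity)
  have hdK : 0 < d * K := by positivity
  refine ⟨hP0, ?_, fun heq => ?_⟩
  · have : d * K * 2 ≤ d * K * (P * Q) := by linarith
    exact le_of_mul_le_mul_left this hdK
  have c3 : K * P * (d * Q) = 2 * (d * K) := by
    rw [← heq]; ring
  have q1 : 2 * M * (d * Q) = K * P * (d * Q) := by linarith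
  have q2 : 2 * M = K * P := mul_right_cancel₀ (by positivity) q1
  have q3 : 2 * M * Qd = 2 * M * (d * Q) := by linarith
  have q4 : Qd = d * Q := mul_left_cancel₀ (by positivity) q3
  have q5 : d * K = Qd * M := by linarith
  obtain ⟨rfl, rfl⟩ := hEeq (by rw [hM, hP] at q2; linarith)
  have hd1 : d = 1 := by
    have : (d - 1) * (t ^ 2 - d) = 0 := by linarith
    rcases mul_eq_zero.mp this with h | h <;> linarith
  have q6 : N * δ = M * s := by
    have e1 : d * (K * s) ≤ d * (N * (β + γ)) := by
      refine mul_le_mul_of_nonneg_left ?_ (by linarith)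
      have : 0 ≤ (t + 1) * eB + (t + 1) * eC := by positivity
      linarith
    have e2 : N * (d * (β + γ)) ≤ N * (Qd * δ) := mul_le_mul_of_nonneg_left h4 hN0.le
    have e3 : N * δ ≤ M * s := by
      have := mul_le_mul_of_nonneg_left heA hN0.le
      linarith
    have e4 : d * K * s = Qd * M * s := by rw [q5]
    have e5 : Qd * (M * s) ≤ Qd * (N * δ) := by linarith
    exact le_antisymm e3 (le_of_mul_le_mul_left e5 hQd0)
  have q7 : eA = δ := by
    have : N * eA ≤ N * δ := by linarith
    exact le_antisymm (le_of_mul_le_mul_left this hN0) heA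
  have q8 : g ≤ 0 := by rw [q7] at h6; linarith
  have q9 : (t + 1) * eB + (t + 1) * eC ≤ 0 := by
    by_contra! hlt
    have : 0 < g := by rw [hg]; exact mul_pos (by linarith) hlt
    linarith
  have q10 : eB = 0 ∧ eC = 0 := by
    have p0 : 0 < t + 1 := by linarith
    have p1 : 0 ≤ (t + 1) * eB := by positivity
    have p2 : 0 ≤ (t + 1) * eC := by positivity
    have p3 : (t + 1) * eB = 0 := by linarith
    have p4 : (t + 1) * eC = 0 := by linarith
    exact ⟨(mul_eq_zero.mp p3).resolve_left p0.ne', (mul_eq_zero.mp p4).resolve_left p0.ne'⟩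
  exact ⟨hd1, rfl, rfl, q7, q10.1, q10.2⟩

end Tripartite

/-! ### Rank five as a Schur complement of rank one -/

section Schur

variable {V : Type*} {G : SimpleGraph V}

/-- The Schur complement of the adjacency matrix with respect to the rows and columns `p`, `x`,
`q`, `y`, where `px` and `qy` are edges, `p` and `q` are nonadjacent and have no common
neighbour. -/
noncomputable def schur (G : SimpleGraph V) (p x q y u v : V) : ℝ :=
  ind G u v - ind G u p * ind G x v - ind G u x * ind G p v - ind G u q * ind G y v -
    ind G u y * ind G q v + ind G x y * (ind G u p * ind G q v + ind G u q * ind G p v)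

/-- `px` and `qy` are edges whose ends `p`, `q` are at distance at least three. -/
structure FarEdges (G : SimpleGraph V) (p x q y : V) : Prop where
  px : G.Adj p x
  qy : G.Adj q y
  pq : ¬ G.Adj p q
  common : ∀ w, G.Adj p w → ¬ G.Adj q w

lemma FarEdges.symm {p x q y : V} (h : FarEdges G p x q y) : FarEdges G q y p x :=
  ⟨h.qy, h.px, fun h' => h.pq h'.symm, fun w h1 h2 => h.common w h2 h1⟩

lemma schur_comm (p x q y u v : V) : schur G p x q y u v = schur G p x q y v u := by
  simp only [schur, ind_comm G u, ind_comm G x v, ind_comm G p v, ind_comm G y v, ind_comm G q v]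
  ring

variable [Fintype V]

lemma le_graphRank {k : ℕ} (f : Fin k → V)
    (h : ∀ c : Fin k → ℝ, (∀ v, ∑ i, c i * ind G (f i) v = 0) → ∀ i, c i = 0) :
    k ≤ graphRank G := by
  have hli : LinearIndependent ℝ (fun i => (Matrix.of (ind G)).row (f i)) := by
    rw [Fintype.linearIndependent_iff]
    intro c hc
    refine h c fun v => ?_
    have := congrFun hc v
    simpa [Matrix.row] using this
  have hk := hli.rank_matrix
  have hle : (Matrix.of fun i => (Matrix.of (ind G)).row (f i)).rank ≤
      (Matrix.of (ind G)).rank := by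
    rw [Matrix.rank_eq_finrank_span_row, Matrix.rank_eq_finrank_span_row]
    refine Submodule.finrank_mono (Submodule.span_mono ?_)
    rintro _ ⟨i, rfl⟩
    exact ⟨f i, rfl⟩
  rw [graphRank_eq]
  change (Matrix.of fun i => (Matrix.of (ind G)).row (f i)).rank = _ at hk
  rw [Fintype.card_fin] at hk
  omega

/-- The block on p, x, q, y has determinant 1, so a nonzero 2 × 2 minor of the Schur complement
would make the six rows p, x, q, y, u, u' independent. -/
lemma schur_minor (hr : graphRank G ≤ 5) {p x q y : V} (h : FarEdges G p x q y) (u u' v v' : V) :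
    schur G p x q y u v * schur G p x q y u' v' =
      schur G p x q y u v' * schur G p x q y u' v := by
  by_contra hne
  refine absurd (le_graphRank (G := G) ![p, x, q, y, u, u'] fun c hc => ?_) (by omega)
  have hcol : ∀ w, c 0 * ind G p w + c 1 * ind G x w + c 2 * ind G q w + c 3 * ind G y w +
      c 4 * ind G u w + c 5 * ind G u' w = 0 := by
    intro w
    have := hc w
    simpa [Fin.sum_univ_six] using this
  have epx : ind G p x = 1 := ind_of_adj h.px
  have exp : ind G x p = 1 := ind_of_adj h.px.symm
  have eqy : ind G q y = 1 := ind_of_adj h.qy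
  have eyq : ind G y q = 1 := ind_of_adj h.qy.symm
  have epq : ind G p q = 0 := ind_of_not_adj h.pq
  have eqp : ind G q p = 0 := ind_of_not_adj fun h' => h.pq h'.symm
  have epy : ind G p y = 0 := ind_of_not_adj fun h' => h.common _ h' h.qy
  have eyp : ind G y p = 0 := ind_of_not_adj fun h' => h.common _ h'.symm h.qy
  have eqx : ind G q x = 0 := ind_of_not_adj fun h' => h.common _ h.px h'
  have exq : ind G x q = 0 := ind_of_not_adj fun h' => h.common _ h.px h'.symm
  have eyx : ind G y x = ind G x y := ind_comm _ _ _
  have kp := hcol p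
  have kx := hcol x
  have kq := hcol q
  have ky := hcol y
  simp only [ind_self, epx, exp, eqy, eyq, epq, eqp, epy, eyp, eqx, exq, eyx, mul_zero, mul_one,
    add_zero, zero_add] at kp kx kq ky
  -- Eliminating with the columns p, x, q, y turns a relation among six rows into one between two
  -- rows of the Schur complement.
  have kS : ∀ w, c 4 * schur G p x q y u w + c 5 * schur G p x q y u' w = 0 := by
    intro w
    have kw := hcol w
    simp only [schur]
    linear_combination kw - ind G x w * kp - ind G p w * kx - ind G y w * kq - ind G q w * ky +
      ind G x y * (ind G q w * kp + ind G p w * kq)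
  have k1 := kS v
  have k2 := kS v'
  have hne' : schur G p x q y u v * schur G p x q y u' v' -
    schur G p x q y u v' * schur G p x q y u' v ≠ 0 := sub_ne_zero.mpr hne
  have c4 : c 4 = 0 := by
    refine (mul_eq_zero.mp (?_ : c 4 * (schur G p x q y u v * schur G p x q y u' v' -
      schur G p x q y u v' * schur G p x q y u' v) = 0)).resolve_right hne'
    linear_combination schur G p x q y u' v' * k1 - schur G p x q y u' v * k2
  have c5 : c 5 = 0 := by
    refine (mul_eq_zero.mp (?_ : c 5 * (schur G p x q y u v * schur G p x q y u' v' -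
      schur G p x q y u v' * schur G p x q y u' v) = 0)).resolve_right hne'
    linear_combination schur G p x q y u v * k2 - schur G p x q y u v' * k1
  rw [c4, c5] at kp kx kq ky
  have c1 : c 1 = 0 := by linarith
  have c3 : c 3 = 0 := by linarith
  rw [c3] at kx
  rw [c1] at ky
  have c0 : c 0 = 0 := by linarith
  have c2 : c 2 = 0 := by linarith
  intro i
  fin_cases i
  exacts [c0, c1, c2, c3, c4, c5]

lemma graphRank_le_of_span {k : ℕ} (f : Fin k → V)
    (h : ∀ u, ∃ c : Fin k → ℝ, ∀ v, ind G u v = ∑ i, c i * ind G (f i) v) : graphRank G ≤ k := by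
  classical
  rw [graphRank_eq, Matrix.rank_eq_finrank_span_row]
  have hsub : Submodule.span ℝ (Set.range (Matrix.of (ind G)).row) ≤
      Submodule.span ℝ (Set.range fun i => (Matrix.of (ind G)).row (f i)) := by
    rw [Submodule.span_le]
    rintro _ ⟨u, rfl⟩
    obtain ⟨c, hc⟩ := h u
    have : (Matrix.of (ind G)).row u = ∑ i, c i • (Matrix.of (ind G)).row (f i) := by
      funext v
      simpa [Matrix.row] using hc v
    rw [this]
    exact Submodule.sum_mem _ fun i _ => Submodule.smul_mem _ _
      (Submodule.subset_span ⟨i, rfl⟩)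
  calc _ ≤ _ := Submodule.finrank_mono hsub
    _ ≤ Fintype.card (Fin k) := finrank_range_le_card _
    _ = k := Fintype.card_fin k

/-- A vanishing Schur complement would express every row through the four rows p, x, q, y. -/
lemma exists_schur_ne_zero (hr : 4 < graphRank G) (p x q y : V) :
    ∃ u v, schur G p x q y u v ≠ 0 := by
  by_contra! h0
  refine absurd (graphRank_le_of_span ![p, x, q, y] fun u => ?_) (not_le.mpr hr)
  refine ⟨![ind G u x - ind G x y * ind G u q, ind G u p, ind G u y - ind G x y * ind G u p,
    ind G u q], fun v => ?_⟩
  have := h0 u v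
  simp only [schur] at this
  simp [Fin.sum_univ_four]
  linarith

end Schur

namespace FarEdges

variable {V : Type*} {G : SimpleGraph V} {p x q y : V}

lemma ind_q_of_p (h : FarEdges G p x q y) {u : V} (hu : G.Adj p u) : ind G u q = 0 :=
  ind_of_not_adj fun h' => h.common _ hu h'.symm

lemma ind_p_of_q (h : FarEdges G p x q y) {u : V} (hu : G.Adj q u) : ind G u p = 0 :=
  ind_of_not_adj fun h' => h.common _ h'.symm hu

lemma schur_self (h : FarEdges G p x q y) {u : V} (hu : G.Adj p u) :
    schur G p x q y u u = -2 * ind G x u := by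
  have e1 : ind G u p = 1 := ind_of_adj hu.symm
  have e3 : ind G p u = 1 := ind_of_adj hu
  have e4 : ind G q u = 0 := ind_of_not_adj (h.common _ hu)
  simp only [schur, e1, e3, e4, h.ind_q_of_p hu, ind_self, ind_comm G u x]
  ring

lemma schur_self' (h : FarEdges G p x q y) {v : V} (hv : G.Adj q v) :
    schur G p x q y v v = -2 * ind G y v := by
  have e1 : ind G v q = 1 := ind_of_adj hv.symm
  have e3 : ind G q v = 1 := ind_of_adj hv
  have e4 : ind G p v = 0 := ind_of_not_adj fun h' => h.common _ h' hv
  simp only [schur, e1, e3, e4, h.ind_p_of_q hv, ind_self, ind_comm G v y]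
  ring

lemma schur_inner (h : FarEdges G p x q y) {u v : V} (hu : G.Adj p u) (hv : G.Adj p v) :
    schur G p x q y u v = ind G u v - ind G x v - ind G x u := by
  have e1 : ind G u p = 1 := ind_of_adj hu.symm
  have e3 : ind G p v = 1 := ind_of_adj hv
  have e4 : ind G q v = 0 := ind_of_not_adj (h.common _ hv)
  simp only [schur, e1, e3, e4, h.ind_q_of_p hu, ind_comm G u x]
  ring

lemma schur_cross (h : FarEdges G p x q y) {u v : V} (hu : G.Adj p u) (hv : G.Adj q v) :
    schur G p x q y u v = ind G u v - ind G x v - ind G u y + ind G x y := by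
  have e1 : ind G u p = 1 := ind_of_adj hu.symm
  have e3 : ind G q v = 1 := ind_of_adj hv
  have e4 : ind G p v = 0 := ind_of_not_adj fun h' => h.common _ h' hv
  simp only [schur, e1, e3, e4, h.ind_q_of_p hu]
  ring

variable [Fintype V]

/-- The 2 × 2 minor on rows and columns u, v vanishes. Diagonal entries are 0 or -2, so they fix the
off-diagonal ones up to sign. -/
lemma schur_sq (h : FarEdges G p x q y) (hr : graphRank G = 5) (u v : V) :
    schur G p x q y u v ^ 2 = schur G p x q y u u * schur G p x q y v v := by
  have := schur_minor hr.le h u v v u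
  rw [schur_comm p x q y v u] at this
  rw [sq, this]

lemma schur_eq_zero (h : FarEdges G p x q y) (hr : graphRank G = 5) {w : V}
    (hw : schur G p x q y w w = 0) (v : V) : schur G p x q y w v = 0 := by
  have := h.schur_sq hr w v
  rw [hw, zero_mul] at this
  exact pow_eq_zero_iff two_ne_zero |>.mp this

lemma schur_outer (h : FarEdges G p x q y) (hr : graphRank G = 5) {w : V} (hp : ¬ G.Adj p w)
    (hq : ¬ G.Adj q w) (v : V) : schur G p x q y w v = 0 := by
  refine h.schur_eq_zero hr ?_ v
  have e1 : ind G w p = 0 := ind_of_not_adj fun h' => hp h'.symm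
  have e2 : ind G w q = 0 := ind_of_not_adj fun h' => hq h'.symm
  have e3 : ind G p w = 0 := ind_of_not_adj hp
  have e4 : ind G q w = 0 := ind_of_not_adj hq
  simp [schur, e1, e2, e3, e4, ind_self]

/-- Vertices adjacent to neither `p` nor `q` form an independent set. -/
lemma outer_not_adj (h : FarEdges G p x q y) (hr : graphRank G = 5) {w v : V} (hpw : ¬ G.Adj p w)
    (hqw : ¬ G.Adj q w) (hpv : ¬ G.Adj p v) (hqv : ¬ G.Adj q v) : ¬ G.Adj w v := by
  have h0 := h.schur_outer hr hpw hqw v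
  have e1 : ind G w p = 0 := ind_of_not_adj fun h' => hpw h'.symm
  have e2 : ind G w q = 0 := ind_of_not_adj fun h' => hqw h'.symm
  have e3 : ind G p v = 0 := ind_of_not_adj hpv
  have e4 : ind G q v = 0 := ind_of_not_adj hqv
  rw [← ind_eq_zero_iff]
  simpa [schur, e1, e2, e3, e4] using h0

/-- A vertex adjacent to neither `p` nor `q` sees all neighbours of `p` or none of them. -/
lemma outer_adj_iff (h : FarEdges G p x q y) (hr : graphRank G = 5) {w u : V} (hpw : ¬ G.Adj p w)
    (hqw : ¬ G.Adj q w) (hu : G.Adj p u) : G.Adj w u ↔ G.Adj w x := by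
  have h0 := h.schur_outer hr hpw hqw u
  have e1 : ind G w p = 0 := ind_of_not_adj fun h' => hpw h'.symm
  have e2 : ind G w q = 0 := ind_of_not_adj fun h' => hqw h'.symm
  have e3 : ind G p u = 1 := ind_of_adj hu
  have e4 : ind G q u = 0 := ind_of_not_adj (h.common _ hu)
  simp only [schur, e1, e2, e3, e4] at h0
  rw [← ind_eq_one_iff, ← ind_eq_one_iff]
  have : ind G w u = ind G w x := by linarith
  rw [this]

/-- The neighbourhood of `p` induces a complete bipartite graph. -/
lemma inner_adj_iff (h : FarEdges G p x q y) (hr : graphRank G = 5) {u v : V} (hu : G.Adj p u)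
    (hv : G.Adj p v) : G.Adj u v ↔ ¬ (G.Adj x u ↔ G.Adj x v) := by
  have h0 := h.schur_sq hr u v
  rw [h.schur_self hu, h.schur_self hv, h.schur_inner hu hv] at h0
  rcases ind_zero_or_one G x u with h1 | h1 <;> rcases ind_zero_or_one G x v with h2 | h2 <;>
  rcases ind_zero_or_one G u v with h3 | h3 <;>
  · rw [h1, h2, h3] at h0
    simp only [ind_eq_one_iff, ind_eq_zero_iff] at h1 h2 h3
    first
    | (exfalso; norm_num at h0; done)
    | simp [h1, h2, h3]

/-- One of the two diagonal entries is zero, hence so is the entry at (u, v). -/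
lemma cross_add (h : FarEdges G p x q y) (hr : graphRank G = 5) {u v : V} (hu : G.Adj p u)
    (hv : G.Adj q v) (h1 : ¬ G.Adj x u ∨ ¬ G.Adj y v) :
    ind G u v + ind G x y = ind G x v + ind G u y := by
  have h0 := h.schur_sq hr u v
  rw [h.schur_self hu, h.schur_self' hv, h.schur_cross hu hv] at h0
  have : ind G x u * ind G y v = 0 := by
    rcases h1 with h1 | h1 <;> simp [ind_of_not_adj h1]
  have h2 : (ind G u v - ind G x v - ind G u y + ind G x y) ^ 2 = 0 := by
    rw [h0]; linear_combination 4 * this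
  have := pow_eq_zero_iff two_ne_zero |>.mp h2
  linarith

/-- Both diagonal entries are -2, so the entry at (u, v) is ±2. Being a signed sum of four zero-one
terms, it reaches ±2 only if the two terms of one sign are 1 and the other two are 0. -/
lemma cross_of_adj (h : FarEdges G p x q y) (hr : graphRank G = 5) {u v : V} (hu : G.Adj p u)
    (hv : G.Adj q v) (h1 : G.Adj x u) (h2 : G.Adj y v) :
    (G.Adj x y → G.Adj u v ∧ ¬ G.Adj x v ∧ ¬ G.Adj u y) ∧ (¬ G.Adj x y → G.Adj x v) := by
  have h0 := h.schur_sq hr u v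
  rw [h.schur_self hu, h.schur_self' hv, h.schur_cross hu hv, ind_of_adj h1, ind_of_adj h2] at h0
  rcases ind_zero_or_one G x y with h1 | h1 <;> rcases ind_zero_or_one G x v with h2 | h2 <;>
  rcases ind_zero_or_one G u v with h3 | h3 <;> rcases ind_zero_or_one G u y with h4 | h4 <;>
  · rw [h1, h2, h3, h4] at h0
    simp only [ind_eq_one_iff, ind_eq_zero_iff] at h1 h2 h3 h4
    first
    | (exfalso; norm_num at h0; done)
    | simp [h1, h2, h3, h4]

/-- A nonzero symmetric matrix of rank one has a nonzero diagonal entry, and such an entry sits at a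
neighbour of p adjacent to x or at a neighbour of q adjacent to y. -/
lemma exists_inner_adj (h : FarEdges G p x q y) (hr : graphRank G = 5) :
    (∃ u, G.Adj p u ∧ G.Adj x u) ∨ ∃ v, G.Adj q v ∧ G.Adj y v := by
  obtain ⟨u, v, huv⟩ := exists_schur_ne_zero (G := G) (by omega) p x q y
  have hu0 : schur G p x q y u u ≠ 0 := fun h0 => huv (h.schur_eq_zero hr h0 v)
  by_cases hp : G.Adj p u
  · left
    refine ⟨u, hp, ?_⟩
    by_contra hx
    exact hu0 (by rw [h.schur_self hp, ind_of_not_adj hx, mul_zero])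
  by_cases hq : G.Adj q u
  · right
    refine ⟨u, hq, ?_⟩
    by_contra hx
    exact hu0 (by rw [h.schur_self' hq, ind_of_not_adj hx, mul_zero])
  · exact absurd (h.schur_outer hr hp hq u) hu0

end FarEdges

/-- A graph whose vertices map to those of `H`, with fibres of the prescribed sizes and adjacency
read off from `H`, is a blow-up of `H`. -/
lemma nonempty_iso_blowup {V ι : Type*} [Fintype V] [DecidableEq ι] {G : SimpleGraph V}
    {H : SimpleGraph ι} {m : ι → ℕ} (f : V → ι)
    (hf : ∀ i, (Finset.univ.filter fun v => f v = i).card = m i)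
    (hadj : ∀ u v, G.Adj u v ↔ H.Adj (f u) (f v)) : Nonempty (G ≃g blowup H m) := by
  classical
  have hc : ∀ i, Fintype.card {v // f v = i} = m i := fun i => by
    rw [Fintype.card_subtype]; exact hf i
  let e : V ≃ Σ i, Fin (m i) := (Equiv.sigmaFiberEquiv f).symm.trans
    (Equiv.sigmaCongrRight fun i => Fintype.equivFinOfCardEq (hc i))
  refine ⟨⟨e, ?_⟩⟩
  intro u v
  exact (hadj u v).symm

/-! ### Linked graphs and their spectral bound -/

/-- The graph consisting of a complete tripartite graph (colours `0`, `1`, `2`) and a complete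
bipartite graph (colours `3`, `4`), where the colour class `4` has no further neighbours and the
vertex `r` of colour `0` is joined to the whole colour class `3`. -/
structure IsLinked {V : Type*} (G : SimpleGraph V) (κ : V → Fin 5) (r : V) : Prop where
  blob : ∀ u v, κ u < 3 → κ v < 3 → (G.Adj u v ↔ κ u ≠ κ v)
  leaf : ∀ u v, κ u = 4 → (G.Adj u v ↔ κ v = 3)
  centre : ∀ u v, κ u = 3 → κ v = 3 → ¬ G.Adj u v
  root : κ r = 0
  link : ∀ v, κ v = 3 → G.Adj r v
  surj : ∀ i, ∃ v, κ v = i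

section Colour

variable {V : Type*} [Fintype V]

/-- The vertices of colour `i`. -/
def colourClass {k : ℕ} (κ : V → Fin k) (i : Fin k) : Finset V :=
  Finset.univ.filter fun v => κ v = i

lemma mem_colourClass {k : ℕ} {κ : V → Fin k} {i : Fin k} {v : V} :
    v ∈ colourClass κ i ↔ κ v = i := by simp [colourClass]

lemma colourClass_disjoint {k : ℕ} {κ : V → Fin k} {i j : Fin k} (h : i ≠ j) :
    Disjoint (colourClass κ i) (colourClass κ j) := by
  rw [Finset.disjoint_left]
  intro v hv hv'
  rw [mem_colourClass] at hv hv'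
  exact h (hv.symm.trans hv')

lemma sum_card_colourClass {k : ℕ} (κ : V → Fin k) :
    ∑ i, (colourClass κ i).card = Fintype.card V := by
  classical
  rw [← Finset.card_univ]
  exact (Finset.card_eq_sum_card_fiberwise fun v _ => Finset.mem_univ (κ v)).symm

end Colour

namespace IsLinked

variable {V : Type*} [Fintype V] {G : SimpleGraph V} {κ : V → Fin 5} {r : V}

lemma nonempty (h : IsLinked G κ r) (i : Fin 5) : (colourClass κ i).Nonempty := by
  obtain ⟨v, hv⟩ := h.surj i
  exact ⟨v, mem_colourClass.mpr hv⟩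

lemma one_le_card (h : IsLinked G κ r) (i : Fin 5) : 1 ≤ (colourClass κ i).card :=
  Finset.card_pos.mpr (h.nonempty i)

/-- `IsLinked` leaves open which vertices besides `r` are joined to colour 3, so the eigenvalue
equations yield only inequalities between class sums. The case of equality excludes all further
links, which is what identifies the graph. -/
lemma secular (h : IsLinked G κ r) {t : ℝ} {x : V → ℝ} (hx : IsPerron G t x) {a b c d l : ℕ}
    (ha : (colourClass κ 0).card = a) (hb : (colourClass κ 1).card = b)
    (hc : (colourClass κ 2).card = c) (hd : (colourClass κ 3).card = d)
    (hl : (colourClass κ 4).card = l) :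
    0 < t ∧ 0 < t ^ 2 - t - 2 * ((a : ℝ) + b + c - 2) ∧
    2 ≤ (t ^ 2 - t - 2 * ((a : ℝ) + b + c - 2)) * (t ^ 2 - (d + l)) ∧
    ((t ^ 2 - t - 2 * ((a : ℝ) + b + c - 2)) * (t ^ 2 - (d + l)) = 2 →
      d = 1 ∧ b = 1 ∧ c = 1 ∧ ∀ u v, κ u < 3 → κ v = 3 → (G.Adj u v ↔ u = r)) := by
  classical
  set A := colourClass κ 0 with hA
  set B := colourClass κ 1 with hB
  set C := colourClass κ 2 with hC
  set D := colourClass κ 3 with hD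
  set L := colourClass κ 4 with hL
  have hblob : ∀ {i j : Fin 5} {u v : V}, κ u = i → κ v = j → i < 3 → j < 3 → i ≠ j →
      G.Adj u v := by
    rintro i j u v rfl rfl hi hj hij
    exact (h.blob u v hi hj).mpr hij
  have hBC : Disjoint B C := colourClass_disjoint (by decide)
  have hAC : Disjoint A C := colourClass_disjoint (by decide)
  have hAB : Disjoint A B := colourClass_disjoint (by decide)
  have hcard : ∀ i, (1 : ℝ) ≤ ((colourClass κ i).card : ℝ) := fun i => by
    exact_mod_cast h.one_le_card i
  have hEd : ∀ u v, v ∈ D.filter (fun v => G.Adj u v) → G.Adj u v := fun u v hv =>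
    (Finset.mem_filter.mp hv).2
  have hdisj : ∀ i j, i ≠ 3 → j ≠ 3 → ∀ u, Disjoint (colourClass κ i ∪ colourClass κ j)
      (D.filter (fun v => G.Adj u v)) := fun i j hi hj u =>
    Finset.disjoint_of_subset_right (Finset.filter_subset _ _)
      (Finset.disjoint_union_left.mpr ⟨colourClass_disjoint hi, colourClass_disjoint hj⟩)
  have g1 := hx.card_mul_sum_add_le (I := A) (T := B ∪ C) (fun u hu v hv => by
    rw [hA, mem_colourClass] at hu
    rcases Finset.mem_union.mp hv with hv | hv
    · exact hblob hu (mem_colourClass.mp hv) (by decide) (by decide) (by decide)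
    · exact hblob hu (mem_colourClass.mp hv) (by decide) (by decide) (by decide))
    (fun u => D.filter fun v => G.Adj u v) (fun u _ => hEd u)
    (fun u _ => hdisj 1 2 (by decide) (by decide) u)
  have g2 := hx.card_mul_sum_add_le (I := B) (T := A ∪ C) (fun u hu v hv => by
    rw [hB, mem_colourClass] at hu
    rcases Finset.mem_union.mp hv with hv | hv
    · exact hblob hu (mem_colourClass.mp hv) (by decide) (by decide) (by decide)
    · exact hblob hu (mem_colourClass.mp hv) (by decide) (by decide) (by decide))
    (fun u => D.filter fun v => G.Adj u v) (fun u _ => hEd u)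
    (fun u _ => hdisj 0 2 (by decide) (by decide) u)
  have g3 := hx.card_mul_sum_add_le (I := C) (T := A ∪ B) (fun u hu v hv => by
    rw [hC, mem_colourClass] at hu
    rcases Finset.mem_union.mp hv with hv | hv
    · exact hblob hu (mem_colourClass.mp hv) (by decide) (by decide) (by decide)
    · exact hblob hu (mem_colourClass.mp hv) (by decide) (by decide) (by decide))
    (fun u => D.filter fun v => G.Adj u v) (fun u _ => hEd u)
    (fun u _ => hdisj 0 1 (by decide) (by decide) u)
  rw [Finset.sum_union hBC] at g1
  rw [Finset.sum_union hAC] at g2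
  rw [Finset.sum_union hAB] at g3
  have g4 := hx.card_mul_sum_le (I := L) (T := D) (fun u hu v hv =>
    (h.leaf u v (mem_colourClass.mp hu)).mpr (mem_colourClass.mp hv))
  have hrL : Disjoint {r} L := by
    rw [Finset.disjoint_singleton_left, hL, mem_colourClass, h.root]; decide
  have g5 := hx.card_mul_sum_le (I := D) (T := {r} ∪ L) (fun u hu v hv => by
    rw [hD, mem_colourClass] at hu
    rcases Finset.mem_union.mp hv with hv | hv
    · rw [Finset.mem_singleton] at hv
      subst hv
      exact (h.link u hu).symm
    · exact ((h.leaf v u (mem_colourClass.mp hv)).mpr hu).symm)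
  rw [Finset.sum_union hrL, Finset.sum_singleton] at g5
  have g6 := hx.sum_le_mul (u := r) (T := B ∪ C ∪ D) (fun v hv => by
    rcases Finset.mem_union.mp hv with hv | hv
    · rcases Finset.mem_union.mp hv with hv | hv
      · exact hblob h.root (mem_colourClass.mp hv) (by decide) (by decide) (by decide)
      · exact hblob h.root (mem_colourClass.mp hv) (by decide) (by decide) (by decide)
    · exact h.link v (mem_colourClass.mp hv))
  rw [Finset.sum_union (Finset.disjoint_union_left.mpr
    ⟨colourClass_disjoint (by decide), colourClass_disjoint (by decide)⟩),
    Finset.sum_union hBC] at g6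
  have pA : 0 < ∑ v ∈ A, x v := hx.sum_pos (h.nonempty 0)
  have pB : 0 < ∑ v ∈ B, x v := hx.sum_pos (h.nonempty 1)
  have pC : 0 < ∑ v ∈ C, x v := hx.sum_pos (h.nonempty 2)
  have pD : 0 < ∑ v ∈ D, x v := hx.sum_pos (h.nonempty 3)
  have pL : 0 < ∑ v ∈ L, x v := hx.sum_pos (h.nonempty 4)
  have hrA : r ∈ A := mem_colourClass.mpr h.root
  have hfr : D.filter (fun v => G.Adj r v) = D :=
    Finset.filter_true_of_mem fun v hv => h.link v (mem_colourClass.mp hv)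
  have hnn : ∀ u, 0 ≤ ∑ v ∈ D.filter (fun v => G.Adj u v), x v := fun u => hx.sum_nonneg _
  have heA : ∑ v ∈ D, x v ≤ ∑ u ∈ A, ∑ v ∈ D.filter (fun v => G.Adj u v), x v := by
    have := Finset.single_le_sum (fun u _ => hnn u) hrA
    rwa [hfr] at this
  have ht : 0 < t := by
    have : 0 < t * x r := by linarith
    exact pos_of_mul_pos_left this (hx.pos r).le
  rw [ha] at g1
  rw [hb] at g2
  rw [hc] at g3
  rw [hl] at g4
  rw [hd] at g5
  have hd0 : (0 : ℝ) ≤ d := Nat.cast_nonneg d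
  -- Two steps starting from D, through the root and through the leaves: t²δ ≥ d(β + γ + δ + lδ),
  -- where β, γ, δ are the sums over B, C, D.
  have key : (d : ℝ) * (∑ v ∈ B, x v + ∑ v ∈ C, x v) ≤
      (t ^ 2 - d * (l + 1)) * ∑ v ∈ D, x v := by
    have e1 := mul_le_mul_of_nonneg_left g5 ht.le
    have e2 := mul_le_mul_of_nonneg_left g6 hd0
    have e3 := mul_le_mul_of_nonneg_left g4 hd0
    linarith
  have hc0 := hcard 0
  have hc1 := hcard 1
  have hc2 := hcard 2
  have hc3 := hcard 3
  have hc4 := hcard 4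
  rw [← hA, ha] at hc0
  rw [← hB, hb] at hc1
  rw [← hC, hc] at hc2
  rw [← hD, hd] at hc3
  rw [← hL, hl] at hc4
  obtain ⟨r1, r2, r3⟩ := secular_of_tripartite hc0 hc1 hc2 hc3 hc4 ht pA pB pC pD heA
    (Finset.sum_nonneg fun u _ => hnn u) (Finset.sum_nonneg fun u _ => hnn u) g1 g2 g3 key
  refine ⟨ht, r1, r2, fun heq => ?_⟩
  obtain ⟨q1, q2, q3, q4, q5, q6⟩ := r3 heq
  refine ⟨by exact_mod_cast q1, by exact_mod_cast q2, by exact_mod_cast q3, fun u v hu hv => ?_⟩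
  refine ⟨fun huv => ?_, fun huv => huv ▸ h.link v hv⟩
  have hpos : 0 < ∑ v ∈ D.filter (fun v => G.Adj u v), x v :=
    hx.sum_pos ⟨v, Finset.mem_filter.mpr ⟨mem_colourClass.mpr hv, huv⟩⟩
  have hu' : κ u = 0 ∨ κ u = 1 ∨ κ u = 2 := by omega
  rcases hu' with hu' | hu' | hu'
  · by_contra hur
    have hsub : ({r, u} : Finset V) ⊆ A := by
      intro w hw
      rcases Finset.mem_insert.mp hw with rfl | hw
      · exact hrA
      · rw [Finset.mem_singleton.mp hw]; exact mem_colourClass.mpr hu'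
    have := Finset.sum_le_sum_of_subset_of_nonneg hsub
      (f := fun u => ∑ v ∈ D.filter (fun v => G.Adj u v), x v) (fun u _ _ => hnn u)
    rw [Finset.sum_pair (Ne.symm hur), hfr] at this
    linarith
  · have := (Finset.sum_eq_zero_iff_of_nonneg (fun u _ => hnn u)).mp q5 u (mem_colourClass.mpr hu')
    linarith
  · have := (Finset.sum_eq_zero_iff_of_nonneg (fun u _ => hnn u)).mp q6 u (mem_colourClass.mpr hu')
    linarith

end IsLinked

lemma G10_adj_iff (i j : Fin 6) : G10.Adj i j ↔
    (i, j) ∈ ({(0, 1), (1, 0), (0, 2), (2, 0), (0, 3), (3, 0), (1, 2), (2, 1), (1, 4), (4, 1),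
      (2, 4), (4, 2), (3, 5), (5, 3)} : Finset (Fin 6 × Fin 6)) := by
  fin_cases i <;> fin_cases j <;> simp [G10]

lemma G1_adj_iff (i j : Fin 5) : G1.Adj i j ↔
    (i, j) ∈ ({(0, 1), (1, 0), (0, 2), (2, 0), (0, 3), (3, 0), (1, 3), (3, 1),
      (2, 4), (4, 2)} : Finset (Fin 5 × Fin 5)) := by
  fin_cases i <;> fin_cases j <;> simp [G1]

lemma IsLinked.nonempty_iso {V : Type*} [Fintype V] {G : SimpleGraph V} {κ : V → Fin 5} {r : V}
    (h : IsLinked G κ r) {a l : ℕ} (ha : (colourClass κ 0).card = a)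
    (hb : (colourClass κ 1).card = 1) (hc : (colourClass κ 2).card = 1)
    (hd : (colourClass κ 3).card = 1) (hl : (colourClass κ 4).card = l)
    (hlink : ∀ u v, κ u < 3 → κ v = 3 → (G.Adj u v ↔ u = r)) :
    Nonempty (G ≃g blowup G10 ![1, 1, 1, 1, a - 1, l]) := by
  classical
  -- Colour 0 splits: the root becomes vertex 0 of `G10`, the others vertex 4, which differs from 0
  -- only in missing the centre 3.
  set f : V → Fin 6 := fun v => if v = r then 0 else (![4, 1, 2, 3, 5] : Fin 5 → Fin 6) (κ v)
    with hf
  have hfr : f r = 0 := by simp [hf]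
  have hfn : ∀ v, v ≠ r → f v = (![4, 1, 2, 3, 5] : Fin 5 → Fin 6) (κ v) := fun v hv => by
    simp [hf, hv]
  have hne : ∀ v, κ v ≠ 0 → v ≠ r := by
    rintro v hv rfl
    exact hv h.root
  refine nonempty_iso_blowup f ?_ ?_
  · have hcls : ∀ (i : Fin 6) (j : Fin 5), j ≠ 0 → (![4, 1, 2, 3, 5] : Fin 5 → Fin 6) j = i →
        (Finset.univ.filter fun v => f v = i) = colourClass κ j := by
      rintro i j hj rfl
      ext v
      simp only [Finset.mem_filter, Finset.mem_univ, true_and, mem_colourClass]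
      constructor
      · intro hv
        by_cases hvr : v = r
        · rw [hvr, hfr] at hv
          exact absurd hv (by clear hv; revert j; decide)
        · rw [hfn v hvr] at hv
          revert hv hj; generalize κ v = k; revert j k; decide
      · intro hv
        rw [hfn v (hne v (by rwa [hv])), hv]
    intro i
    have h0 : (Finset.univ.filter fun v => f v = 0) = {r} := by
      ext v
      simp only [Finset.mem_filter, Finset.mem_univ, true_and, Finset.mem_singleton]
      constructor
      · intro hv
        by_contra hvr
        rw [hfn v hvr] at hv
        revert hv; generalize κ v = k; revert k; decide
      · rintro rfl; exact hfr
    have h4 : (Finset.univ.filter fun v => f v = 4) = (colourClass κ 0).erase r := by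
      ext v
      simp only [Finset.mem_filter, Finset.mem_univ, true_and, Finset.mem_erase, mem_colourClass]
      constructor
      · intro hv
        have hvr : v ≠ r := by rintro rfl; rw [hfr] at hv; exact absurd hv (by decide)
        refine ⟨hvr, ?_⟩
        rw [hfn v hvr] at hv
        revert hv; generalize κ v = k; revert k; decide
      · rintro ⟨hvr, hv⟩
        rw [hfn v hvr, hv]; rfl
    fin_cases i
    · change (Finset.univ.filter fun v => f v = 0).card = 1
      rw [h0, Finset.card_singleton]
    · change (Finset.univ.filter fun v => f v = 1).card = 1
      rw [hcls 1 1 (by decide) (by decide), hb]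
    · change (Finset.univ.filter fun v => f v = 2).card = 1
      rw [hcls 2 2 (by decide) (by decide), hc]
    · change (Finset.univ.filter fun v => f v = 3).card = 1
      rw [hcls 3 3 (by decide) (by decide), hd]
    · change (Finset.univ.filter fun v => f v = 4).card = a - 1
      rw [h4, Finset.card_erase_of_mem (mem_colourClass.mpr h.root), ha]
    · change (Finset.univ.filter fun v => f v = 5).card = l
      rw [hcls 5 4 (by decide) (by decide), hl]
  · have hrr : ∀ w, κ w = 0 → w ≠ r → f w = 4 := fun w hw hwr => by rw [hfn w hwr, hw]; rfl
    have h1 : ∀ w, κ w = 1 → f w = 1 := fun w hw => by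
      rw [hfn w (hne w (by rw [hw]; decide)), hw]; rfl
    have h2 : ∀ w, κ w = 2 → f w = 2 := fun w hw => by
      rw [hfn w (hne w (by rw [hw]; decide)), hw]; rfl
    have h3 : ∀ w, κ w = 3 → f w = 3 := fun w hw => by
      rw [hfn w (hne w (by rw [hw]; decide)), hw]; rfl
    have h4 : ∀ w, κ w = 4 → f w = 5 := fun w hw => by
      rw [hfn w (hne w (by rw [hw]; decide)), hw]; rfl
    have hcase : ∀ w, (w = r ∧ κ w = 0 ∧ f w = 0) ∨ (w ≠ r ∧ κ w = 0 ∧ f w = 4) ∨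
        (w ≠ r ∧ κ w = 1 ∧ f w = 1) ∨ (w ≠ r ∧ κ w = 2 ∧ f w = 2) ∨
        (w ≠ r ∧ κ w = 3 ∧ f w = 3) ∨ (w ≠ r ∧ κ w = 4 ∧ f w = 5) := by
      intro w
      by_cases hwr : w = r
      · left; subst hwr; exact ⟨rfl, h.root, hfr⟩
      right
      have : κ w = 0 ∨ κ w = 1 ∨ κ w = 2 ∨ κ w = 3 ∨ κ w = 4 := by omega
      rcases this with hw | hw | hw | hw | hw
      · exact Or.inl ⟨hwr, hw, hrr w hw hwr⟩
      · exact Or.inr (Or.inl ⟨hwr, hw, h1 w hw⟩)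
      · exact Or.inr (Or.inr (Or.inl ⟨hwr, hw, h2 w hw⟩))
      · exact Or.inr (Or.inr (Or.inr (Or.inl ⟨hwr, hw, h3 w hw⟩)))
      · exact Or.inr (Or.inr (Or.inr (Or.inr ⟨hwr, hw, h4 w hw⟩)))
    intro u v
    rw [G10_adj_iff]
    rcases hcase u with ⟨u1, u2, u3⟩ | ⟨u1, u2, u3⟩ | ⟨u1, u2, u3⟩ | ⟨u1, u2, u3⟩ | ⟨u1, u2, u3⟩ |
      ⟨u1, u2, u3⟩ <;>
    rcases hcase v with ⟨v1, v2, v3⟩ | ⟨v1, v2, v3⟩ | ⟨v1, v2, v3⟩ | ⟨v1, v2, v3⟩ | ⟨v1, v2, v3⟩ |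
      ⟨v1, v2, v3⟩ <;>
    rw [u3, v3] <;>
    first
    | (rw [h.blob u v (by rw [u2]; decide) (by rw [v2]; decide), u2, v2]; decide)
    | (rw [h.leaf u v u2, v2]; decide)
    | (rw [G.adj_comm, h.leaf v u v2, u2]; decide)
    | (exact iff_of_false (h.centre u v u2 v2) (by decide))
    | (rw [hlink u v (by rw [u2]; decide) v2]; exact iff_of_true u1 (by decide))
    | (rw [hlink u v (by rw [u2]; decide) v2]; exact iff_of_false u1 (by decide))
    | (rw [G.adj_comm, hlink v u (by rw [v2]; decide) u2]; exact iff_of_true v1 (by decide))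
    | (rw [G.adj_comm, hlink v u (by rw [v2]; decide) u2]; exact iff_of_false v1 (by decide))

/-! ### Walks of length two -/

section Walks

open Classical in
/-- The number of walks of length two from `v`. -/
noncomputable def twoWalks {V : Type*} [Fintype V] (G : SimpleGraph V) (v : V) : ℕ :=
  ∑ u ∈ G.neighborFinset v, G.degree u

variable {V : Type*} [Fintype V] {G : SimpleGraph V} {t : ℝ} {x : V → ℝ}

open Classical in
lemma sum_ind (v : V) (f : V → ℝ) : ∑ u, ind G v u * f u = ∑ u ∈ G.neighborFinset v, f u := by
  rw [← Finset.sum_filter_add_sum_filter_not Finset.univ (fun u => G.Adj v u)]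
  rw [Finset.sum_congr rfl fun u hu => by
    rw [ind_of_adj (Finset.mem_filter.mp hu).2, one_mul]]
  rw [Finset.sum_congr (s₁ := Finset.univ.filter fun u => ¬ G.Adj v u) rfl fun u hu => by
    rw [ind_of_not_adj (Finset.mem_filter.mp hu).2, zero_mul], Finset.sum_const_zero, add_zero]
  refine Finset.sum_congr ?_ fun _ _ => rfl
  ext u; simp

open Classical in
lemma twoWalks_cast (v : V) : (twoWalks G v : ℝ) = ∑ u, ∑ w, ind G v u * ind G u w := by
  rw [twoWalks, Nat.cast_sum, ← sum_ind]
  refine Finset.sum_congr rfl fun u _ => ?_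
  rw [← Finset.mul_sum]
  have := sum_ind (G := G) u (fun _ => 1)
  simp only [mul_one, Finset.sum_const, nsmul_eq_mul] at this
  rw [this, SimpleGraph.card_neighborFinset_eq_degree]

open Classical in
/-- In a graph of diameter at most two every vertex starts at least `n - 1` walks of length two. -/
lemma card_le_twoWalks (hdiam : ∀ u v, u ≠ v → ¬ G.Adj u v → ∃ w, G.Adj u w ∧ G.Adj v w) (v : V) :
    Fintype.card V ≤ twoWalks G v + 1 := by
  have h1 : twoWalks G v =
      ∑ u ∈ G.neighborFinset v, ((G.neighborFinset u).erase v).card + G.degree v := by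
    rw [twoWalks, ← SimpleGraph.card_neighborFinset_eq_degree, Finset.card_eq_sum_ones,
      ← Finset.sum_add_distrib]
    refine Finset.sum_congr rfl fun u hu => ?_
    rw [SimpleGraph.mem_neighborFinset] at hu
    rw [Finset.card_erase_add_one (by rw [SimpleGraph.mem_neighborFinset]; exact hu.symm),
      SimpleGraph.card_neighborFinset_eq_degree]
  have h2 := Finset.card_biUnion_le (s := G.neighborFinset v)
    (t := fun u => (G.neighborFinset u).erase v)
  have h3 : (Finset.univ \ (insert v (G.neighborFinset v))) ⊆
      (G.neighborFinset v).biUnion fun u => (G.neighborFinset u).erase v := by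
    intro w hw
    simp only [Finset.mem_sdiff, Finset.mem_univ, true_and, Finset.mem_insert, not_or,
      SimpleGraph.mem_neighborFinset] at hw
    obtain ⟨u, hu1, hu2⟩ := hdiam v w (Ne.symm hw.1) hw.2
    rw [Finset.mem_biUnion]
    exact ⟨u, by simpa using hu1, by simpa using ⟨hw.1, hu2.symm⟩⟩
  have h4 := Finset.card_le_card h3
  rw [Finset.card_sdiff_of_subset (Finset.subset_univ _), Finset.card_univ,
    Finset.card_insert_of_notMem (by simp), SimpleGraph.card_neighborFinset_eq_degree] at h4
  omega

namespace IsPerron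

/-- Both sides equal 1ᵀA²x. -/
lemma sum_twoWalks_mul (h : IsPerron G t x) :
    ∑ v, (twoWalks G v : ℝ) * x v = t ^ 2 * ∑ v, x v := by
  have h1 : ∀ v, t ^ 2 * x v = ∑ u, ∑ w, ind G v u * ind G u w * x w := by
    intro v
    rw [sq, mul_assoc, ← h.eq v, Finset.mul_sum]
    refine Finset.sum_congr rfl fun u _ => ?_
    rw [mul_left_comm, ← h.eq u, Finset.mul_sum]
    exact Finset.sum_congr rfl fun w _ => by ring
  rw [Finset.mul_sum, Finset.sum_congr rfl fun v _ => h1 v]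
  have h2 : ∀ v, (twoWalks G v : ℝ) * x v = ∑ u, ∑ w, ind G w u * ind G u v * x v := by
    intro v
    rw [twoWalks_cast, Finset.sum_mul]
    refine Finset.sum_congr rfl fun u _ => ?_
    rw [Finset.sum_mul]
    refine Finset.sum_congr rfl fun w _ => ?_
    rw [ind_comm G v u, ind_comm G w u]; ring
  rw [Finset.sum_congr rfl fun v _ => h2 v, Finset.sum_comm]
  conv_rhs => rw [Finset.sum_comm]
  exact Finset.sum_congr rfl fun u _ => Finset.sum_comm

/-- This is the Rayleigh bound 1ᵀA²1 ≤ t²n: sum t² = (A²x)_v / x_v over v and symmetrise, using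
x_w/x_v + x_v/x_w ≥ 2. -/
lemma sum_twoWalks_le (h : IsPerron G t x) :
    ∑ v, (twoWalks G v : ℝ) ≤ t ^ 2 * Fintype.card V := by
  have h1 : ∀ v, t ^ 2 = ∑ u, ∑ w, ind G v u * ind G u w * (x w / x v) := by
    intro v
    have : t ^ 2 = (t ^ 2 * x v) / x v := by rw [mul_div_cancel_right₀ _ (h.pos v).ne']
    rw [this, sq, mul_assoc, ← h.eq v, Finset.mul_sum, Finset.sum_div]
    refine Finset.sum_congr rfl fun u _ => ?_
    rw [mul_left_comm, ← h.eq u, Finset.mul_sum, Finset.sum_div]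
    exact Finset.sum_congr rfl fun w _ => by ring
  have h2 : t ^ 2 * Fintype.card V = ∑ v, ∑ u, ∑ w, ind G v u * ind G u w * (x w / x v) := by
    rw [← Finset.sum_congr rfl fun v _ => h1 v, Finset.sum_const, Finset.card_univ, nsmul_eq_mul,
      mul_comm]
  have h3 : t ^ 2 * Fintype.card V = ∑ v, ∑ u, ∑ w, ind G v u * ind G u w * (x v / x w) := by
    rw [h2, Finset.sum_comm]
    conv_rhs => rw [Finset.sum_comm]
    refine Finset.sum_congr rfl fun u _ => ?_
    rw [Finset.sum_comm]
    refine Finset.sum_congr rfl fun w _ => Finset.sum_congr rfl fun v _ => ?_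
    rw [ind_comm G v u, ind_comm G w u]; ring
  have h4 : ∑ v, (twoWalks G v : ℝ) * 2 ≤
      ∑ v, ∑ u, ∑ w, (ind G v u * ind G u w * (x w / x v) +
        ind G v u * ind G u w * (x v / x w)) := by
    refine Finset.sum_le_sum fun v _ => ?_
    rw [twoWalks_cast, Finset.sum_mul]
    refine Finset.sum_le_sum fun u _ => ?_
    rw [Finset.sum_mul]
    refine Finset.sum_le_sum fun w _ => ?_
    rw [← mul_add]
    refine mul_le_mul_of_nonneg_left ?_ (mul_nonneg (ind_nonneg _ _ _) (ind_nonneg _ _ _))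
    have hv := h.pos v
    have hw := h.pos w
    rw [div_add_div _ _ hv.ne' hw.ne', le_div_iff₀ (by positivity)]
    nlinarith [sq_nonneg (x v - x w)]
  simp only [Finset.sum_add_distrib] at h4
  rw [← h2, ← h3, ← Finset.sum_mul] at h4
  linarith

end IsPerron

-- The total is the sum of the squared degrees, which has the parity of the sum of the degrees.
open Classical in
lemma sum_twoWalks_even : Even (∑ v, twoWalks G v) := by
  have h1 : ∑ v, twoWalks G v = ∑ v, G.degree v * G.degree v := by
    have : (∑ v, (twoWalks G v : ℝ)) = ∑ v, (G.degree v : ℝ) * G.degree v := by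
      have hdeg : ∀ u, ∑ w, ind G u w = (G.degree u : ℝ) := fun u => by
        have := sum_ind (G := G) u (fun _ => 1)
        simp only [mul_one, Finset.sum_const, nsmul_eq_mul] at this
        rw [this, SimpleGraph.card_neighborFinset_eq_degree]
      simp_rw [twoWalks_cast, ← Finset.mul_sum, hdeg]
      rw [Finset.sum_comm]
      refine Finset.sum_congr rfl fun u _ => ?_
      rw [← Finset.sum_mul, ← hdeg u]
      congr 1
      exact Finset.sum_congr rfl fun v _ => ind_comm G v u
    exact_mod_cast this
  have h2 : ∑ v, G.degree v * G.degree v =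
      ∑ v, G.degree v * (G.degree v - 1) + ∑ v, G.degree v := by
    rw [← Finset.sum_add_distrib]
    refine Finset.sum_congr rfl fun v _ => ?_
    cases G.degree v with
    | zero => rfl
    | succ k => simp; ring
  rw [h1, h2, G.sum_degrees_eq_twice_card_edges]
  refine Even.add (Finset.even_sum _ fun v _ => ?_) (even_two_mul _)
  cases G.degree v with
  | zero => exact ⟨0, rfl⟩
  | succ k => simpa [mul_comm] using Nat.even_mul_succ_self k

end Walks

/-! ### Diameter two, with sharper bounds in orders five and six -/

section SmallOrder

open Classical

variable {V : Type*} [Fintype V] {G : SimpleGraph V}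

lemma nonempty_iso_cycleGraph_five (hn : Fintype.card V = 5) (hdeg : ∀ v, G.degree v = 2)
    (hdiam : ∀ u v, u ≠ v → ¬ G.Adj u v → ∃ w, G.Adj u w ∧ G.Adj v w) :
    Nonempty (G ≃g SimpleGraph.cycleGraph 5) := by
  have hN : ∀ v u, G.Adj v u → ∃ w, w ≠ u ∧ ∀ z, G.Adj v z ↔ z = u ∨ z = w := by
    intro v u hvu
    have h2 := hdeg v
    rw [← SimpleGraph.card_neighborFinset_eq_degree, Finset.card_eq_two] at h2
    obtain ⟨a, b, hab, hs⟩ := h2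
    have hz : ∀ z, G.Adj v z ↔ z = a ∨ z = b := fun z => by
      rw [← SimpleGraph.mem_neighborFinset, hs]; simp
    rcases (hz u).mp hvu with rfl | rfl
    · exact ⟨b, hab.symm, hz⟩
    · exact ⟨a, hab, fun z => (hz z).trans or_comm⟩
  have hout : ∀ s : Finset V, s.card ≤ 4 → ∃ w, w ∉ s := by
    intro s hs
    by_contra! h
    have : s = Finset.univ := Finset.eq_univ_iff_forall.mpr h
    rw [this, Finset.card_univ] at hs
    omega
  obtain ⟨v0⟩ : Nonempty V := Fintype.card_pos_iff.mp (by omega)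
  obtain ⟨a, ha⟩ : ∃ a, G.Adj v0 a := by
    have h2 := hdeg v0
    rw [← SimpleGraph.card_neighborFinset_eq_degree] at h2
    obtain ⟨a, ha⟩ := Finset.card_pos.mp (by omega : 0 < (G.neighborFinset v0).card)
    exact ⟨a, by simpa using ha⟩
  obtain ⟨b, hba, h0⟩ := hN v0 a ha
  have hb : G.Adj v0 b := (h0 b).mpr (Or.inr rfl)
  obtain ⟨c, hc0, h1⟩ := hN a v0 ha.symm
  obtain ⟨d, hd0, h4⟩ := hN b v0 hb.symm
  have hac : G.Adj a c := (h1 c).mpr (Or.inr rfl)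
  have hbd : G.Adj b d := (h4 d).mpr (Or.inr rfl)
  have hreach : ∀ w, w = v0 ∨ w = a ∨ w = b ∨ w = c ∨ w = d := by
    intro w
    by_cases hw0 : w = v0
    · exact Or.inl hw0
    by_cases hw : G.Adj v0 w
    · rcases (h0 w).mp hw with h | h <;> simp [h]
    obtain ⟨z, hz1, hz2⟩ := hdiam v0 w (Ne.symm hw0) hw
    rcases (h0 z).mp hz1 with rfl | rfl
    · rcases (h1 w).mp hz2.symm with h | h <;> simp [h]
    · rcases (h4 w).mp hz2.symm with h | h <;> simp [h]
  have hcov : (Finset.univ : Finset V) ⊆ {v0, a, b, c, d} := fun w _ => by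
    simpa using hreach w
  have hcard5 : 5 ≤ ({v0, a, b, c, d} : Finset V).card := by
    rw [← hn, ← Finset.card_univ]; exact Finset.card_le_card hcov
  have hsmall : ∀ s : Finset V, s.card ≤ 4 → ({v0, a, b, c, d} : Finset V) ≠ s := by
    rintro s hs rfl; omega
  have hcb : c ≠ b := by
    rintro rfl
    refine hsmall {v0, a, c, d} Finset.card_le_four ?_
    ext w; simp
  have hda : d ≠ a := by
    rintro rfl
    refine hsmall {v0, d, b, c} Finset.card_le_four ?_
    ext w; simp; tauto
  have hcd : c ≠ d := by
    rintro rfl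
    refine hsmall {v0, a, b, c} Finset.card_le_four ?_
    ext w; simp
  obtain ⟨e, hea, h2⟩ := hN c a hac.symm
  have hce : G.Adj c e := (h2 e).mpr (Or.inr rfl)
  have hed : e = d := by
    rcases hreach e with rfl | rfl | rfl | rfl | h
    · rcases (h0 c).mp hce.symm with h | h
      · exact absurd (h ▸ hac) (G.loopless.irrefl _)
      · exact absurd h hcb
    · exact absurd rfl hea
    · rcases (h4 c).mp hce.symm with h | h
      · exact absurd h hc0
      · exact absurd h hcd
    · exact absurd hce (G.loopless.irrefl _)
    · exact h
  subst hed
  obtain ⟨f, hfb, h3⟩ := hN e b hbd.symm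
  have hfc : f = c := by
    rcases (h3 c).mp hce.symm with h | h
    · exact absurd h hcb
    · exact h.symm
  subst hfc
  have n1 : v0 ≠ a := ha.ne
  have n2 : v0 ≠ b := hb.ne
  have n3 : a ≠ f := hac.ne
  have n4 : b ≠ e := hbd.ne
  let g : Fin 5 → V := ![v0, a, f, e, b]
  have hinj : Function.Injective g := by
    intro i j hij
    fin_cases i <;> fin_cases j <;> simp [g] at hij ⊢ <;> simp_all
  have hbij : Function.Bijective g :=
    (Fintype.bijective_iff_injective_and_card g).mpr ⟨hinj, by simp [hn]⟩
  refine ⟨(SimpleGraph.Iso.symm ⟨Equiv.ofBijective g hbij, ?_⟩)⟩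
  intro i j
  change G.Adj (g i) (g j) ↔ (SimpleGraph.cycleGraph 5).Adj i j
  have hg : ∀ k l, g k = g l ↔ k = l := fun k l => hinj.eq_iff
  have k0 : ∀ z, G.Adj (g 0) (g z) ↔ z = 1 ∨ z = 4 := fun z => by
    rw [← hg z 1, ← hg z 4]; exact h0 _
  have k1 : ∀ z, G.Adj (g 1) (g z) ↔ z = 0 ∨ z = 2 := fun z => by
    rw [← hg z 0, ← hg z 2]; exact h1 _
  have k2 : ∀ z, G.Adj (g 2) (g z) ↔ z = 1 ∨ z = 3 := fun z => by
    rw [← hg z 1, ← hg z 3]; exact h2 _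
  have k3 : ∀ z, G.Adj (g 3) (g z) ↔ z = 4 ∨ z = 2 := fun z => by
    rw [← hg z 4, ← hg z 2]; exact h3 _
  have k4 : ∀ z, G.Adj (g 4) (g z) ↔ z = 0 ∨ z = 3 := fun z => by
    rw [← hg z 0, ← hg z 3]; exact h4 _
  fin_cases i
  · exact (k0 j).trans (by revert j; decide)
  · exact (k1 j).trans (by revert j; decide)
  · exact (k2 j).trans (by revert j; decide)
  · exact (k3 j).trans (by revert j; decide)
  · exact (k4 j).trans (by revert j; decide)

/-- A graph of order five or six in which every vertex starts exactly `n - 1` walks of length two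
is a star or regular of degree two and order five. -/
lemma degree_eq_two_of_twoWalks (hn : Fintype.card V = 5 ∨ Fintype.card V = 6)
    (hG : G.Connected) (hr : 2 < graphRank G)
    (hw : ∀ v, twoWalks G v + 1 = Fintype.card V) :
    Fintype.card V = 5 ∧ ∀ v, G.degree v = 2 := by
  have : Nontrivial V := Fintype.one_lt_card_iff_nontrivial.mp (by omega)
  have hpos : ∀ v, 0 < G.degree v := fun v => hG.preconnected.degree_pos_of_nontrivial v
  by_cases h1 : ∃ q, G.degree q = 1
  · exfalso
    -- The walks from a leaf q are counted by the degree of its neighbour p, so p dominates the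
    -- graph; the count at p then makes all other vertices leaves. This is a star, of rank two.
    obtain ⟨q, hq⟩ := h1
    have hq' := hq
    rw [← SimpleGraph.card_neighborFinset_eq_degree, Finset.card_eq_one] at hq
    obtain ⟨p, hp⟩ := hq
    have hpd : G.degree p + 1 = Fintype.card V := by
      have := hw q
      rwa [twoWalks, hp, Finset.sum_singleton] at this
    have hp1 : ∀ u ∈ G.neighborFinset p, G.degree u = 1 := by
      have h2 := hw p
      have h3 : ∑ u ∈ G.neighborFinset p, 1 = ∑ u ∈ G.neighborFinset p, G.degree u := by
        rw [← Finset.card_eq_sum_ones, SimpleGraph.card_neighborFinset_eq_degree]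
        change _ = twoWalks G p
        omega
      intro u hu
      exact ((Finset.sum_eq_sum_iff_of_le fun v _ => hpos v).mp h3 u hu).symm
    have hpall : ∀ u, u ≠ p → G.Adj p u := by
      intro u hu
      have hsub : G.neighborFinset p ⊆ Finset.univ.erase p := fun w hw => by
        rw [SimpleGraph.mem_neighborFinset] at hw
        simp [hw.ne']
      have heq := Finset.eq_of_subset_of_card_le hsub (by
        rw [Finset.card_erase_of_mem (Finset.mem_univ _), Finset.card_univ,
          SimpleGraph.card_neighborFinset_eq_degree]; omega)
      have : u ∈ Finset.univ.erase p := by simp [hu]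
      rw [← heq] at this
      simpa using this
    have honly : ∀ u, u ≠ p → ∀ v, G.Adj u v → v = p := by
      intro u hu v huv
      have h2 := hp1 u (by simpa using hpall u hu)
      rw [← SimpleGraph.card_neighborFinset_eq_degree] at h2
      exact Finset.card_le_one.mp h2.le v (by simpa using huv) p (by simpa using (hpall u hu).symm)
    have hqp : q ≠ p := by
      rintro rfl
      have : q ∈ G.neighborFinset q := by rw [hp]; simp
      simp at this
    refine absurd (graphRank_le_of_span ![p, q] fun u => ?_) (not_le.mpr hr)
    by_cases hu : u = p
    · exact ⟨![1, 0], fun v => by simp [hu]⟩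
    · refine ⟨![0, 1], fun v => ?_⟩
      have : ∀ z, z ≠ p → (G.Adj z v ↔ v = p) := fun z hz =>
        ⟨honly z hz v, fun h => h ▸ (hpall z hz).symm⟩
      have h2 : G.Adj u v ↔ G.Adj q v := (this u hu).trans (this q hqp).symm
      have h3 : ind G u v = ind G q v := by simp [ind, h2]
      simp [h3]
  · push Not at h1
    have h2 : ∀ v, 2 ≤ G.degree v := fun v => by
      have := hpos v
      have := h1 v
      omega
    have h3 : ∀ v, 2 * G.degree v ≤ twoWalks G v := fun v => by
      rw [twoWalks, ← SimpleGraph.card_neighborFinset_eq_degree, mul_comm, ← smul_eq_mul,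
        ← Finset.sum_const]
      exact Finset.sum_le_sum fun u _ => h2 u
    have h4 : ∀ v, G.degree v = 2 := fun v => by
      have := h2 v
      have := h3 v
      have := hw v
      omega
    refine ⟨?_, h4⟩
    obtain ⟨v⟩ := hG.nonempty
    have h5 : twoWalks G v = 4 := by
      rw [twoWalks, Finset.sum_congr rfl fun u _ => h4 u, Finset.sum_const,
        SimpleGraph.card_neighborFinset_eq_degree, h4 v]
      rfl
    have := hw v
    omega

lemma le_sq_of_diam_two {t : ℝ} {x : V → ℝ} (hx : IsPerron G t x) (hG : G.Connected)
    (hdiam : ∀ u v, u ≠ v → ¬ G.Adj u v → ∃ w, G.Adj u w ∧ G.Adj v w) :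
    (Fintype.card V : ℝ) - 1 ≤ t ^ 2 := by
  have := hG.nonempty
  have h1 := hx.sum_twoWalks_mul
  have h2 : ((Fintype.card V : ℝ) - 1) * ∑ v, x v ≤ t ^ 2 * ∑ v, x v := by
    rw [← h1, Finset.mul_sum]
    refine Finset.sum_le_sum fun v _ => mul_le_mul_of_nonneg_right ?_ (hx.pos v).le
    have := card_le_twoWalks hdiam v
    have : (Fintype.card V : ℝ) ≤ twoWalks G v + 1 := by exact_mod_cast this
    linarith
  exact le_of_mul_le_mul_right h2 (hx.sum_pos Finset.univ_nonempty)

/-- At order six t² ≥ 5 is too weak: with m = 1, s = 3 it allows PQ < 2. The number of walks is even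
and at least 30, and 30 would mean exactly five from each vertex, which is impossible. So it is at
least 32, and t² ≥ 32/6. -/
lemma le_sq_of_card_six {t : ℝ} {x : V → ℝ} (hx : IsPerron G t x) (hG : G.Connected)
    (hr : 2 < graphRank G) (hn : Fintype.card V = 6)
    (hdiam : ∀ u v, u ≠ v → ¬ G.Adj u v → ∃ w, G.Adj u w ∧ G.Adj v w) : 16 / 3 ≤ t ^ 2 := by
  have h1 := hx.sum_twoWalks_le
  rw [hn] at h1
  by_cases h32 : 32 ≤ ∑ v, twoWalks G v
  · have : (32 : ℝ) ≤ ∑ v, (twoWalks G v : ℝ) := by exact_mod_cast h32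
    push_cast at h1
    linarith
  exfalso
  have h5 : ∀ v ∈ (Finset.univ : Finset V), 5 ≤ twoWalks G v := fun v _ => by
    have := card_le_twoWalks hdiam v
    omega
  have h30 : ∑ v : V, 5 = 30 := by simp [hn]
  have h30' := Finset.sum_le_sum h5
  have heven := sum_twoWalks_even (G := G)
  have heq : ∑ v : V, 5 = ∑ v, twoWalks G v := by
    obtain ⟨k, hk⟩ := heven
    omega
  have hall := (Finset.sum_eq_sum_iff_of_le h5).mp heq
  have := degree_eq_two_of_twoWalks (Or.inr hn) hG hr fun v => by
    rw [← hall v (Finset.mem_univ _), hn]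
  omega

/-- The mean of the walk counts weighted by x is t² ≤ 4, while each count is at least 4; hence all
equal 4. -/
lemma nonempty_iso_cycleGraph_of_le {t : ℝ} {x : V → ℝ} (hx : IsPerron G t x) (hG : G.Connected)
    (hr : 2 < graphRank G) (hn : Fintype.card V = 5)
    (hdiam : ∀ u v, u ≠ v → ¬ G.Adj u v → ∃ w, G.Adj u w ∧ G.Adj v w) (ht : t ≤ 2) :
    Nonempty (G ≃g SimpleGraph.cycleGraph 5) := by
  have := hG.nonempty
  have h1 := hx.sum_twoWalks_mul
  have h4 : ∀ v, (4 : ℝ) ≤ twoWalks G v := fun v => by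
    have := card_le_twoWalks hdiam v
    have : 4 ≤ twoWalks G v := by omega
    exact_mod_cast this
  have ht2 : t ^ 2 ≤ 4 := by nlinarith [hx.nonneg]
  have h2 : ∑ v, (twoWalks G v : ℝ) * x v ≤ ∑ v, 4 * x v := by
    rw [h1, ← Finset.mul_sum]
    exact mul_le_mul_of_nonneg_right ht2 (hx.sum_nonneg _)
  have hle : ∀ v ∈ (Finset.univ : Finset V), 4 * x v ≤ (twoWalks G v : ℝ) * x v :=
    fun v _ => mul_le_mul_of_nonneg_right (h4 v) (hx.pos v).le
  have heq := (Finset.sum_eq_sum_iff_of_le hle).mp (le_antisymm (Finset.sum_le_sum hle) h2)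
  have hall : ∀ v, twoWalks G v + 1 = Fintype.card V := fun v => by
    have := mul_right_cancel₀ (hx.pos v).ne' (heq v (Finset.mem_univ _))
    have : 4 = twoWalks G v := by exact_mod_cast this
    omega
  exact nonempty_iso_cycleGraph_five hn
    (degree_eq_two_of_twoWalks (Or.inl hn) hG hr hall).2 hdiam

end SmallOrder

/-! ### Spectral bounds for the seven-class blow-ups -/

section Estimates

lemma add_le_mul_nat {u v : ℕ} (hu : 1 ≤ u) (hv : 1 ≤ v) : u + v ≤ u * v + 1 := by
  obtain ⟨u, rfl⟩ := Nat.exists_eq_add_of_le hu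
  obtain ⟨v, rfl⟩ := Nat.exists_eq_add_of_le hv
  nlinarith [Nat.zero_le (u * v)]

lemma add_two_mul_le_mul_nat {u v : ℕ} (hu : 2 ≤ u) (hv : 1 ≤ v) : u + 2 * v ≤ u * v + 2 := by
  obtain ⟨u, rfl⟩ := Nat.exists_eq_add_of_le hu
  obtain ⟨v, rfl⟩ := Nat.exists_eq_add_of_le hv
  nlinarith [Nat.zero_le (u * v)]

/-- Two sets of vertices (blown-up edges `x₁x₂` and the bipartite part `y₁ ∪ y₂`) joined through
the classes `a`, `b`, `c`: the estimate when only `y₁` is joined to the first one. -/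
lemma le_sq_of_one_sided {t ξ₁ ξ₂ η₁ η₂ ζa ζb ζc : ℝ} {x₁ x₂ y₁ y₂ a b c : ℕ}
    (hx₁ : 1 ≤ x₁) (hx₂ : 1 ≤ x₂) (hy₁ : 1 ≤ y₁) (hy₂ : 1 ≤ y₂) (ha : 1 ≤ a) (hb : 1 ≤ b)
    (hc : 1 ≤ c) (ht : 0 ≤ t) (pξ₁ : 0 < ξ₁) (pξ₂ : 0 < ξ₂) (pη₁ : 0 < η₁) (pη₂ : 0 < η₂)
    (pζa : 0 < ζa) (pζb : 0 < ζb) (pζc : 0 < ζc)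
    (h1 : x₁ * (ξ₂ + ζa + ζc + η₁) ≤ t * ξ₁) (h2 : x₂ * (ξ₁ + ζa + ζc + η₁) ≤ t * ξ₂)
    (h3 : y₁ * (ξ₁ + ξ₂ + ζb + ζc) ≤ t * η₁) (h4 : y₂ * (ζb + ζc) ≤ t * η₂)
    (h5 : a * (ξ₁ + ξ₂) ≤ t * ζa) (h6 : b * (η₁ + η₂) ≤ t * ζb)
    (h7 : c * (ξ₁ + ξ₂ + η₁ + η₂) ≤ t * ζc) :
    ((x₁ + x₂ + y₁ + y₂ + a + b + c : ℕ) : ℝ) - 1 ≤ t ^ 2 := by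
  have hX : (((x₁ + x₂) * (a + c + y₁) + x₁ * x₂ : ℕ) : ℝ) ≤ t ^ 2 := by
    have pξ : 0 < ξ₁ + ξ₂ := by linarith
    refine le_of_mul_le_mul_right ?_ pξ
    have e1 := mul_le_mul_of_nonneg_left h1 ht
    have e2 := mul_le_mul_of_nonneg_left h2 ht
    have e3 : (y₁ : ℝ) * (ξ₁ + ξ₂) ≤ t * η₁ :=
        h3.trans' (mul_le_mul_of_nonneg_left (by linarith) (by positivity))
    have e4 : (c : ℝ) * (ξ₁ + ξ₂) ≤ t * ζc :=
        h7.trans' (mul_le_mul_of_nonneg_left (by linarith) (by positivity))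
    have e5 : (x₁ : ℝ) * ξ₂ ≤ t * ξ₁ :=
        h1.trans' (mul_le_mul_of_nonneg_left (by linarith) (by positivity))
    have e6 : (x₂ : ℝ) * ξ₁ ≤ t * ξ₂ :=
        h2.trans' (mul_le_mul_of_nonneg_left (by linarith) (by positivity))
    have k1 : (x₁ : ℝ) * (x₂ * ξ₁ + (a + c + y₁) * (ξ₁ + ξ₂)) ≤
        x₁ * (t * ξ₂ + t * ζa + t * ζc + t * η₁) :=
          mul_le_mul_of_nonneg_left (by linarith) (by positivity)
    have k2 : (x₂ : ℝ) * (x₁ * ξ₂ + (a + c + y₁) * (ξ₁ + ξ₂)) ≤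
        x₂ * (t * ξ₁ + t * ζa + t * ζc + t * η₁) :=
          mul_le_mul_of_nonneg_left (by linarith) (by positivity)
    push_cast
    linarith
  have hY : (((y₁ + y₂) * (b + c) : ℕ) : ℝ) ≤ t ^ 2 := by
    have pη : 0 < η₁ + η₂ := by linarith
    refine le_of_mul_le_mul_right ?_ pη
    have e3 : (y₁ : ℝ) * (ζb + ζc) ≤ t * η₁ :=
        h3.trans' (mul_le_mul_of_nonneg_left (by linarith) (by positivity))
    have e4 : (c : ℝ) * (η₁ + η₂) ≤ t * ζc :=
        h7.trans' (mul_le_mul_of_nonneg_left (by linarith) (by positivity))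
    have k1 : ((y₁ : ℝ) + y₂) * ((b + c) * (η₁ + η₂)) ≤ (y₁ + y₂) * (t * (ζb + ζc)) :=
        mul_le_mul_of_nonneg_left (by linarith) (by positivity)
    have k2 : t * ((y₁ + y₂) * (ζb + ζc)) ≤ t * (t * η₁ + t * η₂) :=
        mul_le_mul_of_nonneg_left (by linarith) (by positivity)
    push_cast
    linarith
  rw [sub_le_iff_le_add]
  -- `hX` and `hY` count two-step returns to either side; the comparison of sizes decides which of
  -- them reaches n - 1.
  by_cases hcase : b + y₂ + 2 ≤ a + c + y₁ + x₁ + x₂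
  · have n1 := add_two_mul_le_mul_nat (u := x₁ + x₂) (v := a + c + y₁) (by omega) (by omega)
    have n2 := add_le_mul_nat hx₁ hx₂
    have n3 : x₁ + x₂ + y₁ + y₂ + a + b + c ≤ (x₁ + x₂) * (a + c + y₁) + x₁ * x₂ + 1 := by omega
    have : ((x₁ + x₂ + y₁ + y₂ + a + b + c : ℕ) : ℝ) ≤
      (((x₁ + x₂) * (a + c + y₁) + x₁ * x₂ : ℕ) : ℝ) + 1 := by exact_mod_cast n3
    linarith
  · have n1 := add_two_mul_le_mul_nat (u := y₁ + y₂) (v := b + c) (by omega) (by omega)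
    have n2 := add_two_mul_le_mul_nat (u := b + c) (v := y₁ + y₂) (by omega) (by omega)
    obtain ⟨w, hw⟩ : ∃ w, b + c = w + 2 := ⟨b + c - 2, by omega⟩
    obtain ⟨z, hz⟩ : ∃ z, y₁ + y₂ = z + 2 := ⟨y₁ + y₂ - 2, by omega⟩
    have n3 : (y₁ + y₂) * (b + c) = z * w + 2 * z + 2 * w + 4 := by rw [hw, hz]; ring
    have n4 : x₁ + x₂ + y₁ + y₂ + a + b + c ≤ (y₁ + y₂) * (b + c) + 1 := by
      rw [n3]; have := Nat.zero_le (z * w); omega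
    have : ((x₁ + x₂ + y₁ + y₂ + a + b + c : ℕ) : ℝ) ≤ (((y₁ + y₂) * (b + c) : ℕ) : ℝ) + 1 := by
      exact_mod_cast n4
    linarith

/-- Count two-step returns to x₁ ∪ x₂. The summand 1 comes from the detours over the links x₁y₁ and
x₂y₂, as xᵢyᵢ ≥ 1. -/
lemma le_sq_of_two_sided_aux {t ξ₁ ξ₂ η₁ η₂ ζa ζc : ℝ} {x₁ x₂ y₁ y₂ a c : ℕ}
    (hx₁ : 1 ≤ x₁) (hx₂ : 1 ≤ x₂) (hy₁ : 1 ≤ y₁) (hy₂ : 1 ≤ y₂) (ht : 0 ≤ t)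
    (pξ₁ : 0 < ξ₁) (pξ₂ : 0 < ξ₂) (pη₁ : 0 < η₁) (pη₂ : 0 < η₂) (pζa : 0 ≤ ζa) (pζc : 0 ≤ ζc)
    (h1 : x₁ * (ξ₂ + ζa + ζc + η₁) ≤ t * ξ₁) (h2 : x₂ * (ξ₁ + ζa + ζc + η₂) ≤ t * ξ₂)
    (h3 : y₁ * ξ₁ ≤ t * η₁) (h4 : y₂ * ξ₂ ≤ t * η₂)
    (h5 : a * (ξ₁ + ξ₂) ≤ t * ζa) (h7 : c * (ξ₁ + ξ₂) ≤ t * ζc) :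
    (((x₁ + x₂) * (a + c) + x₁ * x₂ + 1 : ℕ) : ℝ) ≤ t ^ 2 := by
  have pξ : 0 < ξ₁ + ξ₂ := by linarith
  refine le_of_mul_le_mul_right ?_ pξ
  have e1 := mul_le_mul_of_nonneg_left h1 ht
  have e2 := mul_le_mul_of_nonneg_left h2 ht
  have e5 : (x₁ : ℝ) * ξ₂ ≤ t * ξ₁ :=
      h1.trans' (mul_le_mul_of_nonneg_left (by linarith) (by positivity))
  have e6 : (x₂ : ℝ) * ξ₁ ≤ t * ξ₂ :=
      h2.trans' (mul_le_mul_of_nonneg_left (by linarith) (by positivity))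
  have k1 : (x₁ : ℝ) * (x₂ * ξ₁ + (a + c) * (ξ₁ + ξ₂) + y₁ * ξ₁) ≤
      x₁ * (t * ξ₂ + t * ζa + t * ζc + t * η₁) :=
        mul_le_mul_of_nonneg_left (by linarith) (by positivity)
  have k2 : (x₂ : ℝ) * (x₁ * ξ₂ + (a + c) * (ξ₁ + ξ₂) + y₂ * ξ₂) ≤
      x₂ * (t * ξ₁ + t * ζa + t * ζc + t * η₂) :=
        mul_le_mul_of_nonneg_left (by linarith) (by positivity)
  have n1 : (1 : ℝ) ≤ x₁ * y₁ := by exact_mod_cast Nat.mul_pos hx₁ hy₁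
  have n2 : (1 : ℝ) ≤ x₂ * y₂ := by exact_mod_cast Nat.mul_pos hx₂ hy₂
  have m1 := mul_le_mul_of_nonneg_right n1 pξ₁.le
  have m2 := mul_le_mul_of_nonneg_right n2 pξ₂.le
  push_cast
  linarith

/-- The estimate for two blown-up triangles `x₁x₂a`, `y₁y₂b` linked by `x₁y₁`, `x₂y₂` and by the
class `c`. -/
lemma le_sq_of_two_sided {t ξ₁ ξ₂ η₁ η₂ ζa ζb ζc : ℝ} {x₁ x₂ y₁ y₂ a b c : ℕ}
    (hx₁ : 1 ≤ x₁) (hx₂ : 1 ≤ x₂) (hy₁ : 1 ≤ y₁) (hy₂ : 1 ≤ y₂) (ha : 1 ≤ a) (hb : 1 ≤ b)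
    (ht : 0 ≤ t) (pξ₁ : 0 < ξ₁) (pξ₂ : 0 < ξ₂) (pη₁ : 0 < η₁) (pη₂ : 0 < η₂)
    (pζa : 0 ≤ ζa) (pζb : 0 ≤ ζb) (pζc : 0 ≤ ζc)
    (h1 : x₁ * (ξ₂ + ζa + ζc + η₁) ≤ t * ξ₁) (h2 : x₂ * (ξ₁ + ζa + ζc + η₂) ≤ t * ξ₂)
    (h3 : y₁ * (η₂ + ζb + ζc + ξ₁) ≤ t * η₁) (h4 : y₂ * (η₁ + ζb + ζc + ξ₂) ≤ t * η₂)
    (h5 : a * (ξ₁ + ξ₂) ≤ t * ζa) (h6 : b * (η₁ + η₂) ≤ t * ζb)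
    (h7 : c * (ξ₁ + ξ₂ + η₁ + η₂) ≤ t * ζc) :
    ((x₁ + x₂ + y₁ + y₂ + a + b + c : ℕ) : ℝ) ≤ t ^ 2 ∨
    ((x₁ + x₂ + y₁ + y₂ + a + b + c : ℕ) : ℝ) - 1 ≤ t ^ 2 ∧ 7 ≤ x₁ + x₂ + y₁ + y₂ + a + b + c := by
  have e1 : (y₁ : ℝ) * ξ₁ ≤ t * η₁ :=
      h3.trans' (mul_le_mul_of_nonneg_left (by linarith) (by positivity))
  have e2 : (y₂ : ℝ) * ξ₂ ≤ t * η₂ :=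
      h4.trans' (mul_le_mul_of_nonneg_left (by linarith) (by positivity))
  have e3 : (x₁ : ℝ) * η₁ ≤ t * ξ₁ :=
      h1.trans' (mul_le_mul_of_nonneg_left (by linarith) (by positivity))
  have e4 : (x₂ : ℝ) * η₂ ≤ t * ξ₂ :=
      h2.trans' (mul_le_mul_of_nonneg_left (by linarith) (by positivity))
  have hX := le_sq_of_two_sided_aux hx₁ hx₂ hy₁ hy₂ ht pξ₁ pξ₂ pη₁ pη₂ pζa pζc h1 h2 e1 e2 h5
    (h7.trans' (mul_le_mul_of_nonneg_left (by linarith) (by positivity)))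
  have hY := le_sq_of_two_sided_aux hy₁ hy₂ hx₁ hx₂ ht pη₁ pη₂ pξ₁ pξ₂ pζb pζc h3 h4 e3 e4 h6
    (h7.trans' (mul_le_mul_of_nonneg_left (by linarith) (by positivity)))
  by_cases hcX : b + y₁ + y₂ + 1 ≤ a + c + x₁ + x₂
  · right
    have n1 := add_two_mul_le_mul_nat (u := x₁ + x₂) (v := a + c) (by omega) (by omega)
    have n2 := add_le_mul_nat hx₁ hx₂
    have n3 : x₁ + x₂ + y₁ + y₂ + a + b + c ≤ ((x₁ + x₂) * (a + c) + x₁ * x₂ + 1) + 1 := by omega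
    refine ⟨?_, by omega⟩
    have : ((x₁ + x₂ + y₁ + y₂ + a + b + c : ℕ) : ℝ) ≤
      (((x₁ + x₂) * (a + c) + x₁ * x₂ + 1 : ℕ) : ℝ) + 1 := by exact_mod_cast n3
    linarith
  by_cases hcY : a + x₁ + x₂ + 1 ≤ b + c + y₁ + y₂
  · right
    have n1 := add_two_mul_le_mul_nat (u := y₁ + y₂) (v := b + c) (by omega) (by omega)
    have n2 := add_le_mul_nat hy₁ hy₂
    have n3 : x₁ + x₂ + y₁ + y₂ + a + b + c ≤ ((y₁ + y₂) * (b + c) + y₁ * y₂ + 1) + 1 := by omega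
    refine ⟨?_, by omega⟩
    have : ((x₁ + x₂ + y₁ + y₂ + a + b + c : ℕ) : ℝ) ≤
      (((y₁ + y₂) * (b + c) + y₁ * y₂ + 1 : ℕ) : ℝ) + 1 := by exact_mod_cast n3
    linarith
  -- What remains is c = 0 with sides of equal size, the only case containing order six, where n - 1
  -- would not suffice. Returns to all four classes x₁, x₂, y₁, y₂ are counted together and give t²
  -- ≥ n.
  left
  have hc0 : c = 0 := by omega
  have hbal : a + x₁ + x₂ = b + y₁ + y₂ := by omega
  have nX := add_two_mul_le_mul_nat (u := x₁ + x₂) (v := a) (by omega) (by omega)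
  have nY := add_two_mul_le_mul_nat (u := y₁ + y₂) (v := b) (by omega) (by omega)
  have nP := add_two_mul_le_mul_nat (u := x₂ + y₁) (v := x₁ + y₂) (by omega) (by omega)
  have mX : a + b ≤ (x₁ + x₂) * a := by omega
  have mY : a + b ≤ (y₁ + y₂) * b := by omega
  have mX' : ((a : ℝ) + b) * (ξ₁ + ξ₂) ≤ (x₁ + x₂) * a * (ξ₁ + ξ₂) := by
    refine mul_le_mul_of_nonneg_right ?_ (by linarith)
    exact_mod_cast mX
  have mY' : ((a : ℝ) + b) * (η₁ + η₂) ≤ (y₁ + y₂) * b * (η₁ + η₂) := by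
    refine mul_le_mul_of_nonneg_right ?_ (by linarith)
    exact_mod_cast mY
  have hall : (((x₂ + y₁) * (x₁ + y₂) + (a + b) : ℕ) : ℝ) ≤ t ^ 2 := by
    have ps : 0 < ξ₁ + ξ₂ + η₁ + η₂ := by linarith
    refine le_of_mul_le_mul_right ?_ ps
    have g1 : (x₁ : ℝ) * (ξ₂ + η₁) ≤ t * ξ₁ :=
        h1.trans' (mul_le_mul_of_nonneg_left (by linarith) (by positivity))
    have g2 : (x₂ : ℝ) * (ξ₁ + η₂) ≤ t * ξ₂ :=
        h2.trans' (mul_le_mul_of_nonneg_left (by linarith) (by positivity))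
    have g3 : (y₁ : ℝ) * (η₂ + ξ₁) ≤ t * η₁ :=
        h3.trans' (mul_le_mul_of_nonneg_left (by linarith) (by positivity))
    have g4 : (y₂ : ℝ) * (η₁ + ξ₂) ≤ t * η₂ :=
        h4.trans' (mul_le_mul_of_nonneg_left (by linarith) (by positivity))
    have f1 := mul_le_mul_of_nonneg_left h1 ht
    have f2 := mul_le_mul_of_nonneg_left h2 ht
    have f3 := mul_le_mul_of_nonneg_left h3 ht
    have f4 := mul_le_mul_of_nonneg_left h4 ht
    have pc : 0 ≤ t * ζc := mul_nonneg ht pζc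
    have k1 : (x₁ : ℝ) * (x₂ * (ξ₁ + η₂) + a * (ξ₁ + ξ₂) + y₁ * (η₂ + ξ₁)) ≤
        x₁ * (t * ξ₂ + t * ζa + t * ζc + t * η₁) :=
          mul_le_mul_of_nonneg_left (by linarith) (by positivity)
    have k2 : (x₂ : ℝ) * (x₁ * (ξ₂ + η₁) + a * (ξ₁ + ξ₂) + y₂ * (η₁ + ξ₂)) ≤
        x₂ * (t * ξ₁ + t * ζa + t * ζc + t * η₂) :=
          mul_le_mul_of_nonneg_left (by linarith) (by positivity)
    have k3 : (y₁ : ℝ) * (y₂ * (η₁ + ξ₂) + b * (η₁ + η₂) + x₁ * (ξ₂ + η₁)) ≤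
        y₁ * (t * η₂ + t * ζb + t * ζc + t * ξ₁) :=
          mul_le_mul_of_nonneg_left (by linarith) (by positivity)
    have k4 : (y₂ : ℝ) * (y₁ * (η₂ + ξ₁) + b * (η₁ + η₂) + x₂ * (ξ₁ + η₂)) ≤
        y₂ * (t * η₁ + t * ζb + t * ζc + t * ξ₂) :=
          mul_le_mul_of_nonneg_left (by linarith) (by positivity)
    push_cast
    linarith
  have n4 : x₁ + x₂ + y₁ + y₂ + a + b + c ≤ (x₂ + y₁) * (x₁ + y₂) + (a + b) := by
    have := add_two_mul_le_mul_nat (u := x₁ + y₂) (v := x₂ + y₁) (by omega) (by omega)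
    rw [mul_comm (x₁ + y₂)] at this
    omega
  refine le_trans ?_ hall
  exact_mod_cast n4

end Estimates

/-! ### Structure of rank-five graphs of diameter at least three -/

section Structure

variable {V : Type*} {G : SimpleGraph V}

lemma exists_crossing_adj (hG : G.Connected) (S : Set V) {a b : V} (ha : a ∈ S) (hb : b ∉ S) :
    ∃ u v, u ∈ S ∧ v ∉ S ∧ G.Adj u v := by
  obtain ⟨w⟩ := hG.preconnected a b
  obtain ⟨d, -, h1, h2⟩ := w.exists_boundary_dart S ha hb
  exact ⟨d.fst, d.snd, h1, h2, d.adj⟩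

lemma exists_isLinked_of_root {A B C D L : V → Prop}
    (hcov : ∀ v, A v ∨ B v ∨ C v ∨ D v ∨ L v)
    (hAB : ∀ u v, A u → B v → G.Adj u v) (hAC : ∀ u v, A u → C v → G.Adj u v)
    (hBC : ∀ u v, B u → C v → G.Adj u v) (hAA : ∀ u v, A u → A v → ¬ G.Adj u v)
    (hBB : ∀ u v, B u → B v → ¬ G.Adj u v) (hCC : ∀ u v, C u → C v → ¬ G.Adj u v)
    (hDD : ∀ u v, D u → D v → ¬ G.Adj u v) (hLL : ∀ u v, L u → L v → ¬ G.Adj u v)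
    (hLD : ∀ u v, L u → D v → G.Adj u v) (hLA : ∀ u v, L u → A v → ¬ G.Adj u v)
    (hLB : ∀ u v, L u → B v → ¬ G.Adj u v) (hLC : ∀ u v, L u → C v → ¬ G.Adj u v)
    (hB : ∃ v, B v) (hC : ∃ v, C v) (hD : ∃ v, D v) (hL : ∃ v, L v)
    {r : V} (hr : A r) (hlink : ∀ v, D v → G.Adj r v) : ∃ κ r, IsLinked G κ r := by
  classical
  have hir : ∀ v, ¬ G.Adj v v := fun v => G.irrefl
  have hsymm : ∀ u v, G.Adj u v → G.Adj v u := fun _ _ h => h.symm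
  let P : Fin 5 → V → Prop := ![A, B, C, D, L]
  have hP : ∀ v, ∃ i, P i v := by
    intro v
    rcases hcov v with h | h | h | h | h
    exacts [⟨0, h⟩, ⟨1, h⟩, ⟨2, h⟩, ⟨3, h⟩, ⟨4, h⟩]
  choose κ hκ using hP
  have k0 : ∀ v, κ v = 0 → A v := fun v h => by have := hκ v; rwa [h] at this
  have k1 : ∀ v, κ v = 1 → B v := fun v h => by have := hκ v; rwa [h] at this
  have k2 : ∀ v, κ v = 2 → C v := fun v h => by have := hκ v; rwa [h] at this
  have k3 : ∀ v, κ v = 3 → D v := fun v h => by have := hκ v; rwa [h] at this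
  have k4 : ∀ v, κ v = 4 → L v := fun v h => by have := hκ v; rwa [h] at this
  have hall : ∀ v, κ v = 0 ∨ κ v = 1 ∨ κ v = 2 ∨ κ v = 3 ∨ κ v = 4 := by
    intro v; generalize κ v = i; fin_cases i <;> simp
  obtain ⟨b, hb⟩ := hB
  obtain ⟨c, hc⟩ := hC
  obtain ⟨d, hd⟩ := hD
  obtain ⟨l, hl⟩ := hL
  have j0 : κ r = 0 := by rcases hall r with h | h | h | h | h <;> grind
  have j1 : κ b = 1 := by rcases hall b with h | h | h | h | h <;> grind
  have j2 : κ c = 2 := by rcases hall c with h | h | h | h | h <;> grind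
  have j3 : κ d = 3 := by rcases hall d with h | h | h | h | h <;> grind
  have j4 : κ l = 4 := by rcases hall l with h | h | h | h | h <;> grind
  refine ⟨κ, r, ?_, ?_, ?_, j0, fun v hv => hlink v (k3 v hv), ?_⟩
  · intro u v hu hv
    rcases hall u with h | h | h | h | h <;> rcases hall v with h' | h' | h' | h' | h' <;>
      rw [h] at hu <;> rw [h'] at hv <;> first | (exfalso; revert hu hv; decide) | skip
    all_goals rw [h, h']
    all_goals grind
  · intro u v hu
    have := k4 u hu
    rcases hall v with h' | h' | h' | h' | h' <;> rw [h'] <;> grind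
  · intro u v hu hv
    exact hDD u v (k3 u hu) (k3 v hv)
  · intro i
    fin_cases i
    exacts [⟨r, j0⟩, ⟨b, j1⟩, ⟨c, j2⟩, ⟨d, j3⟩, ⟨l, j4⟩]

lemma exists_isLinked {A B C D L : V → Prop}
    (hcov : ∀ v, A v ∨ B v ∨ C v ∨ D v ∨ L v)
    (hAB : ∀ u v, A u → B v → G.Adj u v) (hAC : ∀ u v, A u → C v → G.Adj u v)
    (hBC : ∀ u v, B u → C v → G.Adj u v) (hAA : ∀ u v, A u → A v → ¬ G.Adj u v)
    (hBB : ∀ u v, B u → B v → ¬ G.Adj u v) (hCC : ∀ u v, C u → C v → ¬ G.Adj u v)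
    (hDD : ∀ u v, D u → D v → ¬ G.Adj u v) (hLL : ∀ u v, L u → L v → ¬ G.Adj u v)
    (hLD : ∀ u v, L u → D v → G.Adj u v) (hLA : ∀ u v, L u → A v → ¬ G.Adj u v)
    (hLB : ∀ u v, L u → B v → ¬ G.Adj u v) (hLC : ∀ u v, L u → C v → ¬ G.Adj u v)
    (hA : ∃ v, A v) (hB : ∃ v, B v) (hC : ∃ v, C v) (hD : ∃ v, D v) (hL : ∃ v, L v)
    {r : V} (hr : A r ∨ B r ∨ C r) (hlink : ∀ v, D v → G.Adj r v) : ∃ κ r, IsLinked G κ r := by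
  rcases hr with hr | hr | hr
  · exact exists_isLinked_of_root hcov hAB hAC hBC hAA hBB hCC hDD hLL hLD hLA hLB hLC hB hC hD hL
      hr hlink
  · exact exists_isLinked_of_root (fun v => by have := hcov v; tauto)
      (fun u v hu hv => (hAB v u hv hu).symm) hBC hAC hBB hAA hCC hDD hLL hLD hLB hLA hLC hA hC hD
      hL hr hlink
  · exact exists_isLinked_of_root (fun v => by have := hcov v; tauto)
      (fun u v hu hv => (hAC v u hv hu).symm) (fun u v hu hv => (hBC v u hv hu).symm) hAB hCC hAA
      hBB hDD hLL hLD hLC hLA hLB hA hB hD hL hr hlink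

lemma IsPerron.card_colourClass_mul_le [Fintype V] {t : ℝ} {x : V → ℝ} (h : IsPerron G t x) {k : ℕ}
    (κ : V → Fin k) (i : Fin k) (J : Finset (Fin k))
    (hJ : ∀ u v, κ u = i → κ v ∈ J → G.Adj u v) :
    ((colourClass κ i).card : ℝ) * ∑ j ∈ J, ∑ v ∈ colourClass κ j, x v ≤
      t * ∑ v ∈ colourClass κ i, x v := by
  classical
  rw [← Finset.sum_biUnion]
  · refine h.card_mul_sum_le fun u hu v hv => hJ u v (mem_colourClass.mp hu) ?_
    obtain ⟨j, hj, hv⟩ := Finset.mem_biUnion.mp hv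
    rwa [mem_colourClass.mp hv]
  · intro i _ j _ hij
    exact colourClass_disjoint hij

end Structure

/-- With `a`, `c` read as adjacency to p, q, the colours are the two sides of N(p) (0, 1), two parts
of N(q) (2, 3), and the remaining vertices according to whether they see only N(p) (4), only N(q)
(5) or both (6). -/
lemma exists_sevenColouring {V : Type*} (a b c d e : V → Prop) : ∃ κ : V → Fin 7,
    (∀ v, κ v = 0 ↔ a v ∧ ¬ b v) ∧ (∀ v, κ v = 1 ↔ a v ∧ b v) ∧
    (∀ v, κ v = 2 ↔ ¬ a v ∧ c v ∧ d v) ∧ (∀ v, κ v = 3 ↔ ¬ a v ∧ c v ∧ ¬ d v) ∧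
    (∀ v, κ v = 4 ↔ ¬ a v ∧ ¬ c v ∧ b v ∧ ¬ e v) ∧ (∀ v, κ v = 5 ↔ ¬ a v ∧ ¬ c v ∧ ¬ b v) ∧
    (∀ v, κ v = 6 ↔ ¬ a v ∧ ¬ c v ∧ b v ∧ e v) := by
  classical
  refine ⟨fun v => if a v then (if b v then 1 else 0) else if c v then (if d v then 2 else 3)
    else if b v then (if e v then 6 else 4) else 5, ?_, ?_, ?_, ?_, ?_, ?_, ?_⟩ <;>
  · intro v
    dsimp only
    split_ifs <;> simp_all

namespace FarEdges

variable {V : Type*} [Fintype V] {G : SimpleGraph V} {p x q y : V}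

lemma outer_adj (h : FarEdges G p x q y) (hr : graphRank G = 5) (hG : G.Connected) {w : V}
    (hp : ¬ G.Adj p w) (hq : ¬ G.Adj q w) : G.Adj w x ∨ G.Adj w y := by
  by_cases hw : w = x
  · exact absurd (hw ▸ h.px) hp
  obtain ⟨u, v, rfl, -, huv⟩ := exists_crossing_adj hG {w} (Set.mem_singleton w)
    (fun h' : x ∈ ({w} : Set V) => hw h'.symm)
  by_cases hpv : G.Adj p v
  · exact Or.inl ((h.outer_adj_iff hr hp hq hpv).mp huv)
  by_cases hqv : G.Adj q v
  · exact Or.inr ((h.symm.outer_adj_iff hr hq hp hqv).mp huv)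
  · exact absurd huv (h.outer_not_adj hr hp hq hpv hqv)

/-- All cross entries of the Schur complement vanish, so the adjacency between N(p) and N(q) is a
function of u plus a function of v. A zero-one matrix of this kind depends on only one of its
indices. -/
lemma cross_iff (h : FarEdges G p x q y) (hr : graphRank G = 5)
    (hy : ∀ v, G.Adj q v → ¬ G.Adj y v) :
    (∀ u v, G.Adj p u → G.Adj q v → (G.Adj u v ↔ G.Adj u y)) ∨
    ((∀ u v, G.Adj p u → G.Adj q v → (G.Adj u v ↔ G.Adj x v)) ∧
      (∃ v, G.Adj q v ∧ G.Adj x v) ∧ ∃ v, G.Adj q v ∧ ¬ G.Adj x v) := by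
  have hc : ∀ u v, G.Adj p u → G.Adj q v → ind G u v + ind G x y = ind G x v + ind G u y :=
    fun u v hu hv => h.cross_add hr hu hv (Or.inr (hy v hv))
  by_cases h1 : ∀ v, G.Adj q v → (G.Adj x v ↔ G.Adj x y)
  · left
    intro u v hu hv
    have h2 : ind G x v = ind G x y := by
      by_cases hxy : G.Adj x y
      · rw [ind_of_adj hxy, ind_of_adj ((h1 v hv).mpr hxy)]
      · rw [ind_of_not_adj hxy, ind_of_not_adj (mt (h1 v hv).mp hxy)]
    have h3 := hc u v hu hv
    rw [← ind_eq_one_iff, ← ind_eq_one_iff, show ind G u v = ind G u y by linarith]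
  · right
    push Not at h1
    obtain ⟨v₁, hv₁, hne⟩ := h1
    have hne' : ¬ (G.Adj x v₁ ↔ G.Adj x y) := by tauto
    have h4 : ∀ u, G.Adj p u → ind G u y = ind G x y := by
      intro u hu
      have h3 := hc u v₁ hu hv₁
      rcases ind_zero_or_one G x y with e1 | e1 <;> rcases ind_zero_or_one G x v₁ with e2 | e2 <;>
      rcases ind_zero_or_one G u v₁ with e3 | e3 <;> rcases ind_zero_or_one G u y with e4 | e4 <;>
      first
      | (rw [e1, e4]; done)
      | (exfalso; rw [e1, e2, e3, e4] at h3; norm_num at h3; done)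
      | (exfalso; simp only [ind_eq_one_iff, ind_eq_zero_iff] at e1 e2; tauto)
    refine ⟨fun u v hu hv => ?_, ?_⟩
    · have h3 := hc u v hu hv
      have h5 := h4 u hu
      rw [← ind_eq_one_iff, ← ind_eq_one_iff, show ind G u v = ind G x v by linarith]
    · by_cases hxy : G.Adj x y
      · exact ⟨⟨y, h.qy, hxy⟩, v₁, hv₁, by tauto⟩
      · exact ⟨⟨v₁, hv₁, by tauto⟩, y, h.qy, hxy⟩

/-- The case where `N(q)` is independent and is not separated by the neighbours of `p`. -/
lemma exists_isLinked_of_left (h : FarEdges G p x q y) (hr : graphRank G = 5) (hG : G.Connected)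
    (hx : ∃ u, G.Adj p u ∧ G.Adj x u) (hy : ∀ v, G.Adj q v → ¬ G.Adj y v)
    (hc : ∀ u v, G.Adj p u → G.Adj q v → (G.Adj u v ↔ G.Adj u y)) : ∃ κ r, IsLinked G κ r := by
  have hsymm : ∀ u v, G.Adj u v → G.Adj v u := fun _ _ h => h.symm
  have hpx := h.px
  have hqy := h.qy
  have hpq := h.pq
  have hcom := h.common
  have hir : ∀ v, ¬ G.Adj v v := fun v => G.irrefl
  have f1 : ∀ u v, ¬ G.Adj p u → ¬ G.Adj q u → ¬ G.Adj p v → ¬ G.Adj q v → ¬ G.Adj u v :=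
    fun _ _ a b c d => h.outer_not_adj hr a b c d
  have f2 : ∀ w u, ¬ G.Adj p w → ¬ G.Adj q w → G.Adj p u → (G.Adj w u ↔ G.Adj w x) :=
    fun _ _ a b c => h.outer_adj_iff hr a b c
  have f3 : ∀ w u, ¬ G.Adj p w → ¬ G.Adj q w → G.Adj q u → (G.Adj w u ↔ G.Adj w y) :=
    fun _ _ a b c => h.symm.outer_adj_iff hr b a c
  have f4 : ∀ u v, G.Adj p u → G.Adj p v → (G.Adj u v ↔ ¬ (G.Adj x u ↔ G.Adj x v)) :=
    fun _ _ a b => h.inner_adj_iff hr a b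
  have f5 : ∀ u v, G.Adj q u → G.Adj q v → ¬ G.Adj u v := fun u v a b hadj => by
    have := (h.symm.inner_adj_iff hr a b).mp hadj
    have := hy u a
    have := hy v b
    tauto
  have f6 : ∀ w, ¬ G.Adj p w → ¬ G.Adj q w → G.Adj w x ∨ G.Adj w y :=
    fun _ a b => h.outer_adj hr hG a b
  obtain ⟨u₀, hu₀⟩ := hx
  let A : V → Prop := fun v => G.Adj p v ∧ ¬ G.Adj x v
  let B : V → Prop := fun v => G.Adj p v ∧ G.Adj x v
  let C : V → Prop := fun v => ¬ G.Adj p v ∧ ¬ G.Adj q v ∧ G.Adj x v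
  let D : V → Prop := fun v => G.Adj q v
  let L : V → Prop := fun v => ¬ G.Adj p v ∧ ¬ G.Adj q v ∧ ¬ G.Adj x v
  have hLA : ∀ u v, L u → A v → ¬ G.Adj u v := by grind
  have hLB : ∀ u v, L u → B v → ¬ G.Adj u v := by grind
  have hLC : ∀ u v, L u → C v → ¬ G.Adj u v := by grind
  -- An edge leaving the tripartite part must end in D = N(q), and its origin sees all of N(q) as
  -- soon as it sees one vertex there; so it can serve as root.
  obtain ⟨r, v, hr', hv, hrv⟩ := exists_crossing_adj hG {v | A v ∨ B v ∨ C v}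
    (a := x) (b := q) (by simp only [Set.mem_ofPred_eq]; grind)
    (by simp only [Set.mem_ofPred_eq]; grind)
  simp only [Set.mem_ofPred_eq] at hr' hv
  refine exists_isLinked (A := A) (B := B) (C := C) (D := D) (L := L) (by grind) (by grind)
    (by grind) (by grind) (by grind) (by grind) (by grind) (by grind) (by grind) (by grind)
    hLA hLB hLC ⟨x, by grind⟩ ⟨u₀, by grind⟩ ⟨p, by grind⟩ ⟨y, by grind⟩ ⟨q, by grind⟩ hr' ?_
  have hv' : D v := by
    by_contra hD
    have hL : L v := by grind
    rcases hr' with h' | h' | h'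
    · exact hLA v r hL h' hrv.symm
    · exact hLB v r hL h' hrv.symm
    · exact hLC v r hL h' hrv.symm
  intro w hw
  grind

/-- The case where `N(q)` is independent and is separated by the neighbours of `p`. -/
lemma isLinked_or_le_of_left (h : FarEdges G p x q y) (hr : graphRank G = 5) (hG : G.Connected)
    (hx : ∃ u, G.Adj p u ∧ G.Adj x u) (hy : ∀ v, G.Adj q v → ¬ G.Adj y v)
    (hc : ∀ u v, G.Adj p u → G.Adj q v → (G.Adj u v ↔ G.Adj x v))
    (hy₁ : ∃ v, G.Adj q v ∧ G.Adj x v) (hy₂ : ∃ v, G.Adj q v ∧ ¬ G.Adj x v)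
    {t : ℝ} {z : V → ℝ} (hz : IsPerron G t z) :
    (∃ κ r, IsLinked G κ r) ∨ (7 ≤ Fintype.card V ∧ (Fintype.card V : ℝ) - 1 ≤ t ^ 2) := by
  classical
  have hsymm : ∀ u v, G.Adj u v → G.Adj v u := fun _ _ h => h.symm
  have hpx := h.px
  have hqy := h.qy
  have hpq := h.pq
  have hcom := h.common
  have hir : ∀ v, ¬ G.Adj v v := fun v => G.irrefl
  have f1 : ∀ u v, ¬ G.Adj p u → ¬ G.Adj q u → ¬ G.Adj p v → ¬ G.Adj q v → ¬ G.Adj u v :=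
    fun _ _ a b c d => h.outer_not_adj hr a b c d
  have f2 : ∀ w u, ¬ G.Adj p w → ¬ G.Adj q w → G.Adj p u → (G.Adj w u ↔ G.Adj w x) :=
    fun _ _ a b c => h.outer_adj_iff hr a b c
  have f3 : ∀ w u, ¬ G.Adj p w → ¬ G.Adj q w → G.Adj q u → (G.Adj w u ↔ G.Adj w y) :=
    fun _ _ a b c => h.symm.outer_adj_iff hr b a c
  have f4 : ∀ u v, G.Adj p u → G.Adj p v → (G.Adj u v ↔ ¬ (G.Adj x u ↔ G.Adj x v)) :=
    fun _ _ a b => h.inner_adj_iff hr a b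
  have f5 : ∀ u v, G.Adj q u → G.Adj q v → ¬ G.Adj u v := fun u v a b hadj => by
    have := (h.symm.inner_adj_iff hr a b).mp hadj
    have := hy u a
    have := hy v b
    tauto
  have f6 : ∀ w, ¬ G.Adj p w → ¬ G.Adj q w → G.Adj w x ∨ G.Adj w y :=
    fun _ a b => h.outer_adj hr hG a b
  obtain ⟨u₀, hu₀⟩ := hx
  obtain ⟨y₁, hy₁⟩ := hy₁
  obtain ⟨y₂, hy₂⟩ := hy₂
  -- A vertex outside both neighbourhoods that sees both makes the spectral radius large. Without
  -- one, the neighbours of x outside N(p) form an independent third class, q belongs to the centre,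
  -- and y₁ is the root.
  by_cases hzz : ∃ w, ¬ G.Adj p w ∧ ¬ G.Adj q w ∧ G.Adj w x ∧ G.Adj w y
  · right
    obtain ⟨w, hw⟩ := hzz
    obtain ⟨κ, k0, k1, k2, k3, k4, k5, k6⟩ := exists_sevenColouring (fun v => G.Adj p v)
      (fun v => G.Adj v x) (fun v => G.Adj q v) (fun v => G.Adj v x) (fun v => G.Adj v y)
    have hn := sum_card_colourClass κ
    rw [Fin.sum_univ_seven] at hn
    have n0 : (colourClass κ 0).Nonempty := ⟨x, mem_colourClass.mpr <| by grind⟩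
    have n1 : (colourClass κ 1).Nonempty := ⟨u₀, mem_colourClass.mpr <| by grind⟩
    have n2 : (colourClass κ 2).Nonempty := ⟨y₁, mem_colourClass.mpr <| by grind⟩
    have n3 : (colourClass κ 3).Nonempty := ⟨y₂, mem_colourClass.mpr <| by grind⟩
    have n4 : (colourClass κ 4).Nonempty := ⟨p, mem_colourClass.mpr <| by grind⟩
    have n5 : (colourClass κ 5).Nonempty := ⟨q, mem_colourClass.mpr <| by grind⟩
    have n6 : (colourClass κ 6).Nonempty := ⟨w, mem_colourClass.mpr <| by grind⟩
    have e0 := hz.card_colourClass_mul_le κ 0 {1, 4, 6, 2} (by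
      simp only [Finset.mem_insert, Finset.mem_singleton]; grind)
    have e1 := hz.card_colourClass_mul_le κ 1 {0, 4, 6, 2} (by
      simp only [Finset.mem_insert, Finset.mem_singleton]; grind)
    have e2 := hz.card_colourClass_mul_le κ 2 {0, 1, 5, 6} (by
      simp only [Finset.mem_insert, Finset.mem_singleton]; grind)
    have e3 := hz.card_colourClass_mul_le κ 3 {5, 6} (by
      simp only [Finset.mem_insert, Finset.mem_singleton]; grind)
    have e4 := hz.card_colourClass_mul_le κ 4 {0, 1} (by
      simp only [Finset.mem_insert, Finset.mem_singleton]; grind)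
    have e5 := hz.card_colourClass_mul_le κ 5 {2, 3} (by
      simp only [Finset.mem_insert, Finset.mem_singleton]; grind)
    have e6 := hz.card_colourClass_mul_le κ 6 {0, 1, 2, 3} (by
      simp only [Finset.mem_insert, Finset.mem_singleton]; grind)
    simp only [Finset.sum_insert, Finset.sum_singleton, Finset.mem_insert, Finset.mem_singleton,
      Fin.isValue, Fin.reduceEq, or_self, not_false_eq_true, ← add_assoc] at e0 e1 e2 e3 e4 e5 e6
    have ht : 0 ≤ t := haveI : Nonempty V := ⟨x⟩; hz.nonneg
    have hle := le_sq_of_one_sided (Finset.card_pos.mpr n0) (Finset.card_pos.mpr n1)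
      (Finset.card_pos.mpr n2) (Finset.card_pos.mpr n3) (Finset.card_pos.mpr n4)
      (Finset.card_pos.mpr n5) (Finset.card_pos.mpr n6) ht (hz.sum_pos n0) (hz.sum_pos n1)
      (hz.sum_pos n2) (hz.sum_pos n3) (hz.sum_pos n4) (hz.sum_pos n5) (hz.sum_pos n6)
      e0 e1 e2 e3 e4 e5 e6
    have := Finset.card_pos.mpr n0
    have := Finset.card_pos.mpr n1
    have := Finset.card_pos.mpr n2
    have := Finset.card_pos.mpr n3
    have := Finset.card_pos.mpr n4
    have := Finset.card_pos.mpr n5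
    have := Finset.card_pos.mpr n6
    refine ⟨by omega, ?_⟩
    rwa [hn] at hle
  · left
    push Not at hzz
    let A : V → Prop := fun v => G.Adj p v ∧ ¬ G.Adj x v
    let B : V → Prop := fun v => G.Adj p v ∧ G.Adj x v
    let C : V → Prop := fun v => ¬ G.Adj p v ∧ G.Adj x v
    let D : V → Prop := fun v => ¬ G.Adj p v ∧ ¬ G.Adj q v ∧ ¬ G.Adj x v
    let L : V → Prop := fun v => G.Adj q v ∧ ¬ G.Adj x v
    have hCC : ∀ u v, C u → C v → ¬ G.Adj u v := by
      intro u v ⟨hpu, hxu⟩ ⟨hpv, hxv⟩ huv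
      by_cases hqu : G.Adj q u <;> by_cases hqv : G.Adj q v
      · exact f5 u v hqu hqv huv
      · exact hzz v hpv hqv hxv.symm ((f3 v u hpv hqv hqu).mp huv.symm)
      · exact hzz u hpu hqu hxu.symm ((f3 u v hpu hqu hqv).mp huv)
      · exact f1 u v hpu hqu hpv hqv huv
    have hLC : ∀ u v, L u → C v → ¬ G.Adj u v := by
      intro u v ⟨hqu, hxu⟩ ⟨hpv, hxv⟩ huv
      by_cases hqv : G.Adj q v
      · exact f5 u v hqu hqv huv
      · exact hzz v hpv hqv hxv.symm ((f3 v u hpv hqv hqu).mp huv.symm)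
    refine exists_isLinked (A := A) (B := B) (C := C) (D := D) (L := L) (by grind) (by grind)
      (by grind) (by grind) (by grind) (by grind) hCC (by grind) (by grind) (by grind)
      (by grind) (by grind) hLC ⟨x, by grind⟩ ⟨u₀, by grind⟩ ⟨p, by grind⟩ ⟨q, by grind⟩
      ⟨y₂, by grind⟩ (r := y₁) (by grind) (by grind)

/-- The case where both `N(p)` and `N(q)` span edges. -/
lemma le_of_both (h : FarEdges G p x q y) (hr : graphRank G = 5) (hG : G.Connected)
    (hxy : G.Adj x y) (hx : ∃ u, G.Adj p u ∧ G.Adj x u) (hy : ∃ v, G.Adj q v ∧ G.Adj y v)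
    {t : ℝ} {z : V → ℝ} (hz : IsPerron G t z) :
    (6 ≤ Fintype.card V ∧ (Fintype.card V : ℝ) ≤ t ^ 2) ∨
      (7 ≤ Fintype.card V ∧ (Fintype.card V : ℝ) - 1 ≤ t ^ 2) := by
  classical
  obtain ⟨u₀, hu₀⟩ := hx
  obtain ⟨v₀, hv₀⟩ := hy
  have hsymm : ∀ u v, G.Adj u v → G.Adj v u := fun _ _ h => h.symm
  have hpx := h.px
  have hqy := h.qy
  have hpq := h.pq
  have hcom := h.common
  have hir : ∀ v, ¬ G.Adj v v := fun v => G.irrefl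
  have f2 : ∀ w u, ¬ G.Adj p w → ¬ G.Adj q w → G.Adj p u → (G.Adj w u ↔ G.Adj w x) :=
    fun _ _ a b c => h.outer_adj_iff hr a b c
  have f3 : ∀ w u, ¬ G.Adj p w → ¬ G.Adj q w → G.Adj q u → (G.Adj w u ↔ G.Adj w y) :=
    fun _ _ a b c => h.symm.outer_adj_iff hr b a c
  have f4 : ∀ u v, G.Adj p u → G.Adj p v → (G.Adj u v ↔ ¬ (G.Adj x u ↔ G.Adj x v)) :=
    fun _ _ a b => h.inner_adj_iff hr a b
  have f5 : ∀ u v, G.Adj q u → G.Adj q v → (G.Adj u v ↔ ¬ (G.Adj y u ↔ G.Adj y v)) :=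
    fun _ _ a b => h.symm.inner_adj_iff hr a b
  have f6 : ∀ w, ¬ G.Adj p w → ¬ G.Adj q w → G.Adj w x ∨ G.Adj w y :=
    fun _ a b => h.outer_adj hr hG a b
  obtain ⟨-, g1, g2⟩ := (h.cross_of_adj hr hu₀.1 hv₀.1 hu₀.2 hv₀.2).1 hxy
  have f7 : ∀ u v, G.Adj p u → G.Adj q v → G.Adj x u → G.Adj y v → G.Adj u v :=
    fun u v a b c d => ((h.cross_of_adj hr a b c d).1 hxy).1
  have f8 : ∀ u v, G.Adj p u → G.Adj q v → ¬ G.Adj x u → ¬ G.Adj y v → G.Adj u v := by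
    intro u v hu hv hxu hyv
    -- As u₀y and xv₀ are not edges, `e1` and `e2` make xv and uy edges, and `e3` then gives uv.
    have e1 := h.cross_add hr hu₀.1 hv (Or.inr hyv)
    have e2 := h.cross_add hr hu hv₀.1 (Or.inl hxu)
    have e3 := h.cross_add hr hu hv (Or.inl hxu)
    rw [ind_of_adj hxy] at e1 e2 e3
    rw [ind_of_not_adj g2] at e1
    rw [ind_of_not_adj g1] at e2
    have i1 := ind_nonneg G u₀ v
    have i2 := ind_nonneg G u v₀
    rcases ind_zero_or_one G u v with e | e
    · rcases ind_zero_or_one G x v with e' | e' <;> rcases ind_zero_or_one G u y with e'' | e'' <;>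
      · rw [e, e', e''] at e3
        rw [e'] at e1
        rw [e''] at e2
        exfalso
        linarith
    · exact ind_eq_one_iff.mp e
  obtain ⟨κ, k0, k1, k2, k3, k4, k5, k6⟩ := exists_sevenColouring (fun v => G.Adj p v)
    (fun v => G.Adj x v) (fun v => G.Adj q v) (fun v => ¬ G.Adj y v) (fun v => G.Adj y v)
  have hn := sum_card_colourClass κ
  rw [Fin.sum_univ_seven] at hn
  have n0 : (colourClass κ 0).Nonempty := ⟨x, mem_colourClass.mpr <| by grind⟩
  have n1 : (colourClass κ 1).Nonempty := ⟨u₀, mem_colourClass.mpr <| by grind⟩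
  have n2 : (colourClass κ 2).Nonempty := ⟨y, mem_colourClass.mpr <| by grind⟩
  have n3 : (colourClass κ 3).Nonempty := ⟨v₀, mem_colourClass.mpr <| by grind⟩
  have n4 : (colourClass κ 4).Nonempty := ⟨p, mem_colourClass.mpr <| by grind⟩
  have n5 : (colourClass κ 5).Nonempty := ⟨q, mem_colourClass.mpr <| by grind⟩
  have e0 := hz.card_colourClass_mul_le κ 0 {1, 4, 6, 2} (by
    simp only [Finset.mem_insert, Finset.mem_singleton]; grind)
  have e1 := hz.card_colourClass_mul_le κ 1 {0, 4, 6, 3} (by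
    simp only [Finset.mem_insert, Finset.mem_singleton]; grind)
  have e2 := hz.card_colourClass_mul_le κ 2 {3, 5, 6, 0} (by
    simp only [Finset.mem_insert, Finset.mem_singleton]; grind)
  have e3 := hz.card_colourClass_mul_le κ 3 {2, 5, 6, 1} (by
    simp only [Finset.mem_insert, Finset.mem_singleton]; grind)
  have e4 := hz.card_colourClass_mul_le κ 4 {0, 1} (by
    simp only [Finset.mem_insert, Finset.mem_singleton]; grind)
  have e5 := hz.card_colourClass_mul_le κ 5 {2, 3} (by
    simp only [Finset.mem_insert, Finset.mem_singleton]; grind)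
  have e6 := hz.card_colourClass_mul_le κ 6 {0, 1, 2, 3} (by
    simp only [Finset.mem_insert, Finset.mem_singleton]; grind)
  simp only [Finset.sum_insert, Finset.sum_singleton, Finset.mem_insert, Finset.mem_singleton,
    Fin.isValue, Fin.reduceEq, or_self, not_false_eq_true, ← add_assoc] at e0 e1 e2 e3 e4 e5 e6
  have ht : 0 ≤ t := haveI : Nonempty V := ⟨x⟩; hz.nonneg
  have hle := le_sq_of_two_sided (Finset.card_pos.mpr n0) (Finset.card_pos.mpr n1)
    (Finset.card_pos.mpr n2) (Finset.card_pos.mpr n3) (Finset.card_pos.mpr n4)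
    (Finset.card_pos.mpr n5) ht (hz.sum_pos n0) (hz.sum_pos n1)
    (hz.sum_pos n2) (hz.sum_pos n3) (hz.sum_nonneg _) (hz.sum_nonneg _) (hz.sum_nonneg _)
    e0 e1 e2 e3 e4 e5 e6
  have := Finset.card_pos.mpr n0
  have := Finset.card_pos.mpr n1
  have := Finset.card_pos.mpr n2
  have := Finset.card_pos.mpr n3
  have := Finset.card_pos.mpr n4
  have := Finset.card_pos.mpr n5
  rw [hn] at hle
  rcases hle with hle | ⟨hle, h7⟩
  · exact Or.inl ⟨by omega, hle⟩
  · exact Or.inr ⟨h7, hle⟩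

lemma isLinked_or_le_aux (h : FarEdges G p x q y) (hr : graphRank G = 5) (hG : G.Connected)
    (hx : ∃ u, G.Adj p u ∧ G.Adj x u) {t : ℝ} {z : V → ℝ} (hz : IsPerron G t z) :
    (∃ κ r, IsLinked G κ r) ∨ (6 ≤ Fintype.card V ∧ (Fintype.card V : ℝ) ≤ t ^ 2) ∨
      (7 ≤ Fintype.card V ∧ (Fintype.card V : ℝ) - 1 ≤ t ^ 2) := by
  by_cases hy : ∃ v, G.Adj q v ∧ G.Adj y v
  · right
    by_cases hxy : G.Adj x y
    · exact h.le_of_both hr hG hxy hx hy hz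
    · obtain ⟨u, hu⟩ := hx
      obtain ⟨v, hv⟩ := hy
      -- If xy is not an edge, then xv is, and v can take the place of y.
      have hxv := (h.cross_of_adj hr hu.1 hv.1 hu.2 hv.2).2 hxy
      exact le_of_both (y := v) ⟨h.px, hv.1, h.pq, h.common⟩ hr hG hxv ⟨u, hu⟩
        ⟨y, h.qy, hv.2.symm⟩ hz
  · push Not at hy
    rcases h.cross_iff hr hy with hc | ⟨hc, hy₁, hy₂⟩
    · exact Or.inl (h.exists_isLinked_of_left hr hG hx hy hc)
    · rcases h.isLinked_or_le_of_left hr hG hx hy hc hy₁ hy₂ hz with h' | h'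
      · exact Or.inl h'
      · exact Or.inr (Or.inr h')

/-- A connected graph of rank five with two vertices at distance at least three is linked or has
a large spectral radius. -/
theorem isLinked_or_le (h : FarEdges G p x q y) (hr : graphRank G = 5) (hG : G.Connected)
    {t : ℝ} {z : V → ℝ} (hz : IsPerron G t z) :
    (∃ κ r, IsLinked G κ r) ∨ (6 ≤ Fintype.card V ∧ (Fintype.card V : ℝ) ≤ t ^ 2) ∨
      (7 ≤ Fintype.card V ∧ (Fintype.card V : ℝ) - 1 ≤ t ^ 2) := by
  rcases h.exists_inner_adj hr with hx | hy
  · exact h.isLinked_or_le_aux hr hG hx hz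
  · exact h.symm.isLinked_or_le_aux hr hG hy hz

end FarEdges

/-! ### The secular lower bound for all graphs of order at least six -/

section LowerBound

lemma exists_adj_of_connected {V : Type*} {G : SimpleGraph V} (hG : G.Connected) {u v : V}
    (huv : u ≠ v) : ∃ w, G.Adj u w := by
  obtain ⟨a, w, rfl, -, h⟩ := exists_crossing_adj hG {u} (Set.mem_singleton u)
    (fun h' : v ∈ ({u} : Set V) => huv h'.symm)
  exact ⟨w, h⟩

variable {V : Type*} [Fintype V] {G : SimpleGraph V}

/-- A connected graph of rank five is linked, or has diameter at most two, or has a large spectral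
radius. -/
lemma isLinked_or_diam_or_le (hG : G.Connected) (hr : graphRank G = 5) {t : ℝ} {z : V → ℝ}
    (hz : IsPerron G t z) :
    (∃ κ r, IsLinked G κ r) ∨ (∀ u v, u ≠ v → ¬ G.Adj u v → ∃ w, G.Adj u w ∧ G.Adj v w) ∨
      (6 ≤ Fintype.card V ∧ (Fintype.card V : ℝ) ≤ t ^ 2) ∨
      (7 ≤ Fintype.card V ∧ (Fintype.card V : ℝ) - 1 ≤ t ^ 2) := by
  by_cases hd : ∀ u v, u ≠ v → ¬ G.Adj u v → ∃ w, G.Adj u w ∧ G.Adj v w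
  · exact Or.inr (Or.inl hd)
  push Not at hd
  obtain ⟨p, q, hne, hpq, hcom⟩ := hd
  obtain ⟨x, hx⟩ := exists_adj_of_connected hG hne
  obtain ⟨y, hy⟩ := exists_adj_of_connected hG hne.symm
  have hfar : FarEdges G p x q y := ⟨hx, hy, hpq, hcom⟩
  rcases hfar.isLinked_or_le hr hG hz with h | h
  · exact Or.inl h
  · exact Or.inr (Or.inr h)

/-- Every connected graph of rank five and order at least six is dominated by a graph of the family
`G₁₀ ∘ (1, 1, 1, 1, m - 1, s - 1)` with secular equation `(t² - t - 2m)(t² - s) = 2`. -/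
theorem exists_secular (hG : G.Connected) (hr : graphRank G = 5) (hn : 6 ≤ Fintype.card V) {t : ℝ}
    {z : V → ℝ} (hz : IsPerron G t z) :
    ∃ m s : ℕ, 1 ≤ m ∧ 2 ≤ s ∧ m + s + 2 = Fintype.card V ∧ 0 < t ∧ 0 < t ^ 2 - t - 2 * m ∧
      2 ≤ (t ^ 2 - t - 2 * m) * (t ^ 2 - s) ∧
      ((t ^ 2 - t - 2 * m) * (t ^ 2 - s) = 2 →
        Nonempty (G ≃g blowup G10 ![1, 1, 1, 1, m - 1, s - 1])) := by
  have := hG.nonempty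
  have ht := hz.nonneg
  have hlarge : (7 ≤ Fintype.card V ∧ (Fintype.card V : ℝ) - 1 ≤ t ^ 2) → ∃ m s : ℕ, 1 ≤ m ∧
      2 ≤ s ∧ m + s + 2 = Fintype.card V ∧ 0 < t ∧ 0 < t ^ 2 - t - 2 * m ∧
      2 < (t ^ 2 - t - 2 * m) * (t ^ 2 - s) := by
    rintro ⟨h7, hle⟩
    obtain ⟨k, hk⟩ := Nat.exists_eq_add_of_le h7
    have h6 : (6 : ℝ) ≤ t ^ 2 := by
      have : (7 : ℝ) ≤ Fintype.card V := by exact_mod_cast h7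
      linarith
    have h24 : 2.4 ≤ t := by nlinarith
    have hP : 1.3 ≤ t ^ 2 - t - 2 := by nlinarith
    -- Here k = n - 7, so m = 1 and s = n - 3; then Q ≥ 2 and P ≥ 1.3 give PQ > 2.
    refine ⟨1, k + 4, le_rfl, by omega, by omega, by linarith, ?_, ?_⟩
    · push_cast; linarith
    · have hQ : (2 : ℝ) ≤ t ^ 2 - ((k + 4 : ℕ) : ℝ) := by
        rw [hk] at hle; push_cast at hle ⊢; linarith
      push_cast at hQ ⊢
      nlinarith
  have hsix : (Fintype.card V = 6 ∧ 16 / 3 ≤ t ^ 2) → ∃ m s : ℕ, 1 ≤ m ∧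
      2 ≤ s ∧ m + s + 2 = Fintype.card V ∧ 0 < t ∧ 0 < t ^ 2 - t - 2 * m ∧
      2 < (t ^ 2 - t - 2 * m) * (t ^ 2 - s) := by
    rintro ⟨h6, hle⟩
    have h23 : 2.3 ≤ t := by nlinarith
    have hP : 0.99 ≤ t ^ 2 - t - 2 := by nlinarith
    -- P ≥ 0.99 and Q ≥ 16/3 - 3 = 7/3, so PQ > 2.
    refine ⟨1, 3, le_rfl, by omega, by omega, by linarith, ?_, ?_⟩
    · push_cast; linarith
    · push_cast; nlinarith
  have hstrict : ((7 ≤ Fintype.card V ∧ (Fintype.card V : ℝ) - 1 ≤ t ^ 2) ∨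
      (Fintype.card V = 6 ∧ 16 / 3 ≤ t ^ 2)) → ∃ m s : ℕ, 1 ≤ m ∧
      2 ≤ s ∧ m + s + 2 = Fintype.card V ∧ 0 < t ∧ 0 < t ^ 2 - t - 2 * m ∧
      2 ≤ (t ^ 2 - t - 2 * m) * (t ^ 2 - s) ∧ ((t ^ 2 - t - 2 * m) * (t ^ 2 - s) = 2 →
        Nonempty (G ≃g blowup G10 ![1, 1, 1, 1, m - 1, s - 1])) := by
    intro h
    obtain ⟨m, s, h1, h2, h3, h4, h5, h6⟩ := h.elim hlarge hsix
    exact ⟨m, s, h1, h2, h3, h4, h5, h6.le, fun h => absurd h h6.ne'⟩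
  rcases isLinked_or_diam_or_le hG hr hz with ⟨κ, r, hκ⟩ | hd | ⟨h6, hle⟩ | h7
  · obtain ⟨h1, h2, h3, h4⟩ := hκ.secular hz rfl rfl rfl rfl rfl
    have hs := sum_card_colourClass κ
    rw [Fin.sum_univ_five] at hs
    have n0 := hκ.one_le_card 0
    have n1 := hκ.one_le_card 1
    have n2 := hκ.one_le_card 2
    have n3 := hκ.one_le_card 3
    have n4 := hκ.one_le_card 4
    have hm : (((colourClass κ 0).card + (colourClass κ 1).card + (colourClass κ 2).card - 2 : ℕ) :
        ℝ) = (colourClass κ 0).card + (colourClass κ 1).card + (colourClass κ 2).card - 2 := by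
      rw [Nat.cast_sub (by omega)]
      push_cast
      ring
    refine ⟨(colourClass κ 0).card + (colourClass κ 1).card + (colourClass κ 2).card - 2,
      (colourClass κ 3).card + (colourClass κ 4).card, by omega, by omega, by omega, h1, ?_, ?_, ?_⟩
    · rw [hm]; exact h2
    · rw [hm]; push_cast; exact h3
    · rw [hm]
      push_cast
      intro h
      obtain ⟨e3, e1, e2, hl⟩ := h4 h
      have := hκ.nonempty_iso rfl e1 e2 e3 rfl hl
      rwa [e1, e2, e3,
        show (colourClass κ 0).card + 1 + 1 - 2 - 1 = (colourClass κ 0).card - 1 by omega,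
        Nat.add_sub_cancel_left]
  · refine hstrict ?_
    rcases hn.lt_or_eq with h | h
    · exact Or.inl ⟨h, le_sq_of_diam_two hz hG hd⟩
    · exact Or.inr ⟨h.symm, le_sq_of_card_six hz hG (by omega) h.symm hd⟩
  · refine hstrict ?_
    rcases h6.lt_or_eq with h | h
    · exact Or.inl ⟨h, by linarith⟩
    · refine Or.inr ⟨h.symm, ?_⟩
      rw [← h] at hle
      push_cast at hle
      linarith
  · exact hstrict (Or.inl h7)

end LowerBound

/-! ### The extremal family and its secular equation -/

section Extremal

/-- The graph `G₁₀ ∘ (1, 1, 1, 1, k, j)`. -/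
abbrev linkGraph (k j : ℕ) : SimpleGraph (Σ i, Fin ((![1, 1, 1, 1, k, j] : Fin 6 → ℕ) i)) :=
  blowup G10 ![1, 1, 1, 1, k, j]

lemma ind_blowup {ι : Type*} {H : SimpleGraph ι} {m : ι → ℕ} (a b : Σ i, Fin (m i)) :
    ind (blowup H m) a b = ind H a.1 b.1 := by
  by_cases h : H.Adj a.1 b.1
  · rw [ind_of_adj h, ind_of_adj (G := blowup H m) h]
  · rw [ind_of_not_adj h, ind_of_not_adj (G := blowup H m) h]

lemma isPerron_blowup {ι : Type*} [Fintype ι] {H : SimpleGraph ι} {m : ι → ℕ} {t : ℝ} {w : ι → ℝ}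
    (hw : ∀ i, 0 < w i) (h : ∀ i, ∑ j, ind H i j * (m j * w j) = t * w i) :
    IsPerron (blowup H m) t (fun v => w v.1) where
  pos v := hw v.1
  eq v := by
    rw [← h v.1, Fintype.sum_sigma]
    refine Finset.sum_congr rfl fun j _ => ?_
    simp only [ind_blowup, Finset.sum_const, Finset.card_univ, Fintype.card_fin, nsmul_eq_mul]
    ring

lemma ind_G10 (i j : Fin 6) : ind G10 i j = (![![0, 1, 1, 1, 0, 0], ![1, 0, 1, 0, 1, 0],
    ![1, 1, 0, 0, 1, 0], ![1, 0, 0, 0, 0, 1], ![0, 1, 1, 0, 0, 0], ![0, 0, 0, 1, 0, 0]] :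
    Fin 6 → Fin 6 → ℝ) i j := by
  fin_cases i <;> fin_cases j <;> simp [ind, G10]

lemma isPerron_linkGraph {k j : ℕ} {t : ℝ} (ht : 0 < t) (hP : 0 < t ^ 2 - t - 2 * ((k : ℝ) + 1))
    (h : (t ^ 2 - t - 2 * ((k : ℝ) + 1)) * (t ^ 2 - (j + 1)) = 2) :
    ∃ x, IsPerron (linkGraph k j) t x := by
  set P := t ^ 2 - t - 2 * ((k : ℝ) + 1) with hPdef
  -- Normalise vertices 1 and 2 to weight 1. Their equations then force weight P at the centre, the
  -- vertices 0, 4, 5 follow from their own equations, and the equation at the centre is PQ = 2.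
  refine ⟨_, isPerron_blowup (w := ![(P + 2) / t, 1, 1, P, 2 / t, P / t]) ?_ ?_⟩
  · intro i
    fin_cases i <;> simp <;> positivity
  · intro i
    rw [Fin.sum_univ_six]
    fin_cases i <;> simp [ind_G10] <;> field_simp
    · ring
    · linarith
    · linarith
    · linarith
    · norm_num

lemma card_linkGraph (k j : ℕ) :
    Fintype.card (Σ i, Fin ((![1, 1, 1, 1, k, j] : Fin 6 → ℕ) i)) = k + j + 4 := by
  simp [Fintype.card_sigma, Fin.sum_univ_six]
  ring

lemma linkGraph_connected (k j : ℕ) : (linkGraph k j).Connected := by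
  have h0 : ∀ v, (linkGraph k j).Reachable v ⟨0, (0 : Fin 1)⟩ := by
    have hadj : ∀ {u v : Σ i, Fin ((![1, 1, 1, 1, k, j] : Fin 6 → ℕ) i)}, G10.Adj u.1 v.1 →
        (linkGraph k j).Reachable u v := fun h => SimpleGraph.Adj.reachable h
    have h1 : (linkGraph k j).Reachable ⟨1, (0 : Fin 1)⟩ ⟨0, (0 : Fin 1)⟩ := hadj (by simp [G10])
    have h3 : (linkGraph k j).Reachable ⟨3, (0 : Fin 1)⟩ ⟨0, (0 : Fin 1)⟩ := hadj (by simp [G10])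
    rintro ⟨i, a⟩
    fin_cases i
    · have : a = (0 : Fin 1) := Subsingleton.elim (α := Fin 1) _ _
      subst this
      exact SimpleGraph.Reachable.refl _
    · exact hadj (by simp [G10])
    · exact hadj (by simp [G10])
    · exact hadj (by simp [G10])
    · exact (hadj (v := ⟨1, (0 : Fin 1)⟩) (by simp [G10])).trans h1
    · exact (hadj (v := ⟨3, (0 : Fin 1)⟩) (by simp [G10])).trans h3
  have : Nonempty (Σ i, Fin ((![1, 1, 1, 1, k, j] : Fin 6 → ℕ) i)) := ⟨⟨0, (0 : Fin 1)⟩⟩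
  exact ⟨fun u v => (h0 u).trans (h0 v).symm⟩

lemma graphRank_linkGraph (k : ℕ) {j : ℕ} (hj : 1 ≤ j) : graphRank (linkGraph k j) = 5 := by
  let f : Fin 5 → Σ i, Fin ((![1, 1, 1, 1, k, j] : Fin 6 → ℕ) i) :=
    ![⟨0, (0 : Fin 1)⟩, ⟨1, (0 : Fin 1)⟩, ⟨2, (0 : Fin 1)⟩, ⟨3, (0 : Fin 1)⟩,
      ⟨5, (⟨0, hj⟩ : Fin j)⟩]
  refine le_antisymm (graphRank_le_of_span f fun u => ?_) (le_graphRank f fun c hc => ?_)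
  · obtain ⟨i, a⟩ := u
    -- Row 4 is row 0 minus row 5: the neighbours of 0 are those of 4 together with 3, the only
    -- neighbour of 5.
    refine ⟨(![![1, 0, 0, 0, 0], ![0, 1, 0, 0, 0], ![0, 0, 1, 0, 0], ![0, 0, 0, 1, 0],
      ![1, 0, 0, 0, -1], ![0, 0, 0, 0, 1]] : Fin 6 → Fin 5 → ℝ) i, fun v => ?_⟩
    obtain ⟨l, b⟩ := v
    simp only [ind_blowup, Fin.sum_univ_five, f]
    clear a b
    fin_cases i <;> fin_cases l <;> simp [ind_G10]
  · have h0 := hc (f 0)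
    have h1 := hc (f 1)
    have h2 := hc (f 2)
    have h3 := hc (f 3)
    have h4 := hc (f 4)
    simp [ind_blowup, Fin.sum_univ_five, f, ind_G10] at h0 h1 h2 h3 h4
    intro i
    fin_cases i <;> simp <;> linarith

/-- The secular equation of the extremal family has a root. -/
lemma exists_secular_root (m s : ℕ) : ∃ t : ℝ, 0 < t ∧ 0 < t ^ 2 - t - 2 * m ∧
    (t ^ 2 - t - 2 * m) * (t ^ 2 - s) = 2 := by
  have hm : (0 : ℝ) ≤ m := Nat.cast_nonneg m
  have hs : (0 : ℝ) ≤ s := Nat.cast_nonneg s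
  set w := √(1 + 8 * (m : ℝ)) with hw
  have hw2 : w ^ 2 = 1 + 8 * m := Real.sq_sqrt (by positivity)
  have hw1 : 1 ≤ w := by
    rw [hw, Real.one_le_sqrt]; linarith
  have hroot : ((1 + w) / 2) ^ 2 - (1 + w) / 2 - 2 * m = 0 := by linarith
  have hT : (1 + w) / 2 ≤ 2 * m + s + 3 := by nlinarith
  have hcont : ContinuousOn (fun t : ℝ => (t ^ 2 - t - 2 * m) * (t ^ 2 - s))
      (Set.Icc ((1 + w) / 2) (2 * m + s + 3)) := by fun_prop
  obtain ⟨t, ⟨ht1, ht2⟩, ht⟩ := intermediate_value_Icc hT hcont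
    (show (2 : ℝ) ∈ Set.Icc _ _ from by
      constructor
      · show (((1 + w) / 2) ^ 2 - (1 + w) / 2 - 2 * m) * _ ≤ 2
        rw [hroot, zero_mul]; norm_num
      · have h1 : (2 : ℝ) ≤ (2 * m + s + 3) ^ 2 - (2 * m + s + 3) - 2 * m := by nlinarith
        have h2 : (1 : ℝ) ≤ (2 * m + s + 3) ^ 2 - s := by nlinarith
        show (2 : ℝ) ≤ ((2 * m + s + 3) ^ 2 - (2 * m + s + 3) - 2 * m) * ((2 * m + s + 3) ^ 2 - s)
        nlinarith)
  have ht' : (t ^ 2 - t - 2 * m) * (t ^ 2 - s) = 2 := ht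
  refine ⟨t, by linarith, ?_, ht'⟩
  have h0 : 0 ≤ t ^ 2 - t - 2 * m := by nlinarith
  refine lt_of_le_of_ne h0 fun h => ?_
  rw [← h, zero_mul] at ht'
  norm_num at ht'

/-- If t' < t, then t' > 1 and both factors are positive at t' and strictly larger at t, so the
product at t' would be below 2. -/
lemma secular_mono {m s : ℝ} (hm : 0 ≤ m) {t t' : ℝ}
    (h : (t ^ 2 - t - 2 * m) * (t ^ 2 - s) = 2) (ht' : 0 < t') (hP' : 0 < t' ^ 2 - t' - 2 * m)
    (h' : 2 ≤ (t' ^ 2 - t' - 2 * m) * (t' ^ 2 - s)) : t ≤ t' := by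
  by_contra! hlt
  have h1 : 1 < t' := by nlinarith
  have hP : t' ^ 2 - t' - 2 * m < t ^ 2 - t - 2 * m := by nlinarith
  have hQ : t' ^ 2 - s < t ^ 2 - s := by nlinarith
  have hQ' : 0 < t' ^ 2 - s := by
    by_contra! h0
    nlinarith [mul_nonneg hP'.le (neg_nonneg.mpr h0)]
  have := mul_lt_mul'' hP hQ hP'.le hQ'.le
  linarith

end Extremal

/-! ### Discrete optimisation of the parameters -/

/-- `t` is the relevant root of the secular equation of `G₁₀ ∘ (1, 1, 1, 1, m - 1, s - 1)`. -/
structure IsSecularRoot (m s : ℕ) (t : ℝ) : Prop where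
  pos : 0 < t
  posP : 0 < t ^ 2 - t - 2 * m
  eq : (t ^ 2 - t - 2 * m) * (t ^ 2 - s) = 2

lemma IsSecularRoot.le {m s : ℕ} {t t' : ℝ} (h : IsSecularRoot m s t) (ht' : 0 < t')
    (hP' : 0 < t' ^ 2 - t' - 2 * m) (h' : 2 ≤ (t' ^ 2 - t' - 2 * m) * (t' ^ 2 - s)) : t ≤ t' :=
  secular_mono (Nat.cast_nonneg m) h.eq ht' hP' h'

lemma IsSecularRoot.posQ {m s : ℕ} {t : ℝ} (h : IsSecularRoot m s t) : 0 < t ^ 2 - s := by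
  by_contra! h0
  nlinarith [mul_nonneg h.posP.le (neg_nonneg.mpr h0), h.eq]

/-- The parameters `m`, `s` minimise the secular root `t` among those of order `n`. -/
structure IsOptimal (n m s : ℕ) (t : ℝ) : Prop extends IsSecularRoot m s t where
  one_le : 1 ≤ m
  two_le : 2 ≤ s
  order : m + s + 2 = n
  min : ∀ m' s' t', 1 ≤ m' → 2 ≤ s' → m' + s' + 2 = n → IsSecularRoot m' s' t' → t ≤ t'

lemma exists_isOptimal {n : ℕ} (hn : 6 ≤ n) : ∃ m s t, IsOptimal n m s t := by
  have hroot : ∀ m : ℕ, ∃ t, IsSecularRoot m (n - 2 - m) t := fun m => by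
    obtain ⟨t, h1, h2, h3⟩ := exists_secular_root m (n - 2 - m)
    exact ⟨t, h1, h2, h3⟩
  choose τ hτ using hroot
  obtain ⟨m, hm, hmin⟩ := Finset.exists_min_image (Finset.Icc 1 (n - 4)) τ ⟨1, by simp; omega⟩
  rw [Finset.mem_Icc] at hm
  refine ⟨m, n - 2 - m, τ m, hτ m, hm.1, by omega, by omega, fun m' s' t' h1 h2 h3 h => ?_⟩
  have hs : s' = n - 2 - m' := by omega
  subst hs
  exact (hmin m' (Finset.mem_Icc.mpr ⟨h1, by omega⟩)).trans ((hτ m').le h.pos h.posP h.eq.ge)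

namespace IsOptimal

variable {n m s : ℕ} {t : ℝ}

/-- If the secular value at other parameters exceeds `2`, then these parameters are better. -/
lemma secular_le (h : IsOptimal n m s t) {m' s' : ℕ} (h1 : 1 ≤ m') (h2 : 2 ≤ s')
    (h3 : m' + s' + 2 = n) (hP : 0 < t ^ 2 - t - 2 * m') :
    (t ^ 2 - t - 2 * m') * (t ^ 2 - s') ≤ 2 := by
  obtain ⟨τ, k1, k2, k3⟩ := exists_secular_root m' s'
  have hτ : IsSecularRoot m' s' τ := ⟨k1, k2, k3⟩
  have h4 := h.min m' s' τ h1 h2 h3 hτ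
  by_contra! hlt
  have h5 : τ = t := le_antisymm (hτ.le h.pos hP hlt.le) h4
  rw [h5] at k3
  linarith

/-- Passing to (m + 1, s - 1) turns PQ into (P - 2)(Q + 1), which by optimality cannot exceed 2 =
PQ. -/
lemma le_of_three_le (h : IsOptimal n m s t) (hs : 3 ≤ s) :
    t ^ 2 - t - 2 * m ≤ 2 * (t ^ 2 - s) + 2 := by
  have hQ := h.posQ
  by_cases hP : 0 < t ^ 2 - t - 2 * ((m + 1 : ℕ) : ℝ)
  · have h1 := h.secular_le (m' := m + 1) (s' := s - 1) (by omega) (by omega)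
      (by have := h.order; omega) hP
    rw [Nat.cast_sub (by omega)] at h1
    push_cast at h1
    nlinarith [h.eq]
  · push_cast at hP
    linarith

/-- Passing to (m - 1, s + 1) gives (P + 2)(Q - 1) ≤ 2 = PQ. -/
lemma le_of_two_le (h : IsOptimal n m s t) (hm : 2 ≤ m) :
    2 * (t ^ 2 - s) ≤ t ^ 2 - t - 2 * m + 2 := by
  have hcast : ((m - 1 : ℕ) : ℝ) = m - 1 := by rw [Nat.cast_sub (by omega)]; norm_num
  have h1 := h.secular_le (m' := m - 1) (s' := s + 1) (by omega) (by have := h.two_le; omega)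
      (by have := h.order; omega) (by rw [hcast]; have := h.posP; linarith)
  rw [hcast] at h1
  push_cast at h1
  nlinarith [h.eq]

/-- Here Q = (√5 - 1)/2 is irrational. Eliminating t makes (2j + 2)Q an integer, so j = -1 and t =
-1 - Q is negative. -/
lemma false_of_sq_add_self_eq_one {Q t : ℝ} (hQ : 0 < Q) (hQ2 : Q ^ 2 + Q = 1) (ht : 0 < t)
    (j s : ℤ) (h1 : t = j - Q) (h2 : t ^ 2 = Q + s) : False := by
  have h3 : (2 * (j : ℝ) + 2) * Q = j ^ 2 + 1 - s := by rw [h1] at h2; linarith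
  have h5 : √5 = 2 * Q + 1 := by
    rw [show (5 : ℝ) = (2 * Q + 1) ^ 2 by linarith, Real.sqrt_sq (by linarith)]
  have hirr : Irrational √5 := by
    have := Nat.Prime.irrational_sqrt (p := 5) (by norm_num)
    exact_mod_cast this
  have hj : (2 * (j : ℝ) + 2) = 0 := by
    by_contra hne
    refine hirr ⟨2 * ((j ^ 2 + 1 - s) / (2 * j + 2)) + 1, ?_⟩
    rw [h5]
    push_cast
    rw [← h3, mul_div_cancel_left₀ _ hne]
  have : (j : ℝ) = -1 := by linarith
  rw [this] at h1
  linarith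

/-- If m and m + d + 1 share the root t, subtracting their equations gives P = 2Q + 2(d + 1), while
optimality gives P ≤ 2Q + 2. So d = 0 and PQ = 2 becomes Q² + Q = 1. -/
lemma unique_of_lt (h : IsOptimal n m s t) {m' s' : ℕ} (h' : IsOptimal n m' s' t) (hlt : m < m') :
    False := by
  have o1 := h.order
  have o2 := h'.order
  have hs' := h'.two_le
  have h1 := h.le_of_three_le (by omega)
  obtain ⟨d, rfl⟩ := Nat.exists_eq_add_of_lt hlt
  have hs : s = s' + d + 1 := by omega
  subst hs
  have e1 := h.eq
  have e2 := h'.eq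
  have hQ := h.posQ
  have hd : (0 : ℝ) ≤ d := Nat.cast_nonneg d
  push_cast at h1 e1 e2 hQ
  have e3 : t ^ 2 - t - 2 * m = 2 * (t ^ 2 - (s' + d + 1)) + 2 * (d + 1) := by
    have : ((d : ℝ) + 1) * (t ^ 2 - t - 2 * m - (2 * (t ^ 2 - (s' + d + 1)) + 2 * (d + 1))) =
        0 := by
      linear_combination e2 - e1
    rcases mul_eq_zero.mp this with h0 | h0
    · linarith
    · linarith
  have hd0 : (d : ℝ) = 0 := by linarith
  rw [hd0] at e1 e3 hQ
  refine false_of_sq_add_self_eq_one (Q := t ^ 2 - (s' + 0 + 1)) hQ ?_ h.pos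
    ((s' : ℤ) + 1 - 2 * m - 2) ((s' : ℤ) + 1) ?_ ?_
  · rw [e3] at e1
    linarith
  · push_cast
    linarith
  · push_cast
    ring

lemma unique (h : IsOptimal n m s t) {m' s' : ℕ} (h' : IsOptimal n m' s' t) : m' = m := by
  rcases lt_trichotomy m' m with hlt | heq | hlt
  · exact (h'.unique_of_lt h hlt).elim
  · exact heq
  · exact (h.unique_of_lt h' hlt).elim

/-- This is the inequality of arithmetic and geometric means for P and 2Q, whose product is 4. -/
lemma four_le (h : IsOptimal n m s t) : 4 ≤ t ^ 2 - t - 2 * m + 2 * (t ^ 2 - s) := by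
  nlinarith [h.eq, h.posP, h.posQ, sq_nonneg (t ^ 2 - t - 2 * m - 2 * (t ^ 2 - s))]

/-- Comparison with the stationary point `t₀ = (1 + √(24n + 1)) / 6`. -/
lemma compare (h : IsOptimal n m s t) :
    -9 * (t ^ 2 - t - 2 * m - 2) ≤ 18 * (m : ℝ) - (6 * n - 19 - √(24 * (n : ℝ) + 1)) ∧
      18 * (m : ℝ) - (6 * n - 19 - √(24 * (n : ℝ) + 1)) ≤
        3 * (t ^ 2 - t - 2 * m + 2 * (t ^ 2 - s) - 4) - 9 * (t ^ 2 - t - 2 * m - 2) := by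
  set w := √(24 * (n : ℝ) + 1) with hw
  have hw2 : w ^ 2 = 24 * n + 1 := Real.sq_sqrt (by positivity)
  have hw0 : 0 ≤ w := Real.sqrt_nonneg _
  have hn : (n : ℝ) = m + s + 2 := by exact_mod_cast h.order.symm
  have h4 := h.four_le
  have hm : (1 : ℝ) ≤ m := by exact_mod_cast h.one_le
  have ht1 : 1 < t := by nlinarith [h.posP, h.pos]
  obtain ⟨t₀, ht₀⟩ : ∃ t₀ : ℝ, w = 6 * t₀ - 1 := ⟨(w + 1) / 6, by ring⟩
  have e0 : 3 * t₀ ^ 2 - t₀ = 2 * n := by rw [ht₀] at hw2; linarith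
  -- P + 2Q - 4 = 3t² - t - 2n vanishes at t₀. In these terms the middle quantity of the claim is
  -- 9(t - t₀)(t + t₀ - 1) - 9(P - 2), and both bounds follow from t ≥ t₀.
  have e1 : (t - t₀) * (3 * (t + t₀) - 1) = t ^ 2 - t - 2 * m + 2 * (t ^ 2 - s) - 4 := by
    linarith
  have ht0 : t₀ ≤ t := by
    by_contra! hlt
    nlinarith
  have ht00 : 0 ≤ t₀ := by linarith
  have g1 : 0 ≤ (t - t₀) * (t + t₀ - 1) := mul_nonneg (by linarith) (by linarith)
  constructor <;> nlinarith

lemma lt_of_two_le (h : IsOptimal n m s t) (hm : 2 ≤ m) :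
    18 * (m : ℝ) < 6 * n - 1 - √(24 * (n : ℝ) + 1) := by
  have h1 := h.compare.2
  have h2 := h.le_of_two_le hm
  have := h.posP
  linarith

lemma lt_of_three_le (h : IsOptimal n m s t) (hs : 3 ≤ s) :
    6 * n - 37 - √(24 * (n : ℝ) + 1) < 18 * (m : ℝ) := by
  have h1 := h.compare.1
  have h2 := h.le_of_three_le hs
  have hP4 : t ^ 2 - t - 2 * m < 4 := by
    have := h.posP
    have := h.eq
    nlinarith
  linarith

lemma three_le (h : IsOptimal n m s t) (hn : 6 ≤ n) : 3 ≤ s := by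
  have ho := h.order
  have h2 := h.two_le
  by_contra hs
  have hs2 : s = 2 := by omega
  have h3 := h.lt_of_two_le (by omega)
  have hm : (m : ℝ) = n - 4 := by
    have : ((m + 4 : ℕ) : ℝ) = n := by exact_mod_cast (by omega : m + 4 = n)
    push_cast at this
    linarith
  have hn6 : (6 : ℝ) ≤ n := by exact_mod_cast hn
  have := Real.sqrt_nonneg (24 * (n : ℝ) + 1)
  linarith

/-- The two one-step comparisons place m - 1 at distance less than one from the stated real number.
-/
lemma eq_floor_or_ceil (h : IsOptimal n m s t) (hn : 12 ≤ n) :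
    ((m - 1 : ℕ) : ℤ) = ⌊(6 * (n : ℝ) - 37 - √(24 * (n : ℝ) + 1)) / 18⌋ ∨
      ((m - 1 : ℕ) : ℤ) = ⌈(6 * (n : ℝ) - 37 - √(24 * (n : ℝ) + 1)) / 18⌉ := by
  have h1 := h.one_le
  have hlow := h.lt_of_three_le (h.three_le (by omega))
  have hn12 : (12 : ℝ) ≤ n := by exact_mod_cast hn
  have hup : 18 * (m : ℝ) < 6 * n - 1 - √(24 * (n : ℝ) + 1) := by
    rcases h1.lt_or_eq with h2 | h2
    · exact h.lt_of_two_le h2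
    -- For m = 1 there is no smaller m to compare with; n ≥ 12 gives the upper bound directly.
    · have : √(24 * (n : ℝ) + 1) ≤ 6 * n - 37 := by
        rw [Real.sqrt_le_left (by linarith)]
        nlinarith
      rw [← h2]
      push_cast
      linarith
  have hcast : (((m - 1 : ℕ) : ℤ) : ℝ) = m - 1 := by
    push_cast [Nat.cast_sub h1]; ring
  by_cases hk : (m : ℝ) - 1 ≤ (6 * (n : ℝ) - 37 - √(24 * (n : ℝ) + 1)) / 18
  · left
    symm
    rw [Int.floor_eq_iff, hcast]
    constructor <;> linarith
  · right
    symm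
    rw [Int.ceil_eq_iff, hcast]
    constructor <;> linarith

/-- The upper bound leaves only m = 2 to exclude. Comparison with m = 1 yields P(P + 2) ≥ 4, so P ≥
√5 - 1 > 1.2; but Q = 2/P and s ≤ 6 keep t below 2.77, where t² - t - 4 < 1.2. -/
lemma eq_one (h : IsOptimal n m s t) (hn : n ≤ 10) : m = 1 := by
  have h1 := h.one_le
  by_contra hne
  have h2 : 2 ≤ m := by omega
  have hup := h.lt_of_two_le h2
  have hn10 : (n : ℝ) ≤ 10 := by exact_mod_cast hn
  have ho : (m : ℝ) + s + 2 = n := by exact_mod_cast h.order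
  have hw : 5 ≤ √(24 * (n : ℝ) + 1) := by
    have : (1 : ℝ) ≤ n := by exact_mod_cast (by have := h.order; omega : 1 ≤ n)
    rw [Real.le_sqrt' (by norm_num)]
    linarith
  have hm3 : m < 3 := by
    have : (m : ℝ) < 3 := by linarith
    exact_mod_cast this
  have hm : m = 2 := by omega
  subst hm
  have hle := h.le_of_two_le le_rfl
  have e := h.eq
  have hP := h.posP
  have hQ := h.posQ
  push_cast at hle e hP ho
  set P := t ^ 2 - t - 2 * 2 with hPdef
  set Q := t ^ 2 - (s : ℝ) with hQdef
  have hP12 : 1.2 ≤ P := by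
    by_contra! hlt
    nlinarith
  have hQ17 : Q ≤ 1.67 := by nlinarith
  have ht : t ^ 2 < 2.77 ^ 2 := by linarith
  have ht' : t < 2.77 := lt_of_pow_lt_pow_left₀ 2 (by norm_num) ht
  nlinarith [h.pos]

/-- The upper bound gives m ≤ 2. For m = 1, s = 8, comparison with m = 2 yields P(P - 2) ≤ 4, so P ≤
1 + √5 < 3.3; then t ≤ 2.9 and Q ≤ 0.5, contradicting PQ = 2. -/
lemma eq_two (h : IsOptimal n m s t) (hn : n = 11) : m = 2 := by
  have h1 := h.one_le
  have ho := h.order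
  rcases h1.lt_or_eq with h2 | h2
  · have hup := h.lt_of_two_le h2
    have hw : 12 ≤ √(24 * (n : ℝ) + 1) := by
      rw [hn, Real.le_sqrt' (by norm_num)]
      norm_num
    have hm3 : m < 3 := by
      have hn' : (n : ℝ) = 11 := by exact_mod_cast hn
      have : (m : ℝ) < 3 := by linarith
      exact_mod_cast this
    omega
  · exfalso
    have hs : s = 8 := by omega
    have hle := h.le_of_three_le (by omega)
    have e := h.eq
    have hP := h.posP
    have hQ := h.posQ
    subst hs
    subst h2
    push_cast at hle e hP hQ
    have hP33 : t ^ 2 - t - 2 * 1 ≤ 3.3 := by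
      by_contra! hlt
      nlinarith
    have ht : t ≤ 2.9 := by
      by_contra! hlt
      nlinarith
    have hQ5 : t ^ 2 - 8 ≤ 0.5 := by nlinarith [h.pos]
    nlinarith

end IsOptimal

/-! ### From optimal parameters to the unique minimizer -/

lemma IsPerron.graphSpectralRadius_le_iff {V W : Type*} [Fintype V] [Fintype W] [Nonempty V]
    [Nonempty W] {G : SimpleGraph V} {H : SimpleGraph W} {t t' : ℝ} {x : V → ℝ} {y : W → ℝ} (hx : IsPerron G t x)
    (hy : IsPerron H t' y) : graphSpectralRadius G ≤ graphSpectralRadius H ↔ t ≤ t' := by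
  rw [hx.graphSpectralRadius_eq, hy.graphSpectralRadius_eq, ENNReal.ofReal_le_ofReal_iff hy.nonneg]

lemma graphSpectralRadius_iso {V W : Type*} [Fintype V] [Fintype W] {G : SimpleGraph V}
    {H : SimpleGraph W} (hG : G.Connected) (e : G ≃g H) :
    graphSpectralRadius G = graphSpectralRadius H := by
  obtain ⟨t, x, hx⟩ := exists_isPerron hG
  have := hG.nonempty
  have : Nonempty W := e.toEquiv.symm.nonempty
  rw [hx.graphSpectralRadius_eq, (hx.iso e.symm).graphSpectralRadius_eq]

lemma IsMinimizer.of_iso {V W : Type*} [Fintype V] [Fintype W] {G : SimpleGraph V}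
    {H : SimpleGraph W} {n r : ℕ} (h : IsMinimizer n r G) (e : G ≃g H) : IsMinimizer n r H := by
  obtain ⟨h1, h2, h3, h4⟩ := h
  refine ⟨(Fintype.card_congr e.toEquiv).symm.trans h1, e.connected_iff.mp h2,
    (graphRank_iso e).symm.trans h3, fun K hK hrK => ?_⟩
  rw [← graphSpectralRadius_iso h2 e]
  exact h4 K hK hrK

lemma IsTheMinimizer.of_iso {W W' : Type*} [Fintype W] [Fintype W'] {F : SimpleGraph W}
    {F' : SimpleGraph W'} {n r : ℕ} (h : IsTheMinimizer.{u} n r F) (e : F ≃g F') :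
    IsTheMinimizer.{u} n r F' := by
  refine ⟨h.1.of_iso e, fun V _ G hG => ?_⟩
  obtain ⟨e'⟩ := h.2 V G hG
  exact ⟨e'.trans e⟩

/-- A minimizer has spectral radius at most that of any connected graph of the same order and
rank. -/
lemma IsMinimizer.le {V W : Type*} [Fintype V] [Fintype W] {G : SimpleGraph V}
    {H : SimpleGraph W} {n r : ℕ} (h : IsMinimizer n r G) (hn : Fintype.card W = n)
    (hH : H.Connected) (hr : graphRank H = r) : graphSpectralRadius G ≤ graphSpectralRadius H := by
  have e := H.overFinIso hn
  rw [graphSpectralRadius_iso hH e]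
  exact h.2.2.2 _ (e.connected_iff.mp hH) ((graphRank_iso e).symm.trans hr)

lemma IsOptimal.isTheMinimizer {n m s : ℕ} {t : ℝ} (h : IsOptimal n m s t) (hn : 6 ≤ n) :
    IsTheMinimizer.{u} n 5 (linkGraph (m - 1) (s - 1)) := by
  have hm := h.one_le
  have hs := h.two_le
  have ho := h.order
  have cm : ((m - 1 : ℕ) : ℝ) + 1 = m := by exact_mod_cast Nat.sub_add_cancel hm
  have cs : ((s - 1 : ℕ) : ℝ) + 1 = s := by exact_mod_cast Nat.sub_add_cancel (by omega : 1 ≤ s)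
  obtain ⟨x, hx⟩ := isPerron_linkGraph (k := m - 1) (j := s - 1) (t := t) h.pos
    (by rw [cm]; exact h.posP) (by rw [cm, cs]; exact h.eq)
  have hconn := linkGraph_connected (m - 1) (s - 1)
  have hrank := graphRank_linkGraph (m - 1) (j := s - 1) (by omega)
  have hcard : Fintype.card (Σ i, Fin ((![1, 1, 1, 1, m - 1, s - 1] : Fin 6 → ℕ) i)) = n := by
    rw [card_linkGraph]; omega
  have := hconn.nonempty
  refine ⟨⟨hcard, hconn, hrank, fun H hH hrH => ?_⟩, fun V _ G hG => ?_⟩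
  · obtain ⟨t', y, hy⟩ := exists_isPerron hH
    have := hH.nonempty
    rw [hx.graphSpectralRadius_le_iff hy]
    obtain ⟨m', s', h1, h2, h3, h4, h5, h6, -⟩ := exists_secular hH hrH (by simpa using hn) hy
    obtain ⟨τ, k1, k2, k3⟩ := exists_secular_root m' s'
    have hτ : IsSecularRoot m' s' τ := ⟨k1, k2, k3⟩
    exact (h.min m' s' τ h1 h2 (by simpa using h3) hτ).trans (hτ.le h4 h5 h6)
  · have hle := hG.le hcard hconn hrank
    obtain ⟨c1, c2, c3, -⟩ := hG
    obtain ⟨t', y, hy⟩ := exists_isPerron c2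
    have := c2.nonempty
    rw [hy.graphSpectralRadius_le_iff hx] at hle
    obtain ⟨m', s', h1, h2, h3, h4, h5, h6, h7⟩ := exists_secular c2 c3 (by omega) hy
    obtain ⟨τ, k1, k2, k3⟩ := exists_secular_root m' s'
    have hτ : IsSecularRoot m' s' τ := ⟨k1, k2, k3⟩
    have l1 := h.min m' s' τ h1 h2 (by omega) hτ
    have l2 := hτ.le h4 h5 h6
    -- The inequalities t ≤ τ ≤ t' ≤ t close up, so the parameters of G are optimal too and its
    -- secular inequality is an equality.
    have e1 : τ = t := by linarith
    have e2 : t' = t := by linarith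
    subst e1
    subst e2
    have h' : IsOptimal n m' s' t' := ⟨hτ, h1, h2, by omega, h.min⟩
    have hm' := h.unique h'
    subst hm'
    have hs' : s' = s := by omega
    subst hs'
    exact h7 k3

/-- Vertex 4 of `G10` has multiplicity 0, and deleting it leaves `G1` up to relabelling. -/
lemma nonempty_iso_blowup_G1 (j : ℕ) :
    Nonempty (blowup G1 ![1, 1, 1, 1, j] ≃g linkGraph 0 j) := by
  refine nonempty_iso_blowup (fun v => (![0, 1, 3, 2, 5] : Fin 5 → Fin 6) v.1) ?_ ?_
  · intro i
    rw [Finset.card_filter, Fintype.sum_sigma, Fin.sum_univ_five]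
    fin_cases i <;> simp <;> exact Finset.card_fin _
  · rintro ⟨i, a⟩ ⟨l, b⟩
    change G1.Adj i l ↔ G10.Adj ((![0, 1, 3, 2, 5] : Fin 5 → Fin 6) i)
      ((![0, 1, 3, 2, 5] : Fin 5 → Fin 6) l)
    clear a b
    rw [G1_adj_iff, G10_adj_iff]
    revert i l
    decide

/-! ### Order five -/

lemma ind_cycleGraph_five (i j : Fin 5) : ind (SimpleGraph.cycleGraph 5) i j =
    (![![0, 1, 0, 0, 1], ![1, 0, 1, 0, 0], ![0, 1, 0, 1, 0], ![0, 0, 1, 0, 1],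
      ![1, 0, 0, 1, 0]] : Fin 5 → Fin 5 → ℝ) i j := by
  fin_cases i <;> fin_cases j <;>
  first
  | exact ind_of_adj (by decide)
  | exact ind_of_not_adj (by decide)

lemma isPerron_cycleGraph_five : IsPerron (SimpleGraph.cycleGraph 5) 2 fun _ => 1 where
  pos _ := one_pos
  eq v := by
    rw [Fin.sum_univ_five]
    fin_cases v <;> simp [ind_cycleGraph_five] <;> norm_num

lemma graphRank_cycleGraph_five : graphRank (SimpleGraph.cycleGraph 5) = 5 := by
  refine le_antisymm ?_ (le_graphRank id fun c hc => ?_)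
  · rw [graphRank_eq]
    exact (Matrix.rank_le_card_width _).trans (by simp)
  · have h0 := hc 0
    have h1 := hc 1
    have h2 := hc 2
    have h3 := hc 3
    have h4 := hc 4
    simp [ind_cycleGraph_five, Fin.sum_univ_five] at h0 h1 h2 h3 h4
    intro i
    fin_cases i <;> simp <;> linarith

/-- In a linked graph a + b + c ≥ 3, so P > 0 already gives t² - t - 2 > 0; the other large-radius
cases need order at least six. -/
lemma two_lt_or_diam {V : Type*} [Fintype V] {G : SimpleGraph V} {t : ℝ} {x : V → ℝ}
    (hn : Fintype.card V = 5) (hG : G.Connected) (hr : graphRank G = 5) (hx : IsPerron G t x) :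
    2 < t ∨ ∀ u v, u ≠ v → ¬ G.Adj u v → ∃ w, G.Adj u w ∧ G.Adj v w := by
  rcases isLinked_or_diam_or_le hG hr hx with ⟨κ, r, hκ⟩ | hd | ⟨h6, -⟩ | ⟨h7, -⟩
  · obtain ⟨h1, h2, -⟩ := hκ.secular hx rfl rfl rfl rfl rfl
    have n0 : (1 : ℝ) ≤ (colourClass κ 0).card := by exact_mod_cast hκ.one_le_card 0
    have n1 : (1 : ℝ) ≤ (colourClass κ 1).card := by exact_mod_cast hκ.one_le_card 1
    have n2 : (1 : ℝ) ≤ (colourClass κ 2).card := by exact_mod_cast hκ.one_le_card 2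
    left
    nlinarith
  · exact Or.inr hd
  · omega
  · omega

lemma isTheMinimizer_cycleGraph_five : IsTheMinimizer.{u} 5 5 (SimpleGraph.cycleGraph 5) := by
  have hx := isPerron_cycleGraph_five
  have hconn : (SimpleGraph.cycleGraph 5).Connected := SimpleGraph.cycleGraph_connected
  refine ⟨⟨by simp, hconn, graphRank_cycleGraph_five, fun H hH hr => ?_⟩, fun V _ G hG => ?_⟩
  · obtain ⟨t, y, hy⟩ := exists_isPerron hH
    have ht := hy.nonneg
    rw [hx.graphSpectralRadius_le_iff hy]
    rcases two_lt_or_diam (by simp) hH hr hy with h | hd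
    · exact h.le
    · have := le_sq_of_diam_two hy hH hd
      simp only [Fintype.card_fin] at this
      push_cast at this
      nlinarith
  · have hle := hG.le (by simp) hconn graphRank_cycleGraph_five
    obtain ⟨c1, c2, c3, -⟩ := hG
    obtain ⟨t, y, hy⟩ := exists_isPerron c2
    have := c2.nonempty
    rw [hy.graphSpectralRadius_le_iff hx] at hle
    rcases two_lt_or_diam c1 c2 c3 hy with h | hd
    · linarith
    · exact nonempty_iso_cycleGraph_of_le hy c2 (by omega) c1 hd hle

end RankFive

theorem theorem2 (n : ℕ) :
    (n = 5 → RankFive.IsTheMinimizer.{u, 0} n 5 (SimpleGraph.cycleGraph 5)) ∧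
    (6 ≤ n → n ≤ 10 →
      RankFive.IsTheMinimizer.{u, 0} n 5 (RankFive.blowup RankFive.G1 ![1, 1, 1, 1, n - 4])) ∧
    (n = 11 →
      RankFive.IsTheMinimizer.{u, 0} n 5 (RankFive.blowup RankFive.G10 ![1, 1, 1, 1, 1, n - 5])) ∧
    (12 ≤ n → ∃ k : ℕ,
      ((k : ℤ) = ⌊(6 * (n : ℝ) - 37 - Real.sqrt (24 * (n : ℝ) + 1)) / 18⌋ ∨
        (k : ℤ) = ⌈(6 * (n : ℝ) - 37 - Real.sqrt (24 * (n : ℝ) + 1)) / 18⌉) ∧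
      RankFive.IsTheMinimizer.{u, 0} n 5
        (RankFive.blowup RankFive.G10 ![1, 1, 1, 1, k, n - k - 4])) := by
  refine ⟨?_, fun h6 h10 => ?_, fun h11 => ?_, fun h12 => ?_⟩
  · rintro rfl
    exact RankFive.isTheMinimizer_cycleGraph_five
  · obtain ⟨m, s, t, h⟩ := RankFive.exists_isOptimal h6
    have hmin := h.isTheMinimizer h6
    have hm := h.eq_one h10
    have ho := h.order
    rw [show m - 1 = 0 by omega, show s - 1 = n - 4 by omega] at hmin
    obtain ⟨e⟩ := RankFive.nonempty_iso_blowup_G1 (n - 4)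
    exact hmin.of_iso e.symm
  · obtain ⟨m, s, t, h⟩ := RankFive.exists_isOptimal (show 6 ≤ n by omega)
    have hmin := h.isTheMinimizer (by omega)
    have hm := h.eq_two h11
    have ho := h.order
    rwa [show m - 1 = 1 by omega, show s - 1 = n - 5 by omega] at hmin
  · obtain ⟨m, s, t, h⟩ := RankFive.exists_isOptimal (show 6 ≤ n by omega)
    have hmin := h.isTheMinimizer (by omega)
    have hm := h.one_le
    have ho := h.order
    refine ⟨m - 1, h.eq_floor_or_ceil h12, ?_⟩
    rwa [show s - 1 = n - (m - 1) - 4 by omega] at hmin
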